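/- \textbf{Theorem (exponential decay of sensitivity in the interior).} Let $\sigma,\lambda_A,\lambda_B,\lambda_C,\lambda_Q,\lambda_H,\lambda_R,\lambda_G,\lambda_W,\gamma_R,\gamma_Q,\alpha_0,\alpha_1,\beta_0,\beta_1>0$ be constants. Let $T>\sigma$ and consider, for parameters $d\in L^2([0,T];\mathbb R^{n_d})$, $d_0\in\mathbb R^{n_x}$, $d_T\in\mathbb R^{n_d}$, the problem $$\min_{u,x}\ \frac12\int_0^T\begin{bmatrix}x\\u\\d\end{bmatrix}^{\!\top}\begin{bmatrix}Q&H^\top&G^\top\\H&R&W^\top\\G&W&0\end{bmatrix}\begin{bmatrix}x\\u\\d\end{bmatrix}dt+\frac12\begin{bmatrix}x(T)\\d_T\end{bmatrix}^{\!\top}\begin{bmatrix}Q_T&G_T^\top\\G_T&0\end{bmatrix}\begin{bmatrix}x(T)\\d_T\end{bmatrix}$$ $$\text{s.t.}\quad \dot x=A x+B u+C d\ \text{ on }(0,T],\qquad x(0)=d_0,$$ over square-integrable controls $u$. The coefficients satisfy the following assumptions ($\|\cdot\|$ is the Euclidean or operator norm, $\preceq$ the order of symmetric matrices): (1) $A,B,C,Q,H,R,G,W$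 are continuous on $[0,T]$ with norms bounded by $\lambda_A,\lambda_B,\lambda_C,\lambda_Q,\lambda_H,\lambda_R,\lambda_G,\lambda_W$, and $\|G_T\|\le\lambda_G$. (2) Let $\Phi_A$ be the evolution operator of $\dot x=A(t)x$ and $\mathcal W(t_0,t_1)=\int_{t_0}^{t_1}\Phi_A(t_0,s)B(s)B(s)^\top\Phi_A(t_0,s)^\top ds$. For every $t_0\in[0,T-\sigma]$ there is $t_1\in[t_0,t_0+\sigma]$ with $\alpha_0I\preceq \mathcal W(t_0,t_1)\preceq\alpha_1I$ and $\beta_0I\preceq\Phi_A(t_1,t_0)\mathcal W(t_0,t_1)\Phi_A(t_1,t_0)^\top\preceq\beta_1I$. (3) $R(t)\succeq\gamma_RI$ and $Q(t)-H(t)^\top R(t)^{-1}H(t)\succeq\gamma_QI$ for all $t\in[0,T]$, and $\gamma_QI\preceq Q_T\preceq\lambda_QI$. \emph{Solutions.} Let $\mathcal H(t,x,u,\lambda;d)$ be the integrand of the cost (with the factor $\tfrac12$) plus $\lambda^\top(A(t)x+B(t)u+C(t)d)$. The solution $(x^*,u^*,\lambda^*)$ for $(d,d_0,d_T)$ is the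 optimal state and control, with the adjoint given by $\dot\lambda^*=-\nabla_x\mathcal H$, $\lambda^*(T)=Q_Tx^*(T)+G_T^\top d_T$, and with $u^*(t)$ minimizing $\mathcal H(t,x^*(t),\cdot,\lambda^*(t);d(t))$ for every $t\in[0,T]$. \emph{Perturbed solutions.} For $t'\in[0,T]$ and $l_{t'}\in\mathbb R^{n_d}$ let $d_p=d+l_{t'}\delta(\cdot-t')$, with $\delta(\cdot-t')$ the unit point mass at $t'$, counted fully also if $t'\in\{0,T\}$. The perturbed solution $(x_p^*,u_p^*,\lambda_p^*)$ solves the optimality system with $d$ replaced by the measure $d_p$: the state and adjoint equations and $Hx+Ru+B^\top\lambda+W^\top d_p=0$ hold as equations of measures on $[0,T]$, the control being a measure $u_p^*(t)\,dt+\eta\,\delta(\cdot-t')$. Here $x(0)=d_0$ is imposed before a jump at $t'=0$, and the terminal condition uses the value $x(T)$ after a jump at $t'=T$. \emph{Constants.} Put $\kappa=\lambda_A+\lambda_B\lambda_H/\gamma_R$ and $$\alpha_0'=\Big(\tfrac{2}{\alpha_0}+\tfrac{(\lambda_H/\gamma_R)^2}{\lambda_A}\big(1+\tfrac{\alpha_1}{\alpha_0}\big)^2(e^{2\lambda_A\sigma}-1)\Big)^{-1},\quad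 \alpha_1'=\tfrac{\lambda_B^2(e^{2\kappa\sigma}-1)}{2\kappa},\quad \tilde\alpha_0=\tfrac{1-e^{-2\kappa\sigma}}{2\kappa},\quad \tilde\alpha_1=\tfrac{e^{2\kappa\sigma}-1}{2\kappa},$$ $$c_0=e^{-2\kappa\sigma}\min\Big\{2\kappa\Big(\tfrac{\lambda_B^2}{\gamma_R}\big(1+\tfrac{\tilde\alpha_1}{\tilde\alpha_0}\big)^2+\tfrac1{\gamma_Q\tilde\alpha_0^2}\Big)^{-1},\Big(\tfrac{\lambda_B^2}{2\gamma_R\kappa}+\tfrac1{\gamma_Q}\Big)^{-1}\Big\},$$ $$c_1=e^{2\kappa\sigma}\max\Big\{\Big(\big(\lambda_Q+\tfrac{\lambda_H^2}{\gamma_R}\big)\big(1+\tfrac{\alpha_1'}{\alpha_0'}\big)^2+\tfrac{\lambda_R\lambda_B^2}{(\alpha_0')^2}\Big)\tfrac1{2\kappa},\ \big(\lambda_Q+\tfrac{\lambda_H^2}{\gamma_R}\big)\big(1+\tfrac1{2\kappa}\big)\Big\},$$ $$c_Z=\sqrt{c_1/c_0},\qquad \rho_Z(\sigma)=\frac{\gamma_Q}{2c_1},\qquad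 c_v=c_Z\Big(\big(\tfrac{\lambda_W\lambda_B}{\gamma_R}+\lambda_C\big)c_1+\tfrac{\lambda_W\lambda_H}{\gamma_R}+\lambda_G\Big),$$ $$\Lambda_x=c_Z\Big(\tfrac{c_v\lambda_B^2}{2\rho_Z\gamma_R}+\tfrac{\lambda_W\lambda_B}{\gamma_R}+\lambda_C\Big),\qquad \Lambda(\sigma)=\Big(1+\tfrac{\lambda_H}{\gamma_R}+c_1\big(1+\tfrac{\lambda_B}{\gamma_R}\big)\Big)\Lambda_x+c_v\big(1+\tfrac{\lambda_B}{\gamma_R}\big).$$ \emph{Conclusion.} $\rho_Z(\sigma)>0$ and $\Lambda(\sigma)>0$ (neither depends on $T$); the solution for $(d,d_0,d_T)$ exists and is unique on $[0,T]$, and the perturbed solution exists and is unique at all times $t\ne t'$. At every $t\neq t'$ the perturbed solution is the limit of the solutions for the parameters $(d+l_{t'}\varphi_n,d_0,d_T)$, whenever $\varphi_n\in L^2([0,T])$, $\varphi_n\ge0$, $\int_0^T\varphi_n=1$, and for each $\varepsilon>0$ the functions $\varphi_n$ vanish on $\{t\in[0,T]:|t-t'|\ge\varepsilon\}$ for all large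 $n$. Moreover, with $\delta x=x_p^*-x^*$, $\delta u=u_p^*-u^*$, $\delta\lambda=\lambda_p^*-\lambda^*$, $$\|\delta x(t)\|+\|\delta u(t)\|+\|\delta\lambda(t)\|\le\|l_{t'}\|\,\Lambda(\sigma)\,e^{-\rho_Z(\sigma)|t-t'|}\qquad\text{for all } t\in[0,T],\ t\neq t'.$$ -/

import Mathlib

open Set MeasureTheory Filter Topology
open scoped InnerProduct

namespace LQ

/-- `ℝⁿ` with the Euclidean norm. -/
abbrev Vec (n : ℕ) : Type := EuclideanSpace ℝ (Fin n)

/-- Real `m × n` matrices, as linear maps `ℝⁿ → ℝᵐ` with the operator norm; the transpose is the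
adjoint `†`, and `≤` on square matrices is the Loewner order (`M ≤ N` iff `N - M` is symmetric
positive semidefinite). -/
abbrev Mat (m n : ℕ) : Type := Vec n →L[ℝ] Vec m

/-! ### Evolution operator of a linear system -/

/-- `Φ t s` is the evolution operator of `x' = A(t) x` on `[0,T]`:
`∂ₜ Φ(t,s) = A(t) Φ(t,s)`, `Φ(s,s) = I`, for all `s, t ∈ [0,T]` (in either order). -/
def IsEvolution {n : ℕ} (T : ℝ) (A : ℝ → Mat n n) (Φ : ℝ → ℝ → Mat n n) : Prop :=
  ∀ s ∈ Icc 0 T, Φ s s = 1 ∧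
    ∀ t ∈ Icc 0 T, HasDerivWithinAt (fun r => Φ r s) (A t ∘L Φ t s) (Icc 0 T) t

/-- Terms of the Peano--Baker series. -/
noncomputable def peanoBaker {n : ℕ} (A : ℝ → Mat n n) (s : ℝ) : ℕ → ℝ → Mat n n
  | 0 => fun _ => 1
  | k + 1 => fun t => ∫ r in s..t, A r ∘L peanoBaker A s k r

/-- The evolution operator `Φ_A` on `[0,T]`. -/
noncomputable def evolution {n : ℕ} (T : ℝ) (A : ℝ → Mat n n) : ℝ → ℝ → Mat n n :=
  Classical.epsilon (IsEvolution T A)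

theorem peanoBaker_continuous {n : ℕ} {A : ℝ → Mat n n} (hA : Continuous A) (s : ℝ) (k : ℕ) :
    Continuous (peanoBaker A s k) := by
  induction k with
  | zero => exact continuous_const
  | succ k ih =>
    have h : Continuous fun r => A r ∘L peanoBaker A s k r := hA.clm_comp ih
    exact intervalIntegral.continuous_primitive (fun a b => h.intervalIntegrable a b) s

theorem peanoBaker_hasDerivAt {n : ℕ} {A : ℝ → Mat n n} (hA : Continuous A) (s : ℝ) (k : ℕ)
    (t : ℝ) : HasDerivAt (peanoBaker A s (k + 1)) (A t ∘L peanoBaker A s k t) t := by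
  have h : Continuous fun r => A r ∘L peanoBaker A s k r :=
    hA.clm_comp (peanoBaker_continuous hA s k)
  exact intervalIntegral.integral_hasDerivAt_right (h.intervalIntegrable _ _)
    (h.stronglyMeasurableAtFilter _ _) h.continuousAt

theorem peanoBaker_norm_le {n : ℕ} {A : ℝ → Mat n n} {K : ℝ}
    (hK : ∀ t, ‖A t‖ ≤ K) (s : ℝ) (k : ℕ) (t : ℝ) :
    ‖peanoBaker A s k t‖ ≤ (K * |t - s|) ^ k / (k.factorial : ℝ) := by
  have hK0 : 0 ≤ K := (norm_nonneg _).trans (hK 0)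
  induction k generalizing t with
  | zero =>
    have h1 : ‖(1 : Mat n n)‖ ≤ 1 := ContinuousLinearMap.norm_id_le
    simpa [peanoBaker] using h1
  | succ k ih =>
    have key : ∀ r, ‖A r ∘L peanoBaker A s k r‖ ≤ K * ((K * |r - s|) ^ k / (k.factorial : ℝ)) :=
      fun r => (ContinuousLinearMap.opNorm_comp_le _ _).trans
        (mul_le_mul (hK r) (ih r) (norm_nonneg _) hK0)
    have hint : ∀ a b : ℝ, IntervalIntegrable
        (fun r => K * ((K * |r - s|) ^ k / (k.factorial : ℝ))) volume a b := fun a b =>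
      Continuous.intervalIntegrable (by fun_prop) a b
    have hf : (((k + 1).factorial : ℕ) : ℝ) = (k + 1) * (k.factorial : ℝ) := by
      push_cast [Nat.factorial_succ]; ring
    have hk : (k.factorial : ℝ) ≠ 0 := by positivity
    have hk1 : (k : ℝ) + 1 ≠ 0 := by positivity
    change ‖∫ r in s..t, A r ∘L peanoBaker A s k r‖ ≤ _
    rcases le_total s t with h | h
    · refine (intervalIntegral.norm_integral_le_of_norm_le h
        (Eventually.of_forall fun r _ => key r) (hint s t)).trans (le_of_eq ?_)
      have e : ∀ r ∈ uIcc s t, K * ((K * |r - s|) ^ k / (k.factorial : ℝ))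
          = K ^ (k + 1) / (k.factorial : ℝ) * (r - s) ^ k := by
        intro r hr
        rw [uIcc_of_le h] at hr
        rw [abs_of_nonneg (by linarith [hr.1]), mul_pow]; ring
      rw [intervalIntegral.integral_congr e, intervalIntegral.integral_const_mul,
        intervalIntegral.integral_comp_sub_right (fun x => x ^ k), integral_pow, hf,
        abs_of_nonneg (by linarith)]
      simp [mul_pow]; field_simp
    · rw [intervalIntegral.integral_symm, norm_neg]
      refine (intervalIntegral.norm_integral_le_of_norm_le h
        (Eventually.of_forall fun r _ => key r) (hint t s)).trans (le_of_eq ?_)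
      have e : ∀ r ∈ uIcc t s, K * ((K * |r - s|) ^ k / (k.factorial : ℝ))
          = K ^ (k + 1) / (k.factorial : ℝ) * (s - r) ^ k := by
        intro r hr
        rw [uIcc_of_le h] at hr
        rw [abs_of_nonpos (by linarith [hr.2]), mul_pow]; ring
      rw [intervalIntegral.integral_congr e, intervalIntegral.integral_const_mul,
        intervalIntegral.integral_comp_sub_left (fun x => x ^ k), integral_pow, hf,
        abs_of_nonpos (by linarith)]
      simp [mul_pow]; field_simp

/-- A continuous linear system has an evolution operator. -/
theorem exists_isEvolution {n : ℕ} {T : ℝ} (hT : 0 < T) {A : ℝ → Mat n n}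
    (hA : ContinuousOn A (Icc 0 T)) : ∃ Φ, IsEvolution T A Φ := by
  set A' : ℝ → Mat n n := fun t => A (projIcc 0 T hT.le t) with hA'
  have hc : Continuous A' :=
    (continuousOn_iff_continuous_domRestrict.1 hA).comp continuous_projIcc
  have heq : ∀ t ∈ Icc 0 T, A' t = A t := fun t ht => by
    simp only [hA', projIcc_of_mem hT.le ht]
  obtain ⟨K, hK⟩ := isCompact_Icc.exists_bound_of_continuousOn hA
  have hK' : ∀ t, ‖A' t‖ ≤ K := fun t => hK _ (projIcc 0 T hT.le t).2
  have hK0 : 0 ≤ K := (norm_nonneg _).trans (hK' 0)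
  refine ⟨fun t s => ∑' k, peanoBaker A' s k t, fun s hs => ⟨?_, fun t ht => ?_⟩⟩
  · change (∑' k, peanoBaker A' s k s) = 1
    rw [tsum_eq_single 0]
    · rfl
    · intro k hk
      obtain ⟨m, rfl⟩ := Nat.exists_eq_succ_of_ne_zero hk
      simp [peanoBaker]
  · set u : ℕ → ℝ := fun k => K * ((K * (2 * T)) ^ k / (k.factorial : ℝ))
    have hu : Summable u := (Real.summable_pow_div_factorial _).mul_left K
    have hmem : ∀ y ∈ Ioo (s - 2 * T) (s + 2 * T), |y - s| ≤ 2 * T := fun y hy =>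
      abs_le.2 ⟨by linarith [hy.1], by linarith [hy.2]⟩
    have hsum : ∀ y, Summable fun k => peanoBaker A' s k y := fun y =>
      Summable.of_norm_bounded (Real.summable_pow_div_factorial (K * |y - s|))
        (fun k => peanoBaker_norm_le hK' s k y)
    have hts : t ∈ Ioo (s - 2 * T) (s + 2 * T) :=
      ⟨by linarith [ht.1, hs.2], by linarith [ht.2, hs.1]⟩
    have hsum1 : Summable fun k => peanoBaker A' s (k + 1) t :=
      (summable_nat_add_iff (f := fun k => peanoBaker A' s k t) 1).2 (hsum t)
    have hd : HasDerivAt (fun y => ∑' k, peanoBaker A' s (k + 1) y)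
        (∑' k, A' t ∘L peanoBaker A' s k t) t :=
      hasDerivAt_tsum_of_isPreconnected hu isOpen_Ioo isPreconnected_Ioo
        (fun k y _ => peanoBaker_hasDerivAt hc s k y)
        (fun k y hy => (ContinuousLinearMap.opNorm_comp_le _ _).trans
          (mul_le_mul (hK' y) ((peanoBaker_norm_le hK' s k y).trans
            (by
              have := hmem y hy
              gcongr)) (norm_nonneg _) hK0)) hts
        hsum1 hts
    have e1 : (fun y => ∑' k, peanoBaker A' s k y)
        = fun y => 1 + ∑' k, peanoBaker A' s (k + 1) y := by
      funext y
      rw [(hsum y).tsum_eq_zero_add]; rfl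
    have e2 : (∑' k, A' t ∘L peanoBaker A' s k t) = A t ∘L ∑' k, peanoBaker A' s k t := by
      rw [heq t ht]
      have h1 : HasSum (fun k => A t * peanoBaker A' s k t) (A t * ∑' k, peanoBaker A' s k t) :=
        (hsum t).hasSum.mul_left (A t)
      exact h1.tsum_eq
    rw [e2] at hd
    simp only [e1] at hd ⊢
    exact (hd.const_add 1).hasDerivWithinAt

theorem evolution_spec {n : ℕ} {T : ℝ} (hT : 0 < T) {A : ℝ → Mat n n}
    (hA : ContinuousOn A (Icc 0 T)) : IsEvolution T A (evolution T A) :=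
  Classical.epsilon_spec (exists_isEvolution hT hA)

/-- The controllability Gramian
`W_{A,B}(t₀,t₁) = ∫_{t₀}^{t₁} Φ_A(t₀,s) B(s) B(s)ᵀ Φ_A(t₀,s)ᵀ ds`. -/
noncomputable def gramian {n m : ℕ} (T : ℝ) (A : ℝ → Mat n n) (B : ℝ → Mat n m) (t₀ t₁ : ℝ) :
    Mat n n :=
  ∫ s in t₀..t₁, evolution T A t₀ s ∘L B s ∘L (B s)† ∘L (evolution T A t₀ s)†

/-! ### The parameterized linear-quadratic problem -/

/-- The coefficients of the problem. Only their values on `[0,T]` matter. -/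
structure Data (nx nu nd : ℕ) where
  /-- system matrix -/
  A : ℝ → Mat nx nx
  /-- control matrix -/
  B : ℝ → Mat nx nu
  /-- parameter matrix in the dynamics -/
  C : ℝ → Mat nx nd
  /-- state cost -/
  Q : ℝ → Mat nx nx
  /-- cross cost -/
  H : ℝ → Mat nu nx
  /-- control cost -/
  R : ℝ → Mat nu nu
  /-- parameter-state cost -/
  G : ℝ → Mat nd nx
  /-- parameter-control cost -/
  W : ℝ → Mat nd nu
  /-- terminal state cost -/
  QT : Mat nx nx
  /-- terminal parameter-state cost -/
  GT : Mat nd nx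

/-- The constants of the standing assumptions; none of them refers to the horizon `T`. -/
structure Constants where
  /-- length of the controllability window -/
  sigma : ℝ
  /-- bound of `A` -/
  lamA : ℝ
  /-- bound of `B` -/
  lamB : ℝ
  /-- bound of `Q` and `Q_T` -/
  lamQ : ℝ
  /-- bound of `H` -/
  lamH : ℝ
  /-- bound of `R` -/
  lamR : ℝ
  /-- bound of `G` and `G_T` -/
  lamG : ℝ
  /-- bound of `W` -/
  lamW : ℝ
  /-- bound of `C` -/
  lamC : ℝ
  /-- coercivity of `R` -/
  gamR : ℝ
  /-- coercivity of `Q - Hᵀ R⁻¹ H` and `Q_T` -/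
  gamQ : ℝ
  /-- lower bound of the Gramian -/
  alpha0 : ℝ
  /-- upper bound of the Gramian -/
  alpha1 : ℝ
  /-- lower bound of the transported Gramian -/
  beta0 : ℝ
  /-- upper bound of the transported Gramian -/
  beta1 : ℝ
  sigma_pos : 0 < sigma
  lamA_pos : 0 < lamA
  lamB_pos : 0 < lamB
  lamQ_pos : 0 < lamQ
  lamH_pos : 0 < lamH
  lamR_pos : 0 < lamR
  lamG_pos : 0 < lamG
  lamW_pos : 0 < lamW
  lamC_pos : 0 < lamC
  gamR_pos : 0 < gamR
  gamQ_pos : 0 < gamQ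
  alpha0_pos : 0 < alpha0
  alpha1_pos : 0 < alpha1
  beta0_pos : 0 < beta0
  beta1_pos : 0 < beta1

/-- The standing assumptions on the horizon `T` and the coefficients: continuity and boundedness,
uniform complete controllability, coercivity. -/
structure Assumptions {nx nu nd : ℕ} (k : Constants) (T : ℝ) (D : Data nx nu nd) : Prop where
  sigma_lt : k.sigma < T
  contA : ContinuousOn D.A (Icc 0 T)
  contB : ContinuousOn D.B (Icc 0 T)
  contC : ContinuousOn D.C (Icc 0 T)
  contQ : ContinuousOn D.Q (Icc 0 T)
  contH : ContinuousOn D.H (Icc 0 T)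
  contR : ContinuousOn D.R (Icc 0 T)
  contG : ContinuousOn D.G (Icc 0 T)
  contW : ContinuousOn D.W (Icc 0 T)
  boundA : ∀ t ∈ Icc 0 T, ‖D.A t‖ ≤ k.lamA
  boundB : ∀ t ∈ Icc 0 T, ‖D.B t‖ ≤ k.lamB
  boundC : ∀ t ∈ Icc 0 T, ‖D.C t‖ ≤ k.lamC
  boundQ : ∀ t ∈ Icc 0 T, ‖D.Q t‖ ≤ k.lamQ
  boundH : ∀ t ∈ Icc 0 T, ‖D.H t‖ ≤ k.lamH
  boundR : ∀ t ∈ Icc 0 T, ‖D.R t‖ ≤ k.lamR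
  boundG : ∀ t ∈ Icc 0 T, ‖D.G t‖ ≤ k.lamG
  boundW : ∀ t ∈ Icc 0 T, ‖D.W t‖ ≤ k.lamW
  boundGT : ‖D.GT‖ ≤ k.lamG
  controllable : ∀ t₀ ∈ Icc 0 (T - k.sigma), ∃ t₁ ∈ Icc t₀ (t₀ + k.sigma),
    k.alpha0 • (1 : Mat nx nx) ≤ gramian T D.A D.B t₀ t₁ ∧
    gramian T D.A D.B t₀ t₁ ≤ k.alpha1 • (1 : Mat nx nx) ∧
    k.beta0 • (1 : Mat nx nx) ≤
      evolution T D.A t₁ t₀ ∘L gramian T D.A D.B t₀ t₁ ∘L (evolution T D.A t₁ t₀)† ∧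
    evolution T D.A t₁ t₀ ∘L gramian T D.A D.B t₀ t₁ ∘L (evolution T D.A t₁ t₀)† ≤
      k.beta1 • (1 : Mat nx nx)
  coerciveR : ∀ t ∈ Icc 0 T, k.gamR • (1 : Mat nu nu) ≤ D.R t
  coerciveQ : ∀ t ∈ Icc 0 T,
    k.gamQ • (1 : Mat nx nx) ≤ D.Q t - (D.H t)† ∘L (D.R t).inverse ∘L D.H t
  coerciveQT : k.gamQ • (1 : Mat nx nx) ≤ D.QT
  boundQT : D.QT ≤ k.lamQ • (1 : Mat nx nx)

namespace Constants

variable (k : Constants)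

/-- Bound of the shifted system matrix `A - B R⁻¹ H`. -/
noncomputable def kappa : ℝ := k.lamA + k.lamB * k.lamH / k.gamR

/-- `α₀'(σ)`, lower Gramian bound of the pair `(A - B R⁻¹ H, B)`. -/
noncomputable def alpha0' : ℝ :=
  (2 / k.alpha0 + (k.lamH / k.gamR) ^ 2 / k.lamA * (1 + k.alpha1 / k.alpha0) ^ 2 *
    (Real.exp (2 * k.lamA * k.sigma) - 1))⁻¹

/-- `α₁'(σ)`, upper Gramian bound of the pair `(A - B R⁻¹ H, B)`. -/
noncomputable def alpha1' : ℝ :=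
  k.lamB ^ 2 * (Real.exp (2 * k.sigma * k.kappa) - 1) / (2 * k.kappa)

/-- `α̃₀(σ)`, lower Gramian bound of the dual pair. -/
noncomputable def alphaDual0 : ℝ := 1 / (2 * k.kappa) * (1 - Real.exp (-2 * k.kappa * k.sigma))

/-- `α̃₁(σ)`, upper Gramian bound of the dual pair. -/
noncomputable def alphaDual1 : ℝ := 1 / (2 * k.kappa) * (Real.exp (2 * k.kappa * k.sigma) - 1)

/-- `c₀(σ)`, lower bound of the Riccati matrix. -/
noncomputable def c0 : ℝ :=
  min
    (2 * k.kappa * (k.lamB ^ 2 / k.gamR * (1 + k.alphaDual1 / k.alphaDual0) ^ 2 +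
      1 / (k.gamQ * k.alphaDual0 ^ 2))⁻¹)
    (k.lamB ^ 2 / (2 * k.gamR * k.kappa) + 1 / k.gamQ)⁻¹ *
  Real.exp (-2 * k.kappa * k.sigma)

/-- `c₁(σ)`, upper bound of the Riccati matrix. -/
noncomputable def c1 : ℝ :=
  max
    (((k.lamQ + k.lamH ^ 2 / k.gamR) * (1 + k.alpha1' / k.alpha0') ^ 2 +
      k.lamR * k.lamB ^ 2 / k.alpha0' ^ 2) * (1 / (2 * k.kappa)))
    ((k.lamQ + k.lamH ^ 2 / k.gamR) * (1 + 1 / (2 * k.kappa))) *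
  Real.exp (2 * k.kappa * k.sigma)

/-- `c_Z(σ)`. -/
noncomputable def cZ : ℝ := √(k.c1 / k.c0)

/-- The decay rate `ρ_Z(σ)`. -/
noncomputable def rhoZ : ℝ := k.gamQ / (2 * k.c1)

/-- `c_v(σ)`. -/
noncomputable def cv : ℝ :=
  k.cZ * ((k.lamW * k.lamB / k.gamR + k.lamC) * k.c1 + k.lamW * k.lamH / k.gamR + k.lamG)

/-- `Λ_x(σ)`. -/
noncomputable def LambdaX : ℝ :=
  k.cZ * (k.cv * k.lamB ^ 2 / (2 * k.rhoZ * k.gamR) + k.lamW * k.lamB / k.gamR + k.lamC)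

/-- The sensitivity constant `Λ(σ)`. -/
noncomputable def Lambda : ℝ :=
  (1 + k.lamH / k.gamR + k.c1 * (1 + k.lamB / k.gamR)) * k.LambdaX +
    k.cv * (1 + k.lamB / k.gamR)

end Constants

/-! ### Optimal solutions -/

/-- A triple (state, control, adjoint) of trajectories; only values on `[0,T]` matter. -/
structure Trajectory (nx nu : ℕ) where
  /-- state -/
  x : ℝ → Vec nx
  /-- control -/
  u : ℝ → Vec nu
  /-- adjoint -/
  lam : ℝ → Vec nx

/-- Two triples agree on a set of times. -/
def Trajectory.AgreeOn {nx nu : ℕ} (z z' : Trajectory nx nu) (s : Set ℝ) : Prop :=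
  EqOn z.x z'.x s ∧ EqOn z.u z'.u s ∧ EqOn z.lam z'.lam s

section Problem

variable {nx nu nd : ℕ} (D : Data nx nu nd) (T : ℝ)

/-- The running cost: the quadratic form
`½ [x;u;d]ᵀ [[Q, Hᵀ, Gᵀ], [H, R, Wᵀ], [G, W, 0]] [x;u;d]` at time `t`. -/
noncomputable def runningCost (t : ℝ) (x : Vec nx) (u : Vec nu) (d : Vec nd) : ℝ :=
  (1 / 2) * (inner ℝ x (D.Q t x + ((D.H t)†) u + ((D.G t)†) d)
    + inner ℝ u (D.H t x + D.R t u + ((D.W t)†) d)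
    + inner ℝ d (D.G t x + D.W t u))

/-- The terminal cost: the quadratic form `½ [x;e]ᵀ [[Q_T, G_Tᵀ], [G_T, 0]] [x;e]`. -/
noncomputable def terminalCost (x : Vec nx) (e : Vec nd) : ℝ :=
  (1 / 2) * (inner ℝ x (D.QT x + (D.GT†) e) + inner ℝ e (D.GT x))

/-- The Hamiltonian. -/
noncomputable def hamiltonian (t : ℝ) (x : Vec nx) (u : Vec nu) (lam : Vec nx) (d : Vec nd) : ℝ :=
  runningCost D t x u d + inner ℝ lam (D.A t x + D.B t u + D.C t d)

/-- The cost functional. -/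
noncomputable def cost (d : ℝ → Vec nd) (dT : Vec nd) (x : ℝ → Vec nx) (u : ℝ → Vec nu) : ℝ :=
  (∫ t in (0 : ℝ)..T, runningCost D t (x t) (u t) (d t)) + terminalCost D (x T) dT

/-- `(x,u)` is admissible: `u` is square-integrable and `x` is the (Carathéodory) solution of
`x' = A x + B u + C d`, `x(0) = d₀`. -/
def Admissible (d : ℝ → Vec nd) (d0 : Vec nx) (x : ℝ → Vec nx) (u : ℝ → Vec nu) : Prop :=
  MemLp u 2 (volume.restrict (Icc 0 T)) ∧ ContinuousOn x (Icc 0 T) ∧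
    ∀ t ∈ Icc 0 T, x t = d0 + ∫ s in (0 : ℝ)..t, (D.A s (x s) + D.B s (u s) + D.C s (d s))

/-- `z` consists of an optimal state and control for the parameters `(d, d₀, d_T)`, with the
adjoint `λ' = -∇ₓ ℋ`, `λ(T) = Q_T x(T) + G_Tᵀ d_T` (the gradient of the terminal cost), the control
being represented by the function which minimizes the Hamiltonian at every time. -/
def IsOptimalTriple (d : ℝ → Vec nd) (d0 : Vec nx) (dT : Vec nd) (z : Trajectory nx nu) : Prop :=
  Admissible D T d d0 z.x z.u ∧
  (∀ x u, Admissible D T d d0 x u → cost D T d dT z.x z.u ≤ cost D T d dT x u) ∧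
  ContinuousOn z.lam (Icc 0 T) ∧
  (∀ t ∈ Icc 0 T, z.lam t = D.QT (z.x T) + (D.GT†) dT +
    ∫ s in t..T, (((D.A s)†) (z.lam s) + D.Q s (z.x s) + ((D.H s)†) (z.u s) + ((D.G s)†) (d s))) ∧
  ∀ t ∈ Icc 0 T, ∀ w : Vec nu,
    hamiltonian D t (z.x t) (z.u t) (z.lam t) (d t) ≤ hamiltonian D t (z.x t) w (z.lam t) (d t)

/-- `z` is the solution for the parameters `(d + l δ_{t'}, d₀, d_T)`, where `δ_{t'}` is the unit
point mass at `t'`: the optimality system (state equation, adjoint equation, stationarity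
`H x + R u + Bᵀ λ + Wᵀ d = 0` of the Hamiltonian in the control) with `d` replaced by the vector
measure `d dt + l δ_{t'}`. The control is then a measure `u dt + η δ_{t'}`, whose atom `η` is
determined by the stationarity condition at the atom, and `x` and `λ` jump at `t'`. The function
`z.u` is the density of the control, that is, the control at the times `t ≠ t'`. -/
def IsPerturbedTriple (d : ℝ → Vec nd) (d0 : Vec nx) (dT : Vec nd) (t' : ℝ) (l : Vec nd)
    (z : Trajectory nx nu) : Prop :=
  IntervalIntegrable z.x volume 0 T ∧ IntervalIntegrable z.u volume 0 T ∧
  IntervalIntegrable z.lam volume 0 T ∧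
  ∃ η : Vec nu, D.R t' η + ((D.W t')†) l = 0 ∧
    (∀ t ∈ Icc 0 T, z.x t = d0 +
      (∫ s in (0 : ℝ)..t, (D.A s (z.x s) + D.B s (z.u s) + D.C s (d s))) +
      if t' ≤ t then D.B t' η + D.C t' l else 0) ∧
    (∀ t ∈ Icc 0 T, z.lam t = D.QT (z.x T) + (D.GT†) dT +
      (∫ s in t..T, (((D.A s)†) (z.lam s) + D.Q s (z.x s) + ((D.H s)†) (z.u s) + ((D.G s)†) (d s))) +
      if t < t' then ((D.H t')†) η + ((D.G t')†) l else 0) ∧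
    ∀ t ∈ Icc 0 T, t ≠ t' → ∀ w : Vec nu,
      hamiltonian D t (z.x t) (z.u t) (z.lam t) (d t) ≤ hamiltonian D t (z.x t) w (z.lam t) (d t)

end Problem

/-- `φ n` is a sequence of square-integrable approximations on `[0,T]` of the unit point mass at
`t'`: nonnegative, of integral one, and vanishing eventually away from `t'`. -/
def ApproximatesDirac (T t' : ℝ) (φ : ℕ → ℝ → ℝ) : Prop :=
  (∀ n, MemLp (φ n) 2 (volume.restrict (Icc 0 T))) ∧
  (∀ n, ∀ t ∈ Icc 0 T, 0 ≤ φ n t) ∧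
  (∀ n, ∫ t in (0 : ℝ)..T, φ n t = 1) ∧
  ∀ ε > 0, ∀ᶠ n in atTop, ∀ t ∈ Icc 0 T, ε ≤ |t - t'| → φ n t = 0

end LQ

/-!
Minimizing the Hamiltonian gives `u = -R⁻¹ (H x + Bᵀ λ + Wᵀ d)`, and substituting this into the
state and adjoint equations leaves a linear boundary value problem `x' = F x - N λ + f`,
`λ' = -Fᵀ λ - K x - g`, `x(0) = d₀`, `λ(T) = P x(T) + e` with `F = A - B R⁻¹ H`, `N = B R⁻¹ Bᵀ`,
`K = Q - Hᵀ R⁻¹ H` and `P = Q_T`. A point mass in `d` makes `x` jump by some `p` and `λ` by some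
`-q` at `t'`.

Let `X`, `L` be the operator solution of the homogeneous system with `X(T) = 1`, `L(T) = P`. Then
`X` is invertible and `S = L X⁻¹` is the Riccati operator, so that `⟪X v, L v⟫` is a cost-to-go.
Comparing with an explicit control that steers the state to zero, or in the dual problem the
adjoint to zero, within one controllability window gives `c₀ ‖x‖² ≤ ⟪x, S x⟫ ≤ c₁ ‖x‖²`. Hence
`⟪X v, L v⟫`, whose derivative is at most `-γ_Q ‖X v‖²`, is a Lyapunov function, and `X v` decays
like `√(c₁/c₀) e^{-ρ t}`.

The Wronskian `r = Xᵀ λ - Lᵀ x` and the coordinate `w = X⁻¹ x` triangularize the boundary value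
problem, since `λ = S x + (X⁻¹)ᵀ r`: first `r` and then `w` is an integral of known terms. Existence
and uniqueness, the decay of the response to a jump on either side of `t'`, and the convergence for
approximate point masses are read off from these two integrals.
-/

namespace LQ

open scoped InnerProductSpace

section Calculus

variable {E : Type*} [NormedAddCommGroup E] [NormedSpace ℝ E]

theorem le_of_hasDerivWithinAt_nonneg {a b : ℝ} (hab : a ≤ b) {f f' : ℝ → ℝ}
    (hf : ∀ t ∈ Icc a b, HasDerivWithinAt f (f' t) (Icc a b) t) (hf' : ∀ t ∈ Icc a b, 0 ≤ f' t) :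
    f a ≤ f b :=
  monotoneOn_of_hasDerivWithinAt_nonneg (convex_Icc a b) (fun t ht => (hf t ht).continuousWithinAt)
    (fun t ht => (hf t (interior_subset ht)).mono interior_subset)
    (fun t ht => hf' t (interior_subset ht)) (left_mem_Icc.2 hab) (right_mem_Icc.2 hab) hab

theorem eq_of_hasDerivWithinAt_zero {a b : ℝ} {f : ℝ → E}
    (hf : ∀ t ∈ Icc a b, HasDerivWithinAt f 0 (Icc a b) t) {s t : ℝ} (hs : s ∈ Icc a b)
    (ht : t ∈ Icc a b) : f s = f t := by
  have h := (convex_Icc a b).norm_image_sub_le_of_norm_hasDerivWithin_le (C := 0) hf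
    (by simp) ht hs
  simpa [sub_eq_zero] using h

theorem norm_le_exp_mul_of_norm_deriv_le {a b κ : ℝ} {y y' : ℝ → E}
    (hy : ∀ t ∈ Icc a b, HasDerivWithinAt y (y' t) (Icc a b) t)
    (hb : ∀ t ∈ Icc a b, ‖y' t‖ ≤ κ * ‖y t‖) {t : ℝ} (ht : t ∈ Icc a b) :
    ‖y t‖ ≤ Real.exp (κ * (t - a)) * ‖y a‖ := by
  have h := norm_le_gronwallBound_of_norm_deriv_right_le (K := κ) (ε := 0)
    (fun s hs => (hy s hs).continuousWithinAt)
    (fun s hs => (hy s (Ico_subset_Icc_self hs)).mono_of_mem_nhdsWithin (Icc_mem_nhdsGE_of_mem hs))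
    le_rfl (fun s hs => by simpa using hb s (Ico_subset_Icc_self hs)) t ht
  rwa [gronwallBound_ε0, mul_comm] at h

theorem exists_fundamental [FiniteDimensional ℝ E] {T : ℝ} (hT : 0 < T) {M : ℝ → E →L[ℝ] E}
    (hM : ContinuousOn M (Icc 0 T)) {s : ℝ} (hs : s ∈ Icc 0 T) :
    ∃ Z : ℝ → E →L[ℝ] E, Z s = 1 ∧
      ∀ t ∈ Icc 0 T, HasDerivWithinAt Z (M t ∘L Z t) (Icc 0 T) t := by
  let e : E ≃L[ℝ] Vec (Module.finrank ℝ E) :=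
    ContinuousLinearEquiv.ofFinrankEq finrank_euclideanSpace_fin.symm
  let f : E →L[ℝ] Vec (Module.finrank ℝ E) := e
  let g : Vec (Module.finrank ℝ E) →L[ℝ] E := e.symm
  have hM' : ContinuousOn (fun t => f ∘L M t ∘L g) (Icc 0 T) := by fun_prop
  obtain ⟨Φ, hΦ⟩ := exists_isEvolution hT hM'
  obtain ⟨hΦs, hΦ'⟩ := hΦ s hs
  refine ⟨fun t => g ∘L Φ t s ∘L f, by ext v; simp [hΦs, f, g], fun t ht => ?_⟩
  have h := (hasDerivWithinAt_const t (Icc 0 T) g).clm_comp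
    ((hΦ' t ht).clm_comp (hasDerivWithinAt_const t (Icc 0 T) f))
  refine h.congr_deriv ?_
  ext v
  simp [f, g]

theorem hasDerivWithinAt_apply {F : Type*} [NormedAddCommGroup F] [NormedSpace ℝ F]
    {M : ℝ → E →L[ℝ] F} {M' : E →L[ℝ] F} {s : Set ℝ} {t : ℝ}
    (hM : HasDerivWithinAt M M' s t) (v : E) : HasDerivWithinAt (fun t => M t v) (M' v) s t := by
  simpa using hM.clm_apply (hasDerivWithinAt_const t s v)

end Calculus

theorem continuousOn_adjoint {E F : Type*} [NormedAddCommGroup E] [InnerProductSpace ℝ E]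
    [CompleteSpace E] [NormedAddCommGroup F] [InnerProductSpace ℝ F] [CompleteSpace F]
    {M : ℝ → E →L[ℝ] F} {s : Set ℝ} (hM : ContinuousOn M s) : ContinuousOn (fun t => (M t)†) s :=
  ContinuousLinearMap.adjoint.continuous.comp_continuousOn hM

section Positivity

variable {V : Type*} [NormedAddCommGroup V] [InnerProductSpace ℝ V]

theorem smul_one_le_iff {c : ℝ} {M : V →L[ℝ] V} :
    c • (1 : V →L[ℝ] V) ≤ M ↔
      (M : V →ₗ[ℝ] V).IsSymmetric ∧ ∀ x, c * ‖x‖ ^ 2 ≤ ⟪x, M x⟫_ℝ := by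
  rw [ContinuousLinearMap.le_def, ContinuousLinearMap.isPositive_iff]
  refine and_congr ?_ (forall_congr' fun x => ?_)
  · simp [LinearMap.IsSymmetric, inner_sub_left, inner_sub_right, real_inner_smul_left,
      real_inner_smul_right]
  · rw [← sub_nonneg (b := c * ‖x‖ ^ 2), real_inner_comm]
    simp [inner_sub_right, real_inner_smul_right]

theorem le_smul_one_iff {c : ℝ} {M : V →L[ℝ] V} :
    M ≤ c • (1 : V →L[ℝ] V) ↔
      (M : V →ₗ[ℝ] V).IsSymmetric ∧ ∀ x, ⟪x, M x⟫_ℝ ≤ c * ‖x‖ ^ 2 := by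
  rw [ContinuousLinearMap.le_def, ContinuousLinearMap.isPositive_iff]
  refine and_congr ?_ (forall_congr' fun x => ?_)
  · simp [LinearMap.IsSymmetric, inner_sub_left, inner_sub_right, real_inner_smul_left,
      real_inner_smul_right]
  · rw [← sub_nonneg, real_inner_comm]
    simp [inner_sub_right, real_inner_smul_right]

theorem nonneg_iff {M : V →L[ℝ] V} :
    0 ≤ M ↔ (M : V →ₗ[ℝ] V).IsSymmetric ∧ ∀ x, 0 ≤ ⟪x, M x⟫_ℝ := by
  simpa using smul_one_le_iff (c := 0) (M := M)

theorem two_mul_inner_sub_inner_le {S : V →L[ℝ] V} (hS : 0 ≤ S) (x y : V) :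
    2 * ⟪S x, y⟫_ℝ - ⟪x, S x⟫_ℝ ≤ ⟪y, S y⟫_ℝ := by
  obtain ⟨hsymm, hnonneg⟩ := nonneg_iff.1 hS
  have h := hnonneg (x - y)
  have hxy : ⟪x, S y⟫_ℝ = ⟪S x, y⟫_ℝ := (hsymm x y).symm
  simp only [map_sub, inner_sub_left, inner_sub_right, hxy, real_inner_comm (S x) y] at h
  linarith

theorem norm_le_of_nonneg_of_le_smul_one {S : V →L[ℝ] V} {c : ℝ} (hc : 0 ≤ c) (h0 : 0 ≤ S)
    (h1 : S ≤ c • 1) : ‖S‖ ≤ c := by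
  obtain ⟨hsymm, hnonneg⟩ := nonneg_iff.1 h0
  have hle := (le_smul_one_iff.1 h1).2
  obtain rfl | hc := hc.eq_or_lt
  · simp [le_antisymm (by simpa using h1) h0]
  refine S.opNorm_le_bound hc.le fun x => ?_
  have hcross : ⟪x, S (S x)⟫_ℝ = ‖S x‖ ^ 2 := by
    rw [← real_inner_self_eq_norm_sq]
    exact (hsymm x (S x)).symm
  have hform : 0 ≤ c ^ 2 * ⟪x, S x⟫_ℝ - 2 * c * ‖S x‖ ^ 2 + ⟪S x, S (S x)⟫_ℝ := by
    have h := hnonneg (c • x - S x)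
    simp only [map_sub, map_smul, inner_sub_left, inner_sub_right, real_inner_smul_left,
      real_inner_smul_right, hcross, real_inner_self_eq_norm_sq] at h
    linarith
  have hsq : c * ‖S x‖ ^ 2 ≤ c * (c * ‖x‖) ^ 2 := by
    nlinarith [hle (S x), mul_le_mul_of_nonneg_left (hle x) (sq_nonneg c)]
  exact le_of_sq_le_sq (le_of_mul_le_mul_left hsq hc) (by positivity)

theorem completed_square_nonneg {γ : ℝ} (hγ : 0 < γ) (x w : V) :
    0 ≤ γ * ‖x‖ ^ 2 + 2 * ⟪x, w⟫_ℝ + ‖w‖ ^ 2 / γ := by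
  have h : γ * ‖x‖ ^ 2 + 2 * ⟪x, w⟫_ℝ + ‖w‖ ^ 2 / γ = ‖γ • x + w‖ ^ 2 / γ := by
    rw [norm_add_sq_real, real_inner_smul_left, norm_smul, Real.norm_of_nonneg hγ.le]
    field_simp
  rw [h]
  positivity

end Positivity

/-! ### Jump primitives -/

section Primitive

variable {E F G : Type*} [NormedAddCommGroup E] [NormedSpace ℝ E] [NormedAddCommGroup F]
  [NormedSpace ℝ F] [NormedAddCommGroup G] [NormedSpace ℝ G] {a b c : ℝ}

theorem intervalIntegrable_of_mem_Icc {X : Type*} [NormedAddCommGroup X] {h : ℝ → X}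
    (hi : IntervalIntegrable h volume a b) {s t : ℝ} (hs : s ∈ Icc a b) (ht : t ∈ Icc a b) :
    IntervalIntegrable h volume s t :=
  hi.mono_set (uIcc_subset_uIcc (Icc_subset_uIcc hs) (Icc_subset_uIcc ht))

theorem intervalIntegrable_clm_apply {h : ℝ → E} (hi : IntervalIntegrable h volume a b)
    (L : E →L[ℝ] F) : IntervalIntegrable (fun t => L (h t)) volume a b :=
  ⟨L.integrable_comp hi.1, L.integrable_comp hi.2⟩

theorem continuousOn_primitive_Icc (hab : a ≤ b) {h : ℝ → E}
    (hi : IntervalIntegrable h volume a b) :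
    ContinuousOn (fun t => ∫ s in a..t, h s) (Icc a b) := by
  simpa only [uIcc_of_le hab] using
    intervalIntegral.continuousOn_primitive_interval' hi left_mem_uIcc

theorem intervalIntegrable_bilin (hab : a ≤ b) (B : E →L[ℝ] F →L[ℝ] G) {f : ℝ → E} {g : ℝ → F}
    (hf : IntervalIntegrable f volume a b)
    (hg : AEStronglyMeasurable g (volume.restrict (Ioc a b))) {C : ℝ}
    (hC : ∀ t ∈ Icc a b, ‖g t‖ ≤ C) :
    IntervalIntegrable (fun t => B (f t) (g t)) volume a b := by
  rw [intervalIntegrable_iff_integrableOn_Ioc_of_le hab] at hf ⊢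
  exact B.integrable_of_bilin_of_bdd_right C hf hg <| (ae_restrict_mem measurableSet_Ioc).mono
    fun t ht => hC t (Ioc_subset_Icc_self ht)

theorem intervalIntegrable_bilin_continuousOn (hab : a ≤ b) (B : E →L[ℝ] F →L[ℝ] G) {f : ℝ → E}
    {g : ℝ → F} (hf : IntervalIntegrable f volume a b) (hg : ContinuousOn g (Icc a b)) :
    IntervalIntegrable (fun t => B (f t) (g t)) volume a b := by
  obtain ⟨C, hC⟩ := isCompact_Icc.exists_bound_of_continuousOn hg
  exact intervalIntegrable_bilin hab B hf
    ((hg.mono Ioc_subset_Icc_self).aestronglyMeasurable measurableSet_Ioc) hC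

theorem intervalIntegrable_operator_apply (hab : a ≤ b) {M : ℝ → E →L[ℝ] F} {g : ℝ → E}
    (hM : ContinuousOn M (Icc a b)) (hg : IntervalIntegrable g volume a b) :
    IntervalIntegrable (fun t => M t (g t)) volume a b :=
  intervalIntegrable_bilin_continuousOn hab (ContinuousLinearMap.id ℝ (E →L[ℝ] F)).flip hg hM

theorem integral_bilin_setIntegral_Iic_add [CompleteSpace E] [CompleteSpace F] [CompleteSpace G]
    {α : Type*} [LinearOrder α] [TopologicalSpace α] [OrderClosedTopology α]
    [SecondCountableTopology α] [MeasurableSpace α] [OpensMeasurableSpace α] {μ : Measure α}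
    [SFinite μ] (B : E →L[ℝ] F →L[ℝ] G) {f : α → E} {g : α → F} (hf : Integrable f μ)
    (hg : Integrable g μ) :
    ∫ s, B (f s) (∫ r in Iic s, g r ∂μ) ∂μ + ∫ s, B (∫ r in Iio s, f r ∂μ) (g s) ∂μ =
      B (∫ s, f s ∂μ) (∫ s, g s ∂μ) := by
  have hk : Integrable (fun z : α × α => B (f z.1) (g z.2)) (μ.prod μ) :=
    hf.op_fst_snd (by fun_prop) ⟨‖B‖, B.le_opNorm₂⟩ hg
  let A : Set (α × α) := {z | z.2 ≤ z.1}
  have hA : MeasurableSet A := measurableSet_le measurable_snd measurable_fst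
  rw [← integral_prod_bilin B hf hg, ← integral_add_compl hA hk, ← integral_indicator hA,
    ← integral_indicator hA.compl, integral_prod _ (hk.indicator hA),
    integral_prod_symm _ (hk.indicator hA.compl)]
  congr 1 <;> refine integral_congr_ae (.of_forall fun s => ?_) <;> dsimp only
  · have hind : ∀ r, A.indicator (fun z => B (f z.1) (g z.2)) (s, r) =
        B (f s) ((Iic s).indicator g r) := fun r => by
      by_cases h : r ≤ s <;> simp [A, indicator, h]
    simp only [hind]
    rw [ContinuousLinearMap.integral_comp_comm _ (hg.indicator measurableSet_Iic),
      integral_indicator measurableSet_Iic]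
  · have hind : ∀ r, Aᶜ.indicator (fun z => B (f z.1) (g z.2)) (r, s) =
        B.flip (g s) ((Iio s).indicator f r) := fun r => by
      by_cases h : r < s <;> simp [A, indicator, h]
    simp only [hind]
    rw [ContinuousLinearMap.integral_comp_comm _ (hf.indicator measurableSet_Iio),
      integral_indicator measurableSet_Iio, B.flip_apply]

theorem intervalIntegral_eq_setIntegral_Iic {s : ℝ} (hs : s ∈ Ioc a b) (h : ℝ → E) :
    ∫ r in a..s, h r = ∫ r in Iic s, h r ∂volume.restrict (Ioc a b) := by
  rw [Measure.restrict_restrict measurableSet_Iic, Iic_inter_Ioc_of_le hs.2,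
    intervalIntegral.integral_of_le hs.1.le]

theorem integral_bilin_primitive_add [CompleteSpace E] [CompleteSpace F] [CompleteSpace G]
    (B : E →L[ℝ] F →L[ℝ] G) (hab : a ≤ b) {f : ℝ → E} {g : ℝ → F}
    (hf : IntervalIntegrable f volume a b) (hg : IntervalIntegrable g volume a b) :
    (∫ s in a..b, B (f s) (∫ r in a..s, g r)) + (∫ s in a..b, B (∫ r in a..s, f r) (g s)) =
      B (∫ s in a..b, f s) (∫ s in a..b, g s) := by
  rw [intervalIntegrable_iff_integrableOn_Ioc_of_le hab] at hf hg
  simp only [intervalIntegral.integral_of_le hab, ← integral_bilin_setIntegral_Iic_add B hf hg]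
  congr 1 <;> refine setIntegral_congr_fun measurableSet_Ioc fun s hs => ?_
  · rw [intervalIntegral_eq_setIntegral_Iic hs]
  · rw [intervalIntegral_eq_setIntegral_Iic hs, integral_Iic_eq_integral_Iio]

/-- On `[a,b]`, `y` is the primitive of the integrable function `h` with initial value `y₀` and a
jump `p` at `c`; `y` is right-continuous at `c`, and a jump at `c = a` is already part of `y a`. -/
structure HasJumpPrimitive (a b c : ℝ) (y : ℝ → E) (y₀ : E) (h : ℝ → E) (p : E) : Prop where
  integrable : IntervalIntegrable h volume a b
  eq : ∀ t ∈ Icc a b, y t = y₀ + (∫ s in a..t, h s) + if c ≤ t then p else 0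

namespace HasJumpPrimitive

variable {y : ℝ → E} {y₀ : E} {h : ℝ → E} {p : E} {z : ℝ → E} {z₀ : E} {k : ℝ → E} {q : E}

theorem add (hy : HasJumpPrimitive a b c y y₀ h p) (hz : HasJumpPrimitive a b c z z₀ k q) :
    HasJumpPrimitive a b c (fun t => y t + z t) (y₀ + z₀) (fun t => h t + k t) (p + q) := by
  refine ⟨hy.integrable.add hz.integrable, fun t ht => ?_⟩
  have hab := left_mem_Icc.2 (ht.1.trans ht.2)
  rw [hy.eq t ht, hz.eq t ht, intervalIntegral.integral_add
    (intervalIntegrable_of_mem_Icc hy.integrable hab ht)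
    (intervalIntegrable_of_mem_Icc hz.integrable hab ht)]
  split_ifs <;> abel

theorem clm_apply [CompleteSpace E] [CompleteSpace F] (hy : HasJumpPrimitive a b c y y₀ h p)
    (L : E →L[ℝ] F) :
    HasJumpPrimitive a b c (fun t => L (y t)) (L y₀) (fun t => L (h t)) (L p) := by
  refine ⟨intervalIntegrable_clm_apply hy.integrable L, fun t ht => ?_⟩
  have hab := left_mem_Icc.2 (ht.1.trans ht.2)
  rw [hy.eq t ht, L.intervalIntegral_comp_comm (intervalIntegrable_of_mem_Icc hy.integrable hab ht)]
  split_ifs <;> simp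

theorem neg (hy : HasJumpPrimitive a b c y y₀ h p) :
    HasJumpPrimitive a b c (fun t => -y t) (-y₀) (fun t => -h t) (-p) := by
  refine ⟨hy.integrable.neg, fun t ht => ?_⟩
  rw [hy.eq t ht, intervalIntegral.integral_neg]
  split_ifs <;> simp [add_comm]

theorem sub (hy : HasJumpPrimitive a b c y y₀ h p) (hz : HasJumpPrimitive a b c z z₀ k q) :
    HasJumpPrimitive a b c (fun t => y t - z t) (y₀ - z₀) (fun t => h t - k t) (p - q) := by
  simpa only [sub_eq_add_neg] using hy.add hz.neg

theorem congr (hab : a ≤ b) (hy : HasJumpPrimitive a b c y y₀ h p) (h₁ : EqOn z y (Icc a b))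
    (h₂ : z₀ = y₀) (h₃ : EqOn k h (Icc a b)) (h₄ : q = p) : HasJumpPrimitive a b c z z₀ k q := by
  subst h₂ h₄
  refine ⟨hy.integrable.congr fun t ht => (h₃ ?_).symm, fun t ht => ?_⟩
  · rw [uIoc_of_le hab] at ht
    exact Ioc_subset_Icc_self ht
  · rw [h₁ ht, hy.eq t ht, intervalIntegral.integral_congr fun s hs => (h₃ ?_).symm]
    rw [uIcc_of_le ht.1] at hs
    exact ⟨hs.1, hs.2.trans ht.2⟩

theorem of_hasDerivWithinAt [CompleteSpace E] (hab : a ≤ b)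
    (hy : ∀ t ∈ Icc a b, HasDerivWithinAt y (h t) (Icc a b) t) (hc : ContinuousOn h (Icc a b)) :
    HasJumpPrimitive a b c y (y a) h 0 := by
  have hi : IntervalIntegrable h volume a b := hc.intervalIntegrable_of_Icc hab
  refine ⟨hi, fun t ht => ?_⟩
  have hsub : Icc a t ⊆ Icc a b := Icc_subset_Icc_right ht.2
  rw [intervalIntegral.integral_eq_sub_of_hasDerivAt_of_le ht.1
    (fun s hs => (hy s (hsub hs)).continuousWithinAt.mono hsub)
    (fun s hs => (hy s (hsub (Ioo_subset_Icc_self hs))).hasDerivAt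
      (Icc_mem_nhds hs.1 (hs.2.trans_le ht.2)))
    (intervalIntegrable_of_mem_Icc hi (left_mem_Icc.2 hab) ht)]
  simp

theorem continuousOn (hab : a ≤ b) (hy : HasJumpPrimitive a b c y y₀ h 0) :
    ContinuousOn y (Icc a b) :=
  ((continuousOn_const (c := y₀)).add (continuousOn_primitive_Icc hab hy.integrable)).congr
    fun t ht => by simp [hy.eq t ht]

theorem sub_step (hy : HasJumpPrimitive a b c y y₀ h p) :
    HasJumpPrimitive a b c (fun t => y t - if c ≤ t then p else 0) y₀ h 0 :=
  ⟨hy.integrable, fun t ht => by simp [hy.eq t ht]⟩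

theorem aestronglyMeasurable (hab : a ≤ b) (hy : HasJumpPrimitive a b c y y₀ h p) :
    AEStronglyMeasurable y (volume.restrict (Ioc a b)) := by
  have hcont := ((hy.sub_step.continuousOn hab).mono Ioc_subset_Icc_self).aestronglyMeasurable
    (μ := volume) measurableSet_Ioc
  have hstep : StronglyMeasurable fun t : ℝ => if c ≤ t then p else 0 :=
    StronglyMeasurable.ite measurableSet_Ici stronglyMeasurable_const stronglyMeasurable_const
  exact (hcont.add hstep.aestronglyMeasurable).congr (.of_forall fun t => by simp)

theorem exists_bound (hab : a ≤ b) (hy : HasJumpPrimitive a b c y y₀ h p) :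
    ∃ C, ∀ t ∈ Icc a b, ‖y t‖ ≤ C := by
  obtain ⟨C, hC⟩ := isCompact_Icc.exists_bound_of_continuousOn (hy.sub_step.continuousOn hab)
  refine ⟨C + ‖p‖, fun t ht => ?_⟩
  calc ‖y t‖ = ‖(y t - if c ≤ t then p else 0) + if c ≤ t then p else 0‖ := by
        rw [sub_add_cancel]
    _ ≤ C + ‖p‖ := (norm_add_le _ _).trans (add_le_add (hC t ht) (by split_ifs <;> simp))

theorem intervalIntegrable (hab : a ≤ b) (hy : HasJumpPrimitive a b c y y₀ h p) :
    IntervalIntegrable y volume a b := by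
  obtain ⟨C, hC⟩ := hy.exists_bound hab
  rw [intervalIntegrable_iff_integrableOn_Ioc_of_le hab]
  exact Integrable.of_bound (hy.aestronglyMeasurable hab) C <|
    (ae_restrict_mem measurableSet_Ioc).mono fun t ht => hC t (Ioc_subset_Icc_self ht)

theorem eq_right (hc : c ≤ b) (hy : HasJumpPrimitive a b c y y₀ h p) {t : ℝ} (ht : t ∈ Icc a b) :
    y t = y b - (∫ s in t..b, h s) - if t < c then p else 0 := by
  have ha : a ∈ Icc a b := left_mem_Icc.2 (ht.1.trans ht.2)
  have hb : b ∈ Icc a b := right_mem_Icc.2 (ht.1.trans ht.2)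
  rw [hy.eq t ht, hy.eq b hb, if_pos hc, ← intervalIntegral.integral_add_adjacent_intervals
    (intervalIntegrable_of_mem_Icc hy.integrable ha ht)
    (intervalIntegrable_of_mem_Icc hy.integrable ht hb)]
  rcases le_or_gt c t with h | h
  · rw [if_pos h, if_neg h.not_gt]
    abel
  · rw [if_neg h.not_ge, if_pos h]
    abel

theorem of_eq_right (hi : IntervalIntegrable h volume a b) {yb : E}
    (hy : ∀ t ∈ Icc a b, y t = yb - (∫ s in t..b, h s) - if t < c then p else 0) :
    HasJumpPrimitive a b c y (yb - (∫ s in a..b, h s) - p) h p := by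
  refine ⟨hi, fun t ht => ?_⟩
  have ha : a ∈ Icc a b := left_mem_Icc.2 (ht.1.trans ht.2)
  have hb : b ∈ Icc a b := right_mem_Icc.2 (ht.1.trans ht.2)
  rw [hy t ht, ← intervalIntegral.integral_add_adjacent_intervals
    (intervalIntegrable_of_mem_Icc hi ha ht) (intervalIntegrable_of_mem_Icc hi ht hb)]
  rcases le_or_gt c t with h | h
  · rw [if_pos h, if_neg h.not_gt]
    abel
  · rw [if_neg h.not_ge, if_pos h]
    abel

theorem bilin_of_continuous [CompleteSpace E] [CompleteSpace F] [CompleteSpace G]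
    (B : E →L[ℝ] F →L[ℝ] G) (hab : a ≤ b) (hy : HasJumpPrimitive a b c y y₀ h 0) {z : ℝ → F}
    {z₀ : F} {k : ℝ → F} (hz : HasJumpPrimitive a b c z z₀ k 0) :
    HasJumpPrimitive a b c (fun t => B (y t) (z t)) (B y₀ z₀)
      (fun t => B (h t) (z t) + B (y t) (k t)) 0 := by
  have hhz := intervalIntegrable_bilin_continuousOn hab B hy.integrable (hz.continuousOn hab)
  have hyk := intervalIntegrable_bilin_continuousOn hab B.flip hz.integrable (hy.continuousOn hab)
  simp only [ContinuousLinearMap.flip_apply] at hyk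
  refine ⟨hhz.add hyk, fun t ht => ?_⟩
  have hsub : ∀ {s}, s ∈ uIcc a t → s ∈ Icc a b := fun hs => by
    rw [uIcc_of_le ht.1] at hs
    exact ⟨hs.1, hs.2.trans ht.2⟩
  have ha := left_mem_Icc.2 hab
  have hh := intervalIntegrable_of_mem_Icc hy.integrable ha ht
  have hk := intervalIntegrable_of_mem_Icc hz.integrable ha ht
  have hleft : ∫ s in a..t, B (h s) (∫ r in a..s, k r) =
      (∫ s in a..t, B (h s) (z s)) - B (∫ s in a..t, h s) z₀ := by
    rw [← B.flip_apply, ← (B.flip z₀).intervalIntegral_comp_comm hh,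
      ← intervalIntegral.integral_sub (intervalIntegrable_of_mem_Icc hhz ha ht)
        (intervalIntegrable_clm_apply hh _)]
    exact intervalIntegral.integral_congr fun s hs => by simp [hz.eq s (hsub hs)]
  have hright : ∫ s in a..t, B (∫ r in a..s, h r) (k s) =
      (∫ s in a..t, B (y s) (k s)) - B y₀ (∫ s in a..t, k s) := by
    rw [← (B y₀).intervalIntegral_comp_comm hk,
      ← intervalIntegral.integral_sub (intervalIntegrable_of_mem_Icc hyk ha ht)
        (intervalIntegrable_clm_apply hk _)]
    exact intervalIntegral.integral_congr fun s hs => by simp [hy.eq s (hsub hs)]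
  have hfubini := integral_bilin_primitive_add B ht.1 hh hk
  rw [hleft, hright] at hfubini
  rw [intervalIntegral.integral_add (intervalIntegrable_of_mem_Icc hhz ha ht)
    (intervalIntegrable_of_mem_Icc hyk ha ht), hy.eq t ht, hz.eq t ht]
  simp only [ite_self, add_zero, map_add, add_apply, ← hfubini]
  abel

theorem step_mul (hab : a ≤ b) (hc : c ∈ Icc a b) (hy : HasJumpPrimitive a b c y y₀ h 0) :
    HasJumpPrimitive a b c (fun t => if c ≤ t then y t else 0) 0
      (fun t => if c ≤ t then h t else 0) (y c) := by
  have hi : IntervalIntegrable (fun t => if c ≤ t then h t else 0) volume a b := by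
    rw [intervalIntegrable_iff_integrableOn_Ioc_of_le hab]
    exact ((intervalIntegrable_iff_integrableOn_Ioc_of_le hab).1 hy.integrable).indicator
      measurableSet_Ici
  have hzero : ∀ t ∈ Icc a c, ∫ s in a..t, (if c ≤ s then h s else 0) = 0 := fun t ht => by
    rw [intervalIntegral.integral_congr_Ioo_of_le (g := fun _ => 0) ht.1 fun s hs =>
      if_neg (hs.2.trans_le ht.2).not_ge, intervalIntegral.integral_zero]
  refine ⟨hi, fun t ht => ?_⟩
  have ha := left_mem_Icc.2 hab
  rcases le_or_gt c t with hct | hct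
  · have htail : ∫ s in c..t, (if c ≤ s then h s else 0) = ∫ s in c..t, h s :=
      intervalIntegral.integral_congr fun s hs => by
        rw [uIcc_of_le hct] at hs
        exact if_pos hs.1
    rw [if_pos hct, if_pos hct, ← intervalIntegral.integral_add_adjacent_intervals
      (intervalIntegrable_of_mem_Icc hi ha hc) (intervalIntegrable_of_mem_Icc hi hc ht),
      hzero c ⟨hc.1, le_rfl⟩, htail, hy.eq t ht, hy.eq c hc,
      ← intervalIntegral.integral_add_adjacent_intervals
        (intervalIntegrable_of_mem_Icc hy.integrable ha hc)
        (intervalIntegrable_of_mem_Icc hy.integrable hc ht)]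
    simp only [ite_self]
    abel
  · rw [if_neg hct.not_ge, if_neg hct.not_ge, hzero t ⟨ht.1, hct.le⟩]
    simp

theorem bilin [CompleteSpace E] [CompleteSpace F] [CompleteSpace G] (B : E →L[ℝ] F →L[ℝ] G)
    (hab : a ≤ b) (hc : c ∈ Icc a b) (hy : HasJumpPrimitive a b c y y₀ h 0) {z : ℝ → F} {z₀ : F}
    {k : ℝ → F} {q : F} (hz : HasJumpPrimitive a b c z z₀ k q) :
    HasJumpPrimitive a b c (fun t => B (y t) (z t)) (B y₀ z₀)
      (fun t => B (h t) (z t) + B (y t) (k t)) (B (y c) q) := by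
  have hcont := hy.bilin_of_continuous B hab hz.sub_step
  have hjump := (((B.flip q).map_zero ▸ hy.clm_apply (B.flip q)).step_mul hab hc)
  refine (hcont.add hjump).congr hab (fun t _ => ?_) (by simp) (fun t _ => ?_) (by simp)
  all_goals
    split_ifs <;> simp <;> abel

end HasJumpPrimitive

end Primitive

/-! ### Linear Hamiltonian systems -/

/-- The data of the linear Hamiltonian system `x' = F x - N λ`, `λ' = -Fᵀ λ - K x`,
`λ(T) = P x(T)` on `[0,T]`, with `N` positive semidefinite and `K`, `P` at least `γ`. -/
structure HamiltonianSystem (V : Type*) [NormedAddCommGroup V] [InnerProductSpace ℝ V]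
    (T γ : ℝ) where
  F : ℝ → V →L[ℝ] V
  N : ℝ → V →L[ℝ] V
  K : ℝ → V →L[ℝ] V
  P : V →L[ℝ] V
  T_pos : 0 < T
  gam_pos : 0 < γ
  contF : ContinuousOn F (Icc 0 T)
  contN : ContinuousOn N (Icc 0 T)
  contK : ContinuousOn K (Icc 0 T)
  nonneg_N : ∀ t ∈ Icc 0 T, 0 ≤ N t
  coercive_K : ∀ t ∈ Icc 0 T, γ • (1 : V →L[ℝ] V) ≤ K t
  coercive_P : γ • (1 : V →L[ℝ] V) ≤ P

namespace HamiltonianSystem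

section Solutions

variable {V : Type*} [NormedAddCommGroup V] [InnerProductSpace ℝ V] {T γ : ℝ}

theorem nonneg_K (S : HamiltonianSystem V T γ) {t : ℝ} (ht : t ∈ Icc 0 T) : 0 ≤ S.K t := by
  obtain ⟨hsymm, hle⟩ := smul_one_le_iff.1 (S.coercive_K t ht)
  have := S.gam_pos
  exact nonneg_iff.2 ⟨hsymm, fun x => le_trans (by positivity) (hle x)⟩

theorem nonneg_P (S : HamiltonianSystem V T γ) : 0 ≤ S.P := by
  obtain ⟨hsymm, hle⟩ := smul_one_le_iff.1 S.coercive_P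
  have := S.gam_pos
  exact nonneg_iff.2 ⟨hsymm, fun x => le_trans (by positivity) (hle x)⟩

variable [CompleteSpace V]

/-- `(x, λ)` solves the Hamiltonian system on `[0,T]` together with its terminal condition. -/
structure IsSolution (S : HamiltonianSystem V T γ) (x lam : ℝ → V) : Prop where
  deriv_x : ∀ t ∈ Icc 0 T, HasDerivWithinAt x (S.F t (x t) - S.N t (lam t)) (Icc 0 T) t
  deriv_lam : ∀ t ∈ Icc 0 T,
    HasDerivWithinAt lam (-((S.F t)†) (lam t) - S.K t (x t)) (Icc 0 T) t
  right : lam T = S.P (x T)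

/-- Two-sided bounds of the value function `⟨x, λ⟩` (the quadratic form of the solution of the
Riccati equation) by multiples of `‖x‖²`. -/
structure HasValueBounds (S : HamiltonianSystem V T γ) (c₀ c₁ : ℝ) : Prop where
  pos₀ : 0 < c₀
  pos₁ : 0 < c₁
  le_inner : ∀ {x lam}, S.IsSolution x lam → ∀ t ∈ Icc 0 T, c₀ * ‖x t‖ ^ 2 ≤ ⟪x t, lam t⟫_ℝ
  inner_le : ∀ {x lam}, S.IsSolution x lam → ∀ t ∈ Icc 0 T, ⟪x t, lam t⟫_ℝ ≤ c₁ * ‖x t‖ ^ 2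

variable {S : HamiltonianSystem V T γ} {x lam y mu : ℝ → V} {t : ℝ}

namespace IsSolution

theorem hasDerivWithinAt_inner (h : S.IsSolution x lam) (ht : t ∈ Icc 0 T) :
    HasDerivWithinAt (fun t => ⟪x t, lam t⟫_ℝ)
      (-(⟪x t, S.K t (x t)⟫_ℝ + ⟪lam t, S.N t (lam t)⟫_ℝ)) (Icc 0 T) t := by
  refine ((h.deriv_x t ht).inner ℝ (h.deriv_lam t ht)).congr_deriv ?_
  simp only [inner_sub_left, inner_sub_right, inner_neg_right,
    ContinuousLinearMap.adjoint_inner_right, real_inner_comm (lam t) (S.N t (lam t))]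
  ring

theorem inner_eq_inner (h : S.IsSolution x lam) (h' : S.IsSolution y mu) (ht : t ∈ Icc 0 T) :
    ⟪x t, mu t⟫_ℝ = ⟪lam t, y t⟫_ℝ := by
  have hwronskian : ∀ r ∈ Icc 0 T,
      HasDerivWithinAt (fun t => ⟪x t, mu t⟫_ℝ - ⟪lam t, y t⟫_ℝ) 0 (Icc 0 T) r := by
    intro r hr
    have hN : ⟪S.N r (lam r), mu r⟫_ℝ = ⟪lam r, S.N r (mu r)⟫_ℝ :=
      (nonneg_iff.1 (S.nonneg_N r hr)).1 _ _
    have hK : ⟪S.K r (x r), y r⟫_ℝ = ⟪x r, S.K r (y r)⟫_ℝ := (nonneg_iff.1 (S.nonneg_K hr)).1 _ _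
    refine (((h.deriv_x r hr).inner ℝ (h'.deriv_lam r hr)).sub
      ((h.deriv_lam r hr).inner ℝ (h'.deriv_x r hr))).congr_deriv ?_
    simp only [inner_sub_left, inner_sub_right, inner_neg_right, inner_neg_left,
      ContinuousLinearMap.adjoint_inner_right, ContinuousLinearMap.adjoint_inner_left, hN, hK]
    ring
  have hT : ⟪S.P (x T), y T⟫_ℝ = ⟪x T, S.P (y T)⟫_ℝ := (nonneg_iff.1 S.nonneg_P).1 _ _
  have hconst := eq_of_hasDerivWithinAt_zero hwronskian ht ⟨S.T_pos.le, le_rfl⟩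
  simp only [h.right, h'.right, hT, sub_self] at hconst
  exact sub_eq_zero.1 hconst

theorem gam_mul_norm_sq_le_inner (h : S.IsSolution x lam) (ht : t ∈ Icc 0 T) :
    γ * ‖x T‖ ^ 2 ≤ ⟪x t, lam t⟫_ℝ := by
  have hsub : Icc t T ⊆ Icc 0 T := Icc_subset_Icc_left ht.1
  have hdecr : -⟪x t, lam t⟫_ℝ ≤ -⟪x T, lam T⟫_ℝ :=
    le_of_hasDerivWithinAt_nonneg ht.2
      (fun s hs => ((h.hasDerivWithinAt_inner (hsub hs)).neg.mono hsub)) fun s hs => by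
        have hN := (nonneg_iff.1 (S.nonneg_N s (hsub hs))).2 (lam s)
        have hK := (nonneg_iff.1 (S.nonneg_K (hsub hs))).2 (x s)
        linarith
  rw [h.right] at hdecr
  linarith [(smul_one_le_iff.1 S.coercive_P).2 (x T)]

theorem eq_zero_of_eq_zero (h : S.IsSolution x lam) (ht : t ∈ Icc 0 T) (hx : x t = 0) :
    x T = 0 := by
  have hle := h.gam_mul_norm_sq_le_inner ht
  rw [hx, inner_zero_left] at hle
  have hsq : ‖x T‖ ^ 2 ≤ 0 := nonpos_of_mul_nonpos_right hle S.gam_pos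
  simpa using hsq

theorem exp_mul_inner_le (h : S.IsSolution x lam) {c : ℝ} (hc : 0 < c)
    (hle : ∀ t ∈ Icc 0 T, ⟪x t, lam t⟫_ℝ ≤ c * ‖x t‖ ^ 2) {s : ℝ} (hs : s ∈ Icc 0 T)
    (ht : t ∈ Icc 0 T) (hst : s ≤ t) :
    Real.exp (γ / c * (t - s)) * ⟪x t, lam t⟫_ℝ ≤ ⟪x s, lam s⟫_ℝ := by
  have hsub : Icc s t ⊆ Icc 0 T := Icc_subset_Icc hs.1 ht.2
  have hderiv : ∀ r ∈ Icc s t, HasDerivWithinAt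
      (fun r => -(Real.exp (γ / c * (r - s)) * ⟪x r, lam r⟫_ℝ))
      (Real.exp (γ / c * (r - s)) *
        (⟪x r, S.K r (x r)⟫_ℝ + ⟪lam r, S.N r (lam r)⟫_ℝ - γ / c * ⟪x r, lam r⟫_ℝ))
      (Icc s t) r := by
    intro r hr
    have hexp : HasDerivAt (fun r => Real.exp (γ / c * (r - s)))
        (Real.exp (γ / c * (r - s)) * (γ / c)) r := by
      simpa using (((hasDerivAt_id r).sub_const s).const_mul (γ / c)).exp
    refine (hexp.hasDerivWithinAt.mul
      ((h.hasDerivWithinAt_inner (hsub hr)).mono hsub)).neg.congr_deriv ?_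
    ring
  have hmono := le_of_hasDerivWithinAt_nonneg hst hderiv fun r hr => by
    have hN := (nonneg_iff.1 (S.nonneg_N r (hsub hr))).2 (lam r)
    have hK := (smul_one_le_iff.1 (S.coercive_K r (hsub hr))).2 (x r)
    have hγ : γ / c * ⟪x r, lam r⟫_ℝ ≤ γ * ‖x r‖ ^ 2 := by
      have := S.gam_pos
      calc _ ≤ γ / c * (c * ‖x r‖ ^ 2) := by gcongr; exact hle r (hsub hr)
        _ = _ := by field_simp
    exact mul_nonneg (Real.exp_pos _).le (by linarith)
  simpa using hmono

theorem norm_le_exp_mul (h : S.IsSolution x lam) {c₀ c₁ : ℝ} (hS : S.HasValueBounds c₀ c₁)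
    {s : ℝ} (hs : s ∈ Icc 0 T) (ht : t ∈ Icc 0 T) (hst : s ≤ t) :
    ‖x t‖ ≤ √(c₁ / c₀) * Real.exp (-(γ / (2 * c₁)) * (t - s)) * ‖x s‖ := by
  have h0 := hS.pos₀
  have h1 := hS.pos₁
  have hlyapunov := h.exp_mul_inner_le h1 (hS.inner_le h) hs ht hst
  have hexp : Real.exp (-(γ / (2 * c₁)) * (t - s)) ^ 2 = (Real.exp (γ / c₁ * (t - s)))⁻¹ := by
    rw [← Real.exp_neg, ← Real.exp_nat_mul]
    congr 1
    push_cast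
    field_simp
  refine le_of_sq_le_sq ?_ (by positivity)
  rw [mul_pow, mul_pow, Real.sq_sqrt (by positivity), hexp]
  calc ‖x t‖ ^ 2 = (Real.exp (γ / c₁ * (t - s)) * (c₀ * ‖x t‖ ^ 2)) / c₀ *
        (Real.exp (γ / c₁ * (t - s)))⁻¹ := by field_simp
    _ ≤ (c₁ * ‖x s‖ ^ 2) / c₀ * (Real.exp (γ / c₁ * (t - s)))⁻¹ := by
        gcongr ?_ / c₀ * _
        exact (mul_le_mul_of_nonneg_left (hS.le_inner h t ht) (Real.exp_pos _).le).trans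
          (hlyapunov.trans (hS.inner_le h s hs))
    _ = _ := by ring

end IsSolution

end Solutions

section Fundamental

variable {V : Type*} [NormedAddCommGroup V] [InnerProductSpace ℝ V] [CompleteSpace V] {T γ : ℝ}

/-- The operator solutions `X`, `L` of the Hamiltonian system with `X(T) = 1`, `L(T) = P`,
together with the inverse `Y` of `X`. -/
structure Fundamental (S : HamiltonianSystem V T γ) where
  X : ℝ → V →L[ℝ] V
  L : ℝ → V →L[ℝ] V
  Y : ℝ → V →L[ℝ] V
  deriv_X : ∀ t ∈ Icc 0 T, HasDerivWithinAt X (S.F t ∘L X t - S.N t ∘L L t) (Icc 0 T) t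
  deriv_L : ∀ t ∈ Icc 0 T, HasDerivWithinAt L (-((S.F t)†) ∘L L t - S.K t ∘L X t) (Icc 0 T) t
  X_right : X T = 1
  L_right : L T = S.P
  X_Y : ∀ t ∈ Icc 0 T, ∀ v, X t (Y t v) = v
  Y_X : ∀ t ∈ Icc 0 T, ∀ v, Y t (X t v) = v

theorem isSolution_apply {S : HamiltonianSystem V T γ} {X L : ℝ → V →L[ℝ] V}
    (hX : ∀ t ∈ Icc 0 T, HasDerivWithinAt X (S.F t ∘L X t - S.N t ∘L L t) (Icc 0 T) t)
    (hL : ∀ t ∈ Icc 0 T, HasDerivWithinAt L (-((S.F t)†) ∘L L t - S.K t ∘L X t) (Icc 0 T) t)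
    (hXT : X T = 1) (hLT : L T = S.P) (v : V) :
    S.IsSolution (fun t => X t v) (fun t => L t v) where
  deriv_x t ht := by simpa using hasDerivWithinAt_apply (hX t ht) v
  deriv_lam t ht := by simpa using hasDerivWithinAt_apply (hL t ht) v
  right := by simp [hXT, hLT]

theorem exists_operator_solution [FiniteDimensional ℝ V] (S : HamiltonianSystem V T γ) :
    ∃ X L : ℝ → V →L[ℝ] V,
      (∀ t ∈ Icc 0 T, HasDerivWithinAt X (S.F t ∘L X t - S.N t ∘L L t) (Icc 0 T) t) ∧
      (∀ t ∈ Icc 0 T, HasDerivWithinAt L (-((S.F t)†) ∘L L t - S.K t ∘L X t) (Icc 0 T) t) ∧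
      X T = 1 ∧ L T = S.P := by
  let i₁ := ContinuousLinearMap.inl ℝ V V
  let i₂ := ContinuousLinearMap.inr ℝ V V
  let p₁ := ContinuousLinearMap.fst ℝ V V
  let p₂ := ContinuousLinearMap.snd ℝ V V
  let j : V →L[ℝ] V × V := i₁ + i₂ ∘L S.P
  let M : ℝ → (V × V) →L[ℝ] (V × V) := fun t =>
    i₁ ∘L (S.F t ∘L p₁ - S.N t ∘L p₂) + i₂ ∘L (-((S.F t)†) ∘L p₂ - S.K t ∘L p₁)
  have hM : ContinuousOn M (Icc 0 T) := by
    have hF := S.contF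
    have hN := S.contN
    have hK := S.contK
    have hF' : ContinuousOn (fun t => (S.F t)†) (Icc 0 T) :=
      continuousOn_adjoint S.contF
    fun_prop
  obtain ⟨Z, hZT, hZ⟩ := exists_fundamental S.T_pos hM ⟨S.T_pos.le, le_rfl⟩
  have hderiv : ∀ p : V × V →L[ℝ] V, ∀ t ∈ Icc 0 T,
      HasDerivWithinAt (fun t => p ∘L Z t ∘L j) (p ∘L (M t ∘L Z t) ∘L j) (Icc 0 T) t :=
    fun p t ht => ((hasDerivWithinAt_const t _ p).clm_comp
      ((hZ t ht).clm_comp (hasDerivWithinAt_const t _ j))).congr_deriv (by simp)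
  refine ⟨fun t => p₁ ∘L Z t ∘L j, fun t => p₂ ∘L Z t ∘L j, fun t ht => ?_, fun t ht => ?_, ?_, ?_⟩
  · refine (hderiv p₁ t ht).congr_deriv ?_
    ext v
    simp [M, i₁, i₂, p₁, p₂]
  · refine (hderiv p₂ t ht).congr_deriv ?_
    ext v
    simp [M, i₁, i₂, p₁, p₂]
  · ext v
    simp [hZT, j, i₁, i₂, p₁]
  · ext v
    simp [hZT, j, i₁, i₂, p₂]

theorem nonempty_fundamental [FiniteDimensional ℝ V] (S : HamiltonianSystem V T γ) :
    Nonempty S.Fundamental := by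
  obtain ⟨X, L, hX, hL, hXT, hLT⟩ := S.exists_operator_solution
  have hunit : ∀ t ∈ Icc 0 T, IsUnit (X t) := by
    intro t ht
    have hinj : Function.Injective (X t) := (injective_iff_map_eq_zero _).2 fun v hv => by
      simpa [hXT] using (isSolution_apply hX hL hXT hLT v).eq_zero_of_eq_zero ht hv
    rw [ContinuousLinearMap.isUnit_iff_bijective]
    exact ⟨hinj, (LinearMap.injective_iff_surjective (f := (X t : V →ₗ[ℝ] V))).1 hinj⟩
  exact ⟨{
    X := X
    L := L
    Y := fun t => Ring.inverse (X t)
    deriv_X := hX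
    deriv_L := hL
    X_right := hXT
    L_right := hLT
    X_Y := fun t ht v => DFunLike.congr_fun (Ring.mul_inverse_cancel _ (hunit t ht)) v
    Y_X := fun t ht v => DFunLike.congr_fun (Ring.inverse_mul_cancel _ (hunit t ht)) v }⟩

namespace Fundamental

variable {S : HamiltonianSystem V T γ} {t : ℝ}

theorem isSolution (Z : S.Fundamental) (v : V) :
    S.IsSolution (fun t => Z.X t v) (fun t => Z.L t v) :=
  isSolution_apply Z.deriv_X Z.deriv_L Z.X_right Z.L_right v

theorem Y_eq_inverse (Z : S.Fundamental) (ht : t ∈ Icc 0 T) : Z.Y t = Ring.inverse (Z.X t) :=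
  (Ring.inverse_unit ⟨Z.X t, Z.Y t, ContinuousLinearMap.ext (Z.X_Y t ht),
    ContinuousLinearMap.ext (Z.Y_X t ht)⟩).symm

theorem deriv_Y (Z : S.Fundamental) (ht : t ∈ Icc 0 T) :
    HasDerivWithinAt Z.Y (-(Z.Y t ∘L (S.F t ∘L Z.X t - S.N t ∘L Z.L t) ∘L Z.Y t)) (Icc 0 T) t := by
  have hinverse := hasFDerivAt_ringInverse (𝕜 := ℝ)
    (⟨Z.X t, Z.Y t, ContinuousLinearMap.ext (Z.X_Y t ht),
      ContinuousLinearMap.ext (Z.Y_X t ht)⟩ : (V →L[ℝ] V)ˣ)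
  exact (hinverse.comp_hasDerivWithinAt t (Z.deriv_X t ht)).congr (fun s hs => Z.Y_eq_inverse hs)
    (Z.Y_eq_inverse ht)

theorem inner_X_L (Z : S.Fundamental) (ht : t ∈ Icc 0 T) (v w : V) :
    ⟪Z.X t v, Z.L t w⟫_ℝ = ⟪Z.L t v, Z.X t w⟫_ℝ :=
  (Z.isSolution v).inner_eq_inner (Z.isSolution w) ht

/-- The solution of the Riccati equation, which maps the state of a solution of the Hamiltonian
system to its adjoint. -/
def riccati (Z : S.Fundamental) (t : ℝ) : V →L[ℝ] V := Z.L t ∘L Z.Y t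

theorem norm_riccati_le (Z : S.Fundamental) {c₀ c₁ : ℝ} (hS : S.HasValueBounds c₀ c₁)
    (ht : t ∈ Icc 0 T) : ‖Z.riccati t‖ ≤ c₁ := by
  have h0 := hS.pos₀
  have hsymm : (Z.riccati t : V →ₗ[ℝ] V).IsSymmetric := fun v w => by
    have h := Z.inner_X_L ht (Z.Y t v) (Z.Y t w)
    rw [Z.X_Y t ht, Z.X_Y t ht] at h
    exact h.symm
  have hvalue : ∀ v, ⟪Z.X t (Z.Y t v), Z.L t (Z.Y t v)⟫_ℝ = ⟪v, Z.riccati t v⟫_ℝ := fun v => by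
    rw [Z.X_Y t ht, riccati, ContinuousLinearMap.comp_apply]
  refine norm_le_of_nonneg_of_le_smul_one hS.pos₁.le
    (nonneg_iff.2 ⟨hsymm, fun v => ?_⟩) (le_smul_one_iff.2 ⟨hsymm, fun v => ?_⟩)
  · rw [← hvalue]
    exact le_trans (by positivity) (hS.le_inner (Z.isSolution _) t ht)
  · rw [← hvalue]
    simpa only [Z.X_Y t ht] using hS.inner_le (Z.isSolution (Z.Y t v)) t ht

end Fundamental

end Fundamental
end HamiltonianSystem

section Flow

variable {E : Type*} [NormedAddCommGroup E] [NormedSpace ℝ E] {T κ a : ℝ}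

theorem exists_solution_norm_sq_le [FiniteDimensional ℝ E] {M : ℝ → E →L[ℝ] E}
    (hT : 0 < T) (hM : ContinuousOn M (Icc 0 T)) (hκ : ∀ t ∈ Icc 0 T, ‖M t‖ ≤ κ)
    (ha : a ∈ Icc 0 T) (v : E) :
    ∃ y : ℝ → E, y a = v ∧ (∀ t ∈ Icc a T, HasDerivWithinAt y (M t (y t)) (Icc a T) t) ∧
      ∀ t ∈ Icc a T, ‖y t‖ ^ 2 ≤ Real.exp (2 * κ * (t - a)) * ‖v‖ ^ 2 := by
  have hsub : Icc a T ⊆ Icc 0 T := Icc_subset_Icc_left ha.1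
  obtain ⟨Z, hZa, hZ⟩ := exists_fundamental hT hM ha
  have hderiv : ∀ t ∈ Icc a T,
      HasDerivWithinAt (fun t => Z t v) (M t (Z t v)) (Icc a T) t := fun t ht => by
    simpa using (hasDerivWithinAt_apply (hZ t (hsub ht)) v).mono hsub
  refine ⟨fun t => Z t v, by simp [hZa], hderiv, fun t ht => ?_⟩
  have hnorm := norm_le_exp_mul_of_norm_deriv_le hderiv
    (fun s hs => ((M s).le_opNorm _).trans
      (mul_le_mul_of_nonneg_right (hκ s (hsub hs)) (norm_nonneg _))) ht
  have hexp : Real.exp (2 * κ * (t - a)) = Real.exp (κ * (t - a)) ^ 2 := by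
    rw [← Real.exp_nat_mul, Nat.cast_ofNat, mul_assoc]
  rw [hexp, ← mul_pow]
  exact pow_le_pow_left₀ (norm_nonneg _) (by simpa [hZa] using hnorm) 2

theorem hasDerivAt_exp_primitive (hκ : 0 < κ) (c a t : ℝ) :
    HasDerivAt (fun s => c * (Real.exp (2 * κ * (s - a)) / (2 * κ)))
      (c * Real.exp (2 * κ * (t - a))) t := by
  have hexp : HasDerivAt (fun s => Real.exp (2 * κ * (s - a)))
      (Real.exp (2 * κ * (t - a)) * (2 * κ)) t := by
    simpa using (((hasDerivAt_id t).sub_const a).const_mul (2 * κ)).exp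
  refine ((hexp.div_const (2 * κ)).const_mul c).congr_deriv ?_
  field_simp

end Flow

theorem dual_window_cost_le {V : Type*} [NormedAddCommGroup V] [InnerProductSpace ℝ V]
    [CompleteSpace V] {F N : V →L[ℝ] V} {v : V} {κ γ σ ν θ : ℝ} (hσ : 0 < σ) (hγ : 0 ≤ γ)
    (hF : ‖F‖ ≤ κ) (hν : 0 ≤ ν) (hN : N ≤ ν • 1) (hθ₀ : 0 ≤ θ) (hθ₁ : θ ≤ 1) :
    ⟪θ • v, N (θ • v)⟫_ℝ + ‖(-σ⁻¹) • v + (F†) (θ • v)‖ ^ 2 / γ ≤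
      (ν + (σ⁻¹ + κ) ^ 2 / γ) * ‖v‖ ^ 2 := by
  have hθ : ‖θ • v‖ ≤ ‖v‖ := by
    rw [norm_smul, Real.norm_of_nonneg hθ₀]
    exact mul_le_of_le_one_left (norm_nonneg _) hθ₁
  have hw : ‖(-σ⁻¹) • v + (F†) (θ • v)‖ ≤ (σ⁻¹ + κ) * ‖v‖ := by
    rw [add_mul]
    refine norm_add_le_of_le (by simp [norm_smul, abs_of_pos hσ]) ?_
    refine (ContinuousLinearMap.le_opNorm _ _).trans ?_
    rw [LinearIsometryEquiv.norm_map]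
    exact mul_le_mul hF hθ (norm_nonneg _) ((norm_nonneg _).trans hF)
  calc _ ≤ ν * ‖v‖ ^ 2 + ((σ⁻¹ + κ) * ‖v‖) ^ 2 / γ := by
        refine add_le_add (((le_smul_one_iff.1 hN).2 _).trans ?_) ?_ <;> gcongr
    _ = _ := by ring

namespace HamiltonianSystem.IsSolution

variable {V : Type*} [NormedAddCommGroup V] [InnerProductSpace ℝ V] [CompleteSpace V]
  {T γ : ℝ} {S : HamiltonianSystem V T γ} {x lam : ℝ → V} {a b : ℝ} {β β' : ℝ → ℝ}

theorem inner_le_of_primal (h : S.IsSolution x lam) (hab : a ≤ b)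
    (hsub : Icc a b ⊆ Icc 0 T) {ξ ζ : ℝ → V} {r : ℝ → ℝ} (hξa : ξ a = x a)
    (hξ : ∀ t ∈ Icc a b, HasDerivWithinAt ξ (S.F t (ξ t) + ζ t) (Icc a b) t)
    (hζ : ∀ t ∈ Icc a b, ∀ v, 0 ≤ ⟪v, S.N t v⟫_ℝ + 2 * ⟪v, ζ t⟫_ℝ + r t)
    (hβ : ∀ t ∈ Icc a b, HasDerivWithinAt β (β' t) (Icc a b) t)
    (hβ' : ∀ t ∈ Icc a b, ⟪ξ t, S.K t (ξ t)⟫_ℝ + r t ≤ β' t) :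
    ⟪x a, lam a⟫_ℝ ≤ 2 * ⟪lam b, ξ b⟫_ℝ - ⟪x b, lam b⟫_ℝ + β b - β a := by
  have hderiv : ∀ t ∈ Icc a b, HasDerivWithinAt
      (fun t => 2 * ⟪lam t, ξ t⟫_ℝ - ⟪x t, lam t⟫_ℝ + β t)
      (2 * (⟪lam t, S.F t (ξ t) + ζ t⟫_ℝ + ⟪-((S.F t)†) (lam t) - S.K t (x t), ξ t⟫_ℝ) -
        (-(⟪x t, S.K t (x t)⟫_ℝ + ⟪lam t, S.N t (lam t)⟫_ℝ)) + β' t) (Icc a b) t := fun t ht =>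
    (((((h.deriv_lam t (hsub ht)).mono hsub).inner ℝ (hξ t ht)).const_mul 2).sub
      ((h.hasDerivWithinAt_inner (hsub ht)).mono hsub)).add (hβ t ht)
  have hmono := le_of_hasDerivWithinAt_nonneg hab hderiv fun t ht => by
    have hK := two_mul_inner_sub_inner_le (S.nonneg_K (hsub ht)) (x t) (ξ t)
    simp only [inner_add_right, inner_sub_left, inner_neg_left,
      ContinuousLinearMap.adjoint_inner_left]
    linarith [hζ t ht (lam t), hβ' t ht]
  rw [hξa, real_inner_comm (x a) (lam a)] at hmono
  linarith

theorem le_inner_of_dual (h : S.IsSolution x lam) (hab : a ≤ b) (hsub : Icc a b ⊆ Icc 0 T)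
    {y w : ℝ → V} (hy : ∀ t ∈ Icc a b, HasDerivWithinAt y (-((S.F t)†) (y t) + w t) (Icc a b) t)
    (hβ : ∀ t ∈ Icc a b, HasDerivWithinAt β (β' t) (Icc a b) t)
    (hβ' : ∀ t ∈ Icc a b, ⟪y t, S.N t (y t)⟫_ℝ + ‖w t‖ ^ 2 / γ ≤ β' t) :
    2 * ⟪x a, y a⟫_ℝ - (2 * ⟪x b, y b⟫_ℝ - ⟪x b, lam b⟫_ℝ + β b - β a) ≤ ⟪x a, lam a⟫_ℝ := by
  have hderiv : ∀ t ∈ Icc a b, HasDerivWithinAt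
      (fun t => 2 * ⟪x t, y t⟫_ℝ - ⟪x t, lam t⟫_ℝ + β t)
      (2 * (⟪x t, -((S.F t)†) (y t) + w t⟫_ℝ + ⟪S.F t (x t) - S.N t (lam t), y t⟫_ℝ) -
        (-(⟪x t, S.K t (x t)⟫_ℝ + ⟪lam t, S.N t (lam t)⟫_ℝ)) + β' t) (Icc a b) t := fun t ht =>
    (((((h.deriv_x t (hsub ht)).mono hsub).inner ℝ (hy t ht)).const_mul 2).sub
      ((h.hasDerivWithinAt_inner (hsub ht)).mono hsub)).add (hβ t ht)
  have hmono := le_of_hasDerivWithinAt_nonneg hab hderiv fun t ht => by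
    have hN := two_mul_inner_sub_inner_le (S.nonneg_N t (hsub ht)) (lam t) (y t)
    have hK := (smul_one_le_iff.1 (S.coercive_K t (hsub ht))).2 (x t)
    simp only [inner_add_right, inner_sub_left, inner_neg_right,
      ContinuousLinearMap.adjoint_inner_right]
    linarith [hβ' t ht, completed_square_nonneg S.gam_pos (x t) (w t)]
  linarith

variable {κ σ c : ℝ}

theorem inner_le_tail [FiniteDimensional ℝ V] (h : S.IsSolution x lam) (hκ : 0 < κ)
    (hF : ∀ t ∈ Icc 0 T, ‖S.F t‖ ≤ κ) (hc : 0 ≤ c) (hK : ∀ t ∈ Icc 0 T, S.K t ≤ c • 1)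
    (hP : S.P ≤ c • 1) (ha : a ∈ Icc 0 T) (haσ : T - a ≤ σ) :
    ⟪x a, lam a⟫_ℝ ≤ c * (1 + 1 / (2 * κ)) * Real.exp (2 * κ * σ) * ‖x a‖ ^ 2 := by
  have hsub : Icc a T ⊆ Icc 0 T := Icc_subset_Icc_left ha.1
  obtain ⟨ξ, hξa, hξ, hnorm⟩ := exists_solution_norm_sq_le S.T_pos S.contF hF ha (x a)
  have hvalue := h.inner_le_of_primal ha.2 hsub (ζ := 0) (r := 0)
    (β := fun s => c * ‖x a‖ ^ 2 * (Real.exp (2 * κ * (s - a)) / (2 * κ))) hξa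
    (by simpa using hξ)
    (fun t ht v => by simpa using (nonneg_iff.1 (S.nonneg_N t (hsub ht))).2 v)
    (fun t _ => (hasDerivAt_exp_primitive hκ _ a t).hasDerivWithinAt) fun t ht => by
      have hξK := (le_smul_one_iff.1 (hK t (hsub ht))).2 (ξ t)
      rw [Pi.zero_apply, add_zero]
      exact (hξK.trans (mul_le_mul_of_nonneg_left (hnorm t ht) hc)).trans_eq (by ring)
  have hterminal : 2 * ⟪lam T, ξ T⟫_ℝ - ⟪x T, lam T⟫_ℝ ≤
      c * (Real.exp (2 * κ * (T - a)) * ‖x a‖ ^ 2) := by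
    rw [h.right]
    exact (two_mul_inner_sub_inner_le S.nonneg_P (x T) (ξ T)).trans
      (((le_smul_one_iff.1 hP).2 _).trans
        (mul_le_mul_of_nonneg_left (hnorm T ⟨ha.2, le_rfl⟩) hc))
  have hβa : 0 ≤ c * ‖x a‖ ^ 2 * (Real.exp (2 * κ * (a - a)) / (2 * κ)) := by positivity
  calc ⟪x a, lam a⟫_ℝ ≤ c * (Real.exp (2 * κ * (T - a)) * ‖x a‖ ^ 2) +
        c * ‖x a‖ ^ 2 * (Real.exp (2 * κ * (T - a)) / (2 * κ)) := by linarith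
    _ = c * (1 + 1 / (2 * κ)) * Real.exp (2 * κ * (T - a)) * ‖x a‖ ^ 2 := by ring
    _ ≤ c * (1 + 1 / (2 * κ)) * Real.exp (2 * κ * σ) * ‖x a‖ ^ 2 := by gcongr

variable {ν : ℝ}

theorem le_inner_tail [FiniteDimensional ℝ V] (h : S.IsSolution x lam) (hκ : 0 < κ)
    (hF : ∀ t ∈ Icc 0 T, ‖S.F t‖ ≤ κ) (hν : 0 ≤ ν) (hN : ∀ t ∈ Icc 0 T, S.N t ≤ ν • 1)
    (hc : 0 ≤ c) (hcσ : c * (Real.exp (2 * κ * σ) * (ν / (2 * κ) + 1 / γ)) ≤ 1)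
    (ha : a ∈ Icc 0 T) (haσ : T - a ≤ σ) :
    c * ‖x a‖ ^ 2 ≤ ⟪x a, lam a⟫_ℝ := by
  have hγ := S.gam_pos
  have hsub : Icc a T ⊆ Icc 0 T := Icc_subset_Icc_left ha.1
  obtain ⟨y, hya, hy, hnorm⟩ := exists_solution_norm_sq_le (M := fun t => -((S.F t)†)) S.T_pos
    (continuousOn_adjoint S.contF).neg
    (fun t ht => by simpa using hF t ht) ha (c • x a)
  have hnorm_smul : ‖c • x a‖ ^ 2 = c ^ 2 * ‖x a‖ ^ 2 := by
    rw [norm_smul, mul_pow, Real.norm_eq_abs, sq_abs]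
  have hvalue := h.le_inner_of_dual ha.2 hsub (w := 0)
    (β := fun s => ν * (c ^ 2 * ‖x a‖ ^ 2) * (Real.exp (2 * κ * (s - a)) / (2 * κ)))
    (by simpa using hy) (fun t _ => (hasDerivAt_exp_primitive hκ _ a t).hasDerivWithinAt)
    fun t ht => by
      have hyN := (le_smul_one_iff.1 (hN t (hsub ht))).2 (y t)
      rw [Pi.zero_apply, norm_zero, zero_pow two_ne_zero, zero_div, add_zero]
      refine (hyN.trans (mul_le_mul_of_nonneg_left (hnorm t ht) hν)).trans_eq ?_
      rw [hnorm_smul]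
      ring
  have hterminal : 2 * ⟪x T, y T⟫_ℝ - ⟪x T, lam T⟫_ℝ ≤
      Real.exp (2 * κ * (T - a)) * (c ^ 2 * ‖x a‖ ^ 2) / γ := by
    have hP := (smul_one_le_iff.1 S.coercive_P).2 (x T)
    have hyT := div_le_div_of_nonneg_right (hnorm T ⟨ha.2, le_rfl⟩) hγ.le
    rw [hnorm_smul] at hyT
    have hsq := completed_square_nonneg hγ (x T) (-y T)
    rw [inner_neg_right, norm_neg] at hsq
    rw [h.right]
    linarith
  have hcost : Real.exp (2 * κ * (T - a)) * (c ^ 2 * ‖x a‖ ^ 2) / γ +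
      ν * (c ^ 2 * ‖x a‖ ^ 2) * (Real.exp (2 * κ * (T - a)) / (2 * κ)) ≤ c * ‖x a‖ ^ 2 := by
    calc _ = c * ‖x a‖ ^ 2 * (c * (Real.exp (2 * κ * (T - a)) * (ν / (2 * κ) + 1 / γ))) := by ring
      _ ≤ c * ‖x a‖ ^ 2 * (c * (Real.exp (2 * κ * σ) * (ν / (2 * κ) + 1 / γ))) := by gcongr
      _ ≤ c * ‖x a‖ ^ 2 := mul_le_of_le_one_right (by positivity) hcσ
  have hβa : 0 ≤ ν * (c ^ 2 * ‖x a‖ ^ 2) * (Real.exp (2 * κ * (a - a)) / (2 * κ)) := by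
    positivity
  rw [hya, real_inner_smul_right, real_inner_self_eq_norm_sq] at hvalue
  linarith

theorem le_inner_window (h : S.IsSolution x lam) (hσ : 0 < σ)
    (hF : ∀ t ∈ Icc 0 T, ‖S.F t‖ ≤ κ) (hν : 0 ≤ ν) (hN : ∀ t ∈ Icc 0 T, S.N t ≤ ν • 1)
    (hc : 0 ≤ c) (hcσ : c * (ν * σ + (1 + κ * σ) ^ 2 / (σ * γ)) ≤ 1)
    (ha : 0 ≤ a) (haσ : a + σ ≤ T) :
    c * ‖x a‖ ^ 2 ≤ ⟪x a, lam a⟫_ℝ := by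
  have hγ := S.gam_pos
  have hsub : Icc a (a + σ) ⊆ Icc 0 T := Icc_subset_Icc ha haσ
  -- The dual is tested with the adjoint that decreases linearly from `c x(a)` to zero.
  set θ : ℝ → ℝ := fun t => 1 - (t - a) / σ with hθ
  have hθ_deriv : ∀ t, HasDerivAt θ (-σ⁻¹) t := fun t => by
    simpa using (((hasDerivAt_id t).sub_const a).div_const σ).const_sub 1
  set v := c • x a with hv
  have hvalue := h.le_inner_of_dual (by linarith) hsub (y := fun t => θ t • v)
    (w := fun t => (-σ⁻¹) • v + ((S.F t)†) (θ t • v))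
    (β := fun t => (ν + (σ⁻¹ + κ) ^ 2 / γ) * ‖v‖ ^ 2 * t)
    (fun t _ => ((hθ_deriv t).hasDerivWithinAt.smul_const v).congr_deriv (by abel))
    (fun t _ => ((hasDerivAt_id t).const_mul _).hasDerivWithinAt) fun t ht =>
      (dual_window_cost_le hσ hγ.le (hF t (hsub ht)) hν (hN t (hsub ht))
        (sub_nonneg.2 ((div_le_one hσ).2 (sub_le_iff_le_add'.2 ht.2)))
        (sub_le_self _ (div_nonneg (sub_nonneg.2 ht.1) hσ.le))).trans_eq (mul_one _).symm
  have hvalue_right : 0 ≤ ⟪x (a + σ), lam (a + σ)⟫_ℝ :=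
    le_trans (by positivity) (h.gam_mul_norm_sq_le_inner (hsub ⟨by linarith, le_rfl⟩))
  have hcost : (ν + (σ⁻¹ + κ) ^ 2 / γ) * ‖v‖ ^ 2 * σ ≤ c * ‖x a‖ ^ 2 := by
    calc _ = c * ‖x a‖ ^ 2 * (c * (ν * σ + (1 + κ * σ) ^ 2 / (σ * γ))) := by
          rw [hv, norm_smul, Real.norm_of_nonneg hc]
          field_simp
      _ ≤ c * ‖x a‖ ^ 2 := mul_le_of_le_one_right (by positivity) hcσ
  simp only [hθ, sub_self, zero_div, sub_zero, one_smul, add_sub_cancel_left, div_self hσ.ne',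
    zero_smul, inner_zero_right, mul_zero, hv, inner_smul_right,
    real_inner_self_eq_norm_sq] at hvalue
  linarith

end HamiltonianSystem.IsSolution

/-! ### The boundary value problem -/

section OperatorApply

variable {V : Type*} [NormedAddCommGroup V] [InnerProductSpace ℝ V] [CompleteSpace V]
  {a b c : ℝ} {M M' : ℝ → V →L[ℝ] V} {z k : ℝ → V} {z₀ q : V}

theorem HasJumpPrimitive.apply (hz : HasJumpPrimitive a b c z z₀ k q) (hab : a ≤ b)
    (hc : c ∈ Icc a b) (hM : ∀ t ∈ Icc a b, HasDerivWithinAt M (M' t) (Icc a b) t)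
    (hM' : ContinuousOn M' (Icc a b)) :
    HasJumpPrimitive a b c (fun t => M t (z t)) (M a z₀) (fun t => M' t (z t) + M t (k t))
      (M c q) :=
  .bilin (ContinuousLinearMap.id ℝ (V →L[ℝ] V)) hab hc (.of_hasDerivWithinAt hab hM hM') hz

theorem HasJumpPrimitive.adjoint_apply (hz : HasJumpPrimitive a b c z z₀ k q) (hab : a ≤ b)
    (hc : c ∈ Icc a b) (hM : ∀ t ∈ Icc a b, HasDerivWithinAt M (M' t) (Icc a b) t)
    (hM' : ContinuousOn M' (Icc a b)) :
    HasJumpPrimitive a b c (fun t => ((M t)†) (z t)) (((M a)†) z₀)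
      (fun t => ((M' t)†) (z t) + ((M t)†) (k t)) (((M c)†) q) :=
  hz.apply hab hc (fun t ht => (hM t ht).star) (continuousOn_adjoint hM')

end OperatorApply

/-- The inhomogeneous terms of the boundary value problem `x' = F x - N λ + f`,
`λ' = -Fᵀ λ - K x - g`, `x(0) = x₀`, `λ(T) = P x(T) + e` with a jump of the state by `p` and of the
adjoint by `-q`. -/
structure Forcing (V : Type*) where
  f : ℝ → V
  g : ℝ → V
  x₀ : V
  e : V
  p : V
  q : V

instance Forcing.instSub {V : Type*} [Sub V] : Sub (Forcing V) :=
  ⟨fun b b' => ⟨fun t => b.f t - b'.f t, fun t => b.g t - b'.g t, b.x₀ - b'.x₀, b.e - b'.e,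
    b.p - b'.p, b.q - b'.q⟩⟩

theorem Forcing.sub_def {V : Type*} [Sub V] (b b' : Forcing V) :
    b - b' = ⟨fun t => b.f t - b'.f t, fun t => b.g t - b'.g t, b.x₀ - b'.x₀, b.e - b'.e,
      b.p - b'.p, b.q - b'.q⟩ :=
  rfl

namespace HamiltonianSystem

section BoundaryValue

variable {V : Type*} [NormedAddCommGroup V] [InnerProductSpace ℝ V] [CompleteSpace V] {T γ : ℝ}

/-- `(x, λ)` solves the boundary value problem with inhomogeneous terms `b`, the jumps occurring
at `t'`. The jumps at `t' = 0` and `t' = T` are not seen by the boundary conditions in the sense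
of `HasJumpPrimitive`. -/
structure IsBVPSolution (S : HamiltonianSystem V T γ) (t' : ℝ) (b : Forcing V) (x lam : ℝ → V) :
    Prop where
  state : HasJumpPrimitive 0 T t' x b.x₀ (fun t => S.F t (x t) - S.N t (lam t) + b.f t) b.p
  adj : ∃ l₀, HasJumpPrimitive 0 T t' lam l₀
    (fun t => -((S.F t)†) (lam t) - S.K t (x t) - b.g t) (-b.q)
  right : lam T = S.P (x T) + b.e

theorem IsBVPSolution.sub {S : HamiltonianSystem V T γ} {t' : ℝ} {b b' : Forcing V}
    {x lam x' lam' : ℝ → V} (h : S.IsBVPSolution t' b x lam) (h' : S.IsBVPSolution t' b' x' lam') :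
    S.IsBVPSolution t' (b - b') (fun t => x t - x' t) (fun t => lam t - lam' t) := by
  have hT := S.T_pos.le
  obtain ⟨l, hl⟩ := h.adj
  obtain ⟨l', hl'⟩ := h'.adj
  refine ⟨(h.state.sub h'.state).congr hT (fun _ _ => rfl) rfl (fun t _ => ?_) rfl,
    ⟨l - l', (hl.sub hl').congr hT (fun _ _ => rfl) rfl (fun t _ => ?_) ?_⟩, ?_⟩
  · change _ - _ + (b.f t - b'.f t) = _
    simp only [map_sub]
    abel
  · change _ - _ - (b.g t - b'.g t) = _
    simp only [map_sub]
    abel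
  · change -(b.q - b'.q) = _
    abel
  · change _ = _ + (b.e - b'.e)
    rw [h.right, h'.right, map_sub]
    abel

theorem adjoint_N (S : HamiltonianSystem V T γ) {t : ℝ} (ht : t ∈ Icc 0 T) : (S.N t)† = S.N t :=
  ((ContinuousLinearMap.nonneg_iff_isPositive _).1 (S.nonneg_N t ht)).isSelfAdjoint.adjoint_eq

theorem adjoint_K (S : HamiltonianSystem V T γ) {t : ℝ} (ht : t ∈ Icc 0 T) : (S.K t)† = S.K t :=
  ((ContinuousLinearMap.nonneg_iff_isPositive _).1 (S.nonneg_K ht)).isSelfAdjoint.adjoint_eq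

theorem adjoint_P (S : HamiltonianSystem V T γ) : S.P† = S.P :=
  ((ContinuousLinearMap.nonneg_iff_isPositive _).1 S.nonneg_P).isSelfAdjoint.adjoint_eq

namespace Fundamental

variable {S : HamiltonianSystem V T γ} (Z : S.Fundamental) {t t' : ℝ} {b : Forcing V}
  {x lam : ℝ → V}

theorem continuousOn_X : ContinuousOn Z.X (Icc 0 T) :=
  fun t ht => (Z.deriv_X t ht).continuousWithinAt

theorem continuousOn_L : ContinuousOn Z.L (Icc 0 T) :=
  fun t ht => (Z.deriv_L t ht).continuousWithinAt

theorem continuousOn_Y : ContinuousOn Z.Y (Icc 0 T) :=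
  fun _ ht => (Z.deriv_Y ht).continuousWithinAt

theorem continuousOn_deriv_X :
    ContinuousOn (fun t => S.F t ∘L Z.X t - S.N t ∘L Z.L t) (Icc 0 T) :=
  (S.contF.clm_comp Z.continuousOn_X).sub (S.contN.clm_comp Z.continuousOn_L)

theorem continuousOn_deriv_L :
    ContinuousOn (fun t => -((S.F t)†) ∘L Z.L t - S.K t ∘L Z.X t) (Icc 0 T) :=
  ((continuousOn_adjoint S.contF).neg.clm_comp Z.continuousOn_L).sub
    (S.contK.clm_comp Z.continuousOn_X)

theorem continuousOn_deriv_Y :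
    ContinuousOn (fun t => -(Z.Y t ∘L (S.F t ∘L Z.X t - S.N t ∘L Z.L t) ∘L Z.Y t)) (Icc 0 T) :=
  (Z.continuousOn_Y.clm_comp (Z.continuousOn_deriv_X.clm_comp Z.continuousOn_Y)).neg

theorem Y_right : Z.Y T = 1 := by
  ext v
  simpa [Z.X_right] using Z.X_Y T ⟨S.T_pos.le, le_rfl⟩ v

theorem adjoint_Y_adjoint_X (ht : t ∈ Icc 0 T) (v : V) : ((Z.Y t)†) (((Z.X t)†) v) = v := by
  refine ext_inner_right ℝ fun w => ?_
  simp only [ContinuousLinearMap.adjoint_inner_left, Z.X_Y t ht]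

theorem adjoint_Y_adjoint_L (ht : t ∈ Icc 0 T) (v : V) :
    ((Z.Y t)†) (((Z.L t)†) v) = Z.L t (Z.Y t v) := by
  refine ext_inner_right ℝ fun w => ?_
  have hsymm := Z.inner_X_L ht (Z.Y t v) (Z.Y t w)
  rw [Z.X_Y t ht, Z.X_Y t ht] at hsymm
  simpa only [ContinuousLinearMap.adjoint_inner_left] using hsymm

/-- The adjoint of the frame `v ↦ (X v, L v)` of the solution space at time `t`, applied to
`(q, p)`. -/
noncomputable def coframe (t : ℝ) (p q : V) : V := ((Z.X t)†) q + ((Z.L t)†) p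

/-- The Wronskian `Xᵀ λ - Lᵀ x` of a solution `(x, λ)` of the boundary value problem with the
fundamental solution, see `adjoint_X_sub_adjoint_L`. It does not depend on the solution. -/
noncomputable def wronskian (t' : ℝ) (b : Forcing V) (t : ℝ) : V :=
  b.e + (∫ s in t..T, Z.coframe s (b.f s) (b.g s)) + if t < t' then Z.coframe t' b.p b.q else 0

/-- The state `Y x` of a solution of the boundary value problem relative to the frame `X`, see
`Y_eq_coordinate`. -/
noncomputable def coordinate (t' : ℝ) (b : Forcing V) (t : ℝ) : V :=
  Z.Y 0 b.x₀ + (∫ s in 0..t, Z.Y s (b.f s - S.N s (((Z.Y s)†) (Z.wronskian t' b s)))) +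
    if t' ≤ t then Z.Y t' b.p else 0

theorem adjoint_X_sub_adjoint_L (ht' : t' ∈ Icc 0 T) (h : S.IsBVPSolution t' b x lam)
    (ht : t ∈ Icc 0 T) :
    ((Z.X t)†) (lam t) - ((Z.L t)†) (x t) = Z.wronskian t' b t := by
  obtain ⟨l₀, hl⟩ := h.adj
  have hT := S.T_pos.le
  have hXlam := hl.adjoint_apply hT ht' Z.deriv_X Z.continuousOn_deriv_X
  have hLx := h.state.adjoint_apply hT ht' Z.deriv_L Z.continuousOn_deriv_L
  have hprimitive := (hXlam.sub hLx).congr hT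
    (k := fun s => -Z.coframe s (b.f s) (b.g s)) (q := -Z.coframe t' b.p b.q)
    (fun _ _ => rfl) rfl
    (fun s hs => by
      simp only [coframe, map_sub, map_neg, map_add, ContinuousLinearMap.adjoint_comp,
        S.adjoint_N hs, S.adjoint_K hs, sub_apply, neg_apply, ContinuousLinearMap.comp_apply,
        ContinuousLinearMap.adjoint_adjoint]
      abel)
    (by simp only [coframe, map_neg]; abel)
  have hone : ((1 : V →L[ℝ] V)†) = 1 := star_one _
  rw [hprimitive.eq_right ht'.2 ht]
  simp only [Z.X_right, Z.L_right, h.right, S.adjoint_P, wronskian, hone, one_apply_eq_self,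
    intervalIntegral.integral_neg, sub_neg_eq_add]
  split_ifs <;> abel

theorem lam_eq_riccati_add (ht' : t' ∈ Icc 0 T) (h : S.IsBVPSolution t' b x lam)
    (ht : t ∈ Icc 0 T) :
    lam t = Z.riccati t (x t) + ((Z.Y t)†) (Z.wronskian t' b t) := by
  rw [← Z.adjoint_X_sub_adjoint_L ht' h ht, map_sub, Z.adjoint_Y_adjoint_X ht,
    Z.adjoint_Y_adjoint_L ht, riccati, ContinuousLinearMap.comp_apply]
  abel

theorem Y_eq_coordinate (ht' : t' ∈ Icc 0 T) (h : S.IsBVPSolution t' b x lam)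
    (ht : t ∈ Icc 0 T) : Z.Y t (x t) = Z.coordinate t' b t := by
  have hT := S.T_pos.le
  refine ((h.state.apply hT ht' (fun s => Z.deriv_Y) Z.continuousOn_deriv_Y).congr hT
    (k := fun s => Z.Y s (b.f s - S.N s (((Z.Y s)†) (Z.wronskian t' b s))))
    (fun _ _ => rfl) rfl (fun s hs => ?_) rfl).eq t ht
  simp only [Z.lam_eq_riccati_add ht' h hs, riccati, map_sub, map_add, sub_apply, neg_apply,
    ContinuousLinearMap.comp_apply, Z.X_Y s hs]
  abel

theorem state_eq (ht' : t' ∈ Icc 0 T) (h : S.IsBVPSolution t' b x lam) (ht : t ∈ Icc 0 T) :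
    x t = Z.X t (Z.coordinate t' b t) := by
  rw [← Z.Y_eq_coordinate ht' h ht, Z.X_Y t ht]

theorem intervalIntegrable_coframe {f g : ℝ → V} (hf : IntervalIntegrable f volume 0 T)
    (hg : IntervalIntegrable g volume 0 T) :
    IntervalIntegrable (fun s => Z.coframe s (f s) (g s)) volume 0 T :=
  (intervalIntegrable_operator_apply S.T_pos.le (continuousOn_adjoint Z.continuousOn_X) hg).add
    (intervalIntegrable_operator_apply S.T_pos.le (continuousOn_adjoint Z.continuousOn_L) hf)

theorem hasJumpPrimitive_wronskian (hf : IntervalIntegrable b.f volume 0 T)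
    (hg : IntervalIntegrable b.g volume 0 T) :
    ∃ r₀, HasJumpPrimitive 0 T t' (Z.wronskian t' b) r₀
      (fun s => -Z.coframe s (b.f s) (b.g s)) (-Z.coframe t' b.p b.q) := by
  refine ⟨_, .of_eq_right (Z.intervalIntegrable_coframe hf hg).neg (yb := b.e)
    fun t _ => ?_⟩
  simp only [wronskian, Pi.neg_apply, intervalIntegral.integral_neg, sub_neg_eq_add]
  split_ifs <;> abel

theorem hasJumpPrimitive_coordinate (hf : IntervalIntegrable b.f volume 0 T)
    (hg : IntervalIntegrable b.g volume 0 T) :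
    HasJumpPrimitive 0 T t' (Z.coordinate t' b) (Z.Y 0 b.x₀)
      (fun s => Z.Y s (b.f s - S.N s (((Z.Y s)†) (Z.wronskian t' b s)))) (Z.Y t' b.p) := by
  have hT := S.T_pos.le
  obtain ⟨r₀, hr⟩ := Z.hasJumpPrimitive_wronskian (t' := t') hf hg
  exact ⟨intervalIntegrable_operator_apply hT Z.continuousOn_Y <|
    hf.sub <| intervalIntegrable_operator_apply hT S.contN <|
    intervalIntegrable_operator_apply hT (continuousOn_adjoint Z.continuousOn_Y) <|
    hr.intervalIntegrable hT, fun t _ => rfl⟩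

theorem isBVPSolution (ht' : t' ∈ Icc 0 T) (hf : IntervalIntegrable b.f volume 0 T)
    (hg : IntervalIntegrable b.g volume 0 T) :
    S.IsBVPSolution t' b (fun t => Z.X t (Z.coordinate t' b t))
      (fun t => Z.L t (Z.coordinate t' b t) + ((Z.Y t)†) (Z.wronskian t' b t)) := by
  have hT := S.T_pos.le
  obtain ⟨r₀, hr⟩ := Z.hasJumpPrimitive_wronskian (t' := t') hf hg
  have hw := Z.hasJumpPrimitive_coordinate (t' := t') hf hg
  refine ⟨?_, ⟨Z.L 0 (Z.Y 0 b.x₀) + ((Z.Y 0)†) r₀, ?_⟩, ?_⟩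
  · refine (hw.apply hT ht' Z.deriv_X Z.continuousOn_deriv_X).congr hT (fun _ _ => rfl)
      (Z.X_Y 0 ⟨le_rfl, hT⟩ _).symm (fun s hs => ?_) (Z.X_Y t' ht' _).symm
    simp only [map_add, map_sub, sub_apply, ContinuousLinearMap.comp_apply, Z.X_Y s hs]
    abel
  · refine ((hw.apply hT ht' Z.deriv_L Z.continuousOn_deriv_L).add
      (hr.adjoint_apply hT ht' (fun s => Z.deriv_Y) Z.continuousOn_deriv_Y)).congr hT
      (fun _ _ => rfl) rfl (fun s hs => ?_) ?_
    · simp only [coframe, map_add, map_sub, map_neg, sub_apply, neg_apply,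
        ContinuousLinearMap.comp_apply, ContinuousLinearMap.adjoint_comp, S.adjoint_N hs,
        Z.adjoint_Y_adjoint_X hs, Z.adjoint_Y_adjoint_L hs]
      abel
    · simp only [coframe, map_neg, map_add, Z.adjoint_Y_adjoint_X ht', Z.adjoint_Y_adjoint_L ht']
      abel
  · have hone : ((1 : V →L[ℝ] V)†) = 1 := star_one _
    simp [Z.L_right, Z.X_right, Z.Y_right, hone, wronskian, not_lt.2 ht'.2]

end Fundamental

variable [FiniteDimensional ℝ V] {t' : ℝ} {b : Forcing V}

theorem exists_isBVPSolution (S : HamiltonianSystem V T γ) (ht' : t' ∈ Icc 0 T)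
    (hf : IntervalIntegrable b.f volume 0 T) (hg : IntervalIntegrable b.g volume 0 T) :
    ∃ x lam, S.IsBVPSolution t' b x lam := by
  obtain ⟨Z⟩ := S.nonempty_fundamental
  exact ⟨_, _, Z.isBVPSolution ht' hf hg⟩

theorem IsBVPSolution.unique {S : HamiltonianSystem V T γ} {x lam x' lam' : ℝ → V}
    (h : S.IsBVPSolution t' b x lam) (h' : S.IsBVPSolution t' b x' lam') (ht' : t' ∈ Icc 0 T) :
    EqOn x x' (Icc 0 T) ∧ EqOn lam lam' (Icc 0 T) := by
  obtain ⟨Z⟩ := S.nonempty_fundamental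
  have hx : EqOn x x' (Icc 0 T) := fun t ht => by rw [Z.state_eq ht' h ht, Z.state_eq ht' h' ht]
  refine ⟨hx, fun t ht => ?_⟩
  rw [Z.lam_eq_riccati_add ht' h ht, Z.lam_eq_riccati_add ht' h' ht, hx ht]

end BoundaryValue

end HamiltonianSystem

/-! ### Response to a jump -/

theorem integral_exp_mul_exp_le {ρ t t' : ℝ} (hρ : 0 < ρ) :
    ∫ s in 0..min t t', Real.exp (-ρ * (t - s)) * Real.exp (-ρ * (t' - s)) ≤
      Real.exp (-ρ * |t - t'|) / (2 * ρ) := by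
  have hderiv : ∀ s ∈ uIcc 0 (min t t'), HasDerivAt
      (fun s => Real.exp (-ρ * (t + t' - 2 * s)) / (2 * ρ))
      (Real.exp (-ρ * (t - s)) * Real.exp (-ρ * (t' - s))) s := by
    intro s _
    have hexp : HasDerivAt (fun s => Real.exp (-ρ * (t + t' - 2 * s)))
        (Real.exp (-ρ * (t + t' - 2 * s)) * (-ρ * -(2 * 1))) s :=
      ((((hasDerivAt_id s).const_mul 2).const_sub (t + t')).const_mul (-ρ)).exp
    refine (hexp.div_const (2 * ρ)).congr_deriv ?_
    rw [← Real.exp_add, show -ρ * (t - s) + -ρ * (t' - s) = -ρ * (t + t' - 2 * s) by ring]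
    field_simp
  have habs : t + t' - 2 * min t t' = |t - t'| := by
    rw [← max_sub_min_eq_abs', ← min_add_max t t']
    ring
  rw [intervalIntegral.integral_eq_sub_of_hasDerivAt hderiv
    (Continuous.intervalIntegrable (by fun_prop) _ _), habs]
  exact sub_le_self _ (by positivity)

/-- The inhomogeneous terms consisting of the jumps `p` and `-q` only. -/
def Forcing.jump {V : Type*} [Zero V] (p q : V) : Forcing V where
  f _ := 0
  g _ := 0
  x₀ := 0
  e := 0
  p := p
  q := q

namespace HamiltonianSystem

namespace Fundamental

variable {V : Type*} [NormedAddCommGroup V] [InnerProductSpace ℝ V] [CompleteSpace V] {T γ : ℝ}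
  {S : HamiltonianSystem V T γ}

/-- The transition operators `X(t) X(s)⁻¹`, `s ≤ t`, decay exponentially with rate `ρ` and
constant `C`, and the solution of the Riccati equation is bounded by `c`. -/
structure HasDecay (Z : S.Fundamental) (C ρ c : ℝ) : Prop where
  rate_pos : 0 < ρ
  norm_X_comp_Y_le : ∀ s ∈ Icc 0 T, ∀ t ∈ Icc 0 T, s ≤ t →
    ‖Z.X t ∘L Z.Y s‖ ≤ C * Real.exp (-ρ * (t - s))
  norm_riccati_le : ∀ t ∈ Icc 0 T, ‖Z.riccati t‖ ≤ c

theorem hasDecay (Z : S.Fundamental) {c₀ c₁ : ℝ} (hS : S.HasValueBounds c₀ c₁) :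
    Z.HasDecay √(c₁ / c₀) (γ / (2 * c₁)) c₁ where
  rate_pos := div_pos S.gam_pos (mul_pos two_pos hS.pos₁)
  norm_X_comp_Y_le s hs t ht hst := by
    refine ContinuousLinearMap.opNorm_le_bound _ (by positivity) fun v => ?_
    have hv := (Z.isSolution (Z.Y s v)).norm_le_exp_mul hS hs ht hst
    rwa [Z.X_Y s hs] at hv
  norm_riccati_le _ ht := Z.norm_riccati_le hS ht

namespace HasDecay

variable {Z : S.Fundamental} {C ρ c t t' : ℝ} {p q : V}

theorem const_nonneg (h : Z.HasDecay C ρ c) : 0 ≤ C := by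
  have hT : T ∈ Icc 0 T := ⟨S.T_pos.le, le_rfl⟩
  simpa using (norm_nonneg _).trans (h.norm_X_comp_Y_le T hT T hT le_rfl)

theorem riccati_nonneg (h : Z.HasDecay C ρ c) : 0 ≤ c :=
  (norm_nonneg _).trans (h.norm_riccati_le T ⟨S.T_pos.le, le_rfl⟩)

theorem norm_adjoint_Y_coframe_le (h : Z.HasDecay C ρ c) (ht : t ∈ Icc 0 T) (ht' : t' ∈ Icc 0 T)
    (htt' : t ≤ t') (p q : V) :
    ‖((Z.Y t)†) (Z.coframe t' p q)‖ ≤ C * (c * ‖p‖ + ‖q‖) * Real.exp (-ρ * (t' - t)) := by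
  have hfactor : ((Z.Y t)†) (Z.coframe t' p q) =
      ((Z.X t' ∘L Z.Y t)†) (q + ((Z.riccati t')†) p) := by
    have hL : Z.L t' = Z.riccati t' ∘L Z.X t' := by
      ext v
      simp only [riccati, ContinuousLinearMap.comp_apply, Z.Y_X t' ht']
    simp only [coframe, hL, ContinuousLinearMap.adjoint_comp, ContinuousLinearMap.comp_apply,
      map_add]
  have htransition : ‖(Z.X t' ∘L Z.Y t)†‖ ≤ C * Real.exp (-ρ * (t' - t)) := by
    rw [LinearIsometryEquiv.norm_map]
    exact h.norm_X_comp_Y_le t ht t' ht' htt'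
  have hriccati : ‖((Z.riccati t')†) p‖ ≤ c * ‖p‖ :=
    ContinuousLinearMap.le_of_opNorm_le _
      ((LinearIsometryEquiv.norm_map _ _).trans_le (h.norm_riccati_le t' ht')) p
  rw [hfactor]
  calc _ ≤ C * Real.exp (-ρ * (t' - t)) * ‖q + ((Z.riccati t')†) p‖ :=
        ContinuousLinearMap.le_of_opNorm_le _ htransition _
    _ ≤ C * Real.exp (-ρ * (t' - t)) * (‖q‖ + c * ‖p‖) := by
        have := h.const_nonneg
        gcongr
        exact norm_add_le_of_le le_rfl hriccati
    _ = _ := by ring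

end HasDecay

variable (Z : S.Fundamental) {C ρ c t t' : ℝ} {p q : V}

theorem wronskian_jump (t t' : ℝ) (p q : V) :
    Z.wronskian t' (.jump p q) t = if t < t' then Z.coframe t' p q else 0 := by
  simp [wronskian, Forcing.jump, coframe]

theorem intervalIntegrable_jump_density (t' : ℝ) (p q : V) :
    IntervalIntegrable (fun s => Z.Y s (S.N s (((Z.Y s)†) (Z.wronskian t' (.jump p q) s))))
      volume 0 T := by
  have hT := S.T_pos.le
  obtain ⟨r₀, hr⟩ := Z.hasJumpPrimitive_wronskian (t' := t') (b := .jump p q)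
    intervalIntegrable_const intervalIntegrable_const
  exact intervalIntegrable_operator_apply hT Z.continuousOn_Y <|
    intervalIntegrable_operator_apply hT S.contN <|
    intervalIntegrable_operator_apply hT (continuousOn_adjoint Z.continuousOn_Y) <|
    hr.intervalIntegrable hT

theorem coordinate_jump (ht : t ∈ Icc 0 T) (ht' : t' ∈ Icc 0 T) (p q : V) :
    Z.coordinate t' (.jump p q) t =
      -(∫ s in 0..min t t', Z.Y s (S.N s (((Z.Y s)†) (Z.wronskian t' (.jump p q) s)))) +
        if t' ≤ t then Z.Y t' p else 0 := by
  have hint := Z.intervalIntegrable_jump_density t' p q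
  have hmin : ∫ s in 0..t, Z.Y s (S.N s (((Z.Y s)†) (Z.wronskian t' (.jump p q) s))) =
      ∫ s in 0..min t t', Z.Y s (S.N s (((Z.Y s)†) (Z.wronskian t' (.jump p q) s))) := by
    rcases le_total t t' with htt' | htt'
    · rw [min_eq_left htt']
    · rw [min_eq_right htt', ← intervalIntegral.integral_add_adjacent_intervals
        (intervalIntegrable_of_mem_Icc hint ⟨le_rfl, S.T_pos.le⟩ ht')
        (intervalIntegrable_of_mem_Icc hint ht' ht),
        intervalIntegral.integral_congr (a := t') (g := fun _ => 0) fun s hs => ?_]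
      · simp
      · rw [uIcc_of_le htt'] at hs
        simp only [wronskian_jump, if_neg hs.1.not_gt, map_zero]
  have hdensity (s : ℝ) : Z.Y s ((Forcing.jump p q).f s -
      S.N s (((Z.Y s)†) (Z.wronskian t' (.jump p q) s))) =
      -Z.Y s (S.N s (((Z.Y s)†) (Z.wronskian t' (.jump p q) s))) := by
    rw [Forcing.jump, zero_sub, map_neg]
  have hx₀ : Z.Y 0 (Forcing.jump p q).x₀ = 0 := map_zero _
  simp only [coordinate, hdensity, hx₀, zero_add, intervalIntegral.integral_neg, hmin]
  rfl

variable {Z}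

theorem HasDecay.norm_X_integral_le (h : Z.HasDecay C ρ c) {ν : ℝ}
    (hν : ∀ t ∈ Icc 0 T, ‖S.N t‖ ≤ ν) (ht : t ∈ Icc 0 T) (ht' : t' ∈ Icc 0 T) (p q : V) :
    ‖Z.X t (∫ s in 0..min t t', Z.Y s (S.N s (((Z.Y s)†) (Z.wronskian t' (.jump p q) s))))‖ ≤
      C * ν * (C * (c * ‖p‖ + ‖q‖)) * (Real.exp (-ρ * |t - t'|) / (2 * ρ)) := by
  have hC := h.const_nonneg
  have hν0 : 0 ≤ ν := (norm_nonneg _).trans (hν t ht)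
  have hc := h.riccati_nonneg
  have hmin : min t t' ∈ Icc 0 T := ⟨le_min ht.1 ht'.1, (min_le_left _ _).trans ht.2⟩
  have hbound : ∀ s ∈ Ioc 0 (min t t'),
      ‖Z.X t (Z.Y s (S.N s (((Z.Y s)†) (Z.wronskian t' (.jump p q) s))))‖ ≤
        C * ν * (C * (c * ‖p‖ + ‖q‖)) *
          (Real.exp (-ρ * (t - s)) * Real.exp (-ρ * (t' - s))) := by
    intro s hs
    have hst : s ≤ t := hs.2.trans (min_le_left _ _)
    have hst' : s ≤ t' := hs.2.trans (min_le_right _ _)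
    have hs' : s ∈ Icc 0 T := ⟨hs.1.le, hst.trans ht.2⟩
    have hwronskian : ‖((Z.Y s)†) (Z.wronskian t' (.jump p q) s)‖ ≤
        C * (c * ‖p‖ + ‖q‖) * Real.exp (-ρ * (t' - s)) := by
      rw [wronskian_jump]
      split_ifs
      · exact h.norm_adjoint_Y_coframe_le hs' ht' hst' p q
      · simpa using by positivity
    calc _ ≤ C * Real.exp (-ρ * (t - s)) * ‖S.N s (((Z.Y s)†) (Z.wronskian t' (.jump p q) s))‖ :=
          ContinuousLinearMap.le_of_opNorm_le _ (h.norm_X_comp_Y_le s hs' t ht hst) _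
      _ ≤ C * Real.exp (-ρ * (t - s)) *
          (ν * (C * (c * ‖p‖ + ‖q‖) * Real.exp (-ρ * (t' - s)))) := by
          gcongr
          exact ContinuousLinearMap.le_of_opNorm_le_of_le _ (hν s hs') hwronskian
      _ = _ := by ring
  rw [← (Z.X t).intervalIntegral_comp_comm (intervalIntegrable_of_mem_Icc
    (Z.intervalIntegrable_jump_density t' p q) ⟨le_rfl, S.T_pos.le⟩ hmin)]
  refine (intervalIntegral.norm_integral_le_of_norm_le hmin.1 (.of_forall hbound)
    (Continuous.intervalIntegrable (by fun_prop) _ _)).trans ?_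
  rw [intervalIntegral.integral_const_mul]
  exact mul_le_mul_of_nonneg_left (integral_exp_mul_exp_le h.rate_pos) (by positivity)

theorem HasDecay.norm_state_le (h : Z.HasDecay C ρ c) {ν : ℝ} (hν : ∀ t ∈ Icc 0 T, ‖S.N t‖ ≤ ν)
    (ht' : t' ∈ Icc 0 T) {x lam : ℝ → V} (hx : S.IsBVPSolution t' (.jump p q) x lam)
    (ht : t ∈ Icc 0 T) :
    ‖x t‖ ≤ C * (C * (c * ‖p‖ + ‖q‖) * ν / (2 * ρ) + ‖p‖) * Real.exp (-ρ * |t - t'|) := by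
  have hC := h.const_nonneg
  have hjump : ‖Z.X t (if t' ≤ t then Z.Y t' p else 0)‖ ≤
      C * Real.exp (-ρ * |t - t'|) * ‖p‖ := by
    split_ifs with htt'
    · rw [abs_of_nonneg (sub_nonneg.2 htt')]
      exact ContinuousLinearMap.le_of_opNorm_le _ (h.norm_X_comp_Y_le t' ht' t ht htt') p
    · simpa using by positivity
  rw [Z.state_eq ht' hx ht, Z.coordinate_jump ht ht', map_add, map_neg]
  refine (norm_add_le _ _).trans ?_
  rw [norm_neg]
  refine (add_le_add (h.norm_X_integral_le hν ht ht' p q) hjump).trans_eq ?_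
  ring

theorem HasDecay.norm_adjoint_le (h : Z.HasDecay C ρ c) (ht' : t' ∈ Icc 0 T) {x lam : ℝ → V}
    (hx : S.IsBVPSolution t' (.jump p q) x lam) (ht : t ∈ Icc 0 T) :
    ‖lam t‖ ≤ c * ‖x t‖ + C * (c * ‖p‖ + ‖q‖) * Real.exp (-ρ * |t - t'|) := by
  have hC := h.const_nonneg
  have hc := h.riccati_nonneg
  rw [Z.lam_eq_riccati_add ht' hx ht]
  refine norm_add_le_of_le (ContinuousLinearMap.le_of_opNorm_le _ (h.norm_riccati_le t ht) _) ?_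
  rw [wronskian_jump]
  split_ifs with htt'
  · rw [abs_sub_comm, abs_of_pos (sub_pos.2 htt')]
    exact h.norm_adjoint_Y_coframe_le ht ht' htt'.le p q
  · simpa using by positivity

end Fundamental

end HamiltonianSystem

/-! ### Approximate point masses -/

namespace ApproximatesDirac

variable {V : Type*} [NormedAddCommGroup V] [NormedSpace ℝ V] {T t t' : ℝ} {φ : ℕ → ℝ → ℝ}
  {k : ℝ → V} {n : ℕ}

theorem intervalIntegrable (hφ : ApproximatesDirac T t' φ) (hT : 0 ≤ T) (n : ℕ) :
    IntervalIntegrable (φ n) volume 0 T := by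
  rw [intervalIntegrable_iff_integrableOn_Icc_of_le hT]
  exact (hφ.1 n).integrable one_le_two

theorem intervalIntegrable_smul (hφ : ApproximatesDirac T t' φ) (hT : 0 ≤ T)
    (hk : ContinuousOn k (Icc 0 T)) (n : ℕ) :
    IntervalIntegrable (fun s => φ n s • k s) volume 0 T :=
  (hφ.intervalIntegrable hT n).smul_continuousOn (by rwa [uIcc_of_le hT])

theorem norm_integral_smul_le (hφ : ApproximatesDirac T t' φ) {C : ℝ} (hC : 0 ≤ C)
    (hk : ∀ s ∈ Icc 0 T, φ n s ≠ 0 → ‖k s‖ ≤ C) (ht : t ∈ Icc 0 T) :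
    ‖∫ s in t..T, φ n s • k s‖ ≤ C := by
  have hT : 0 ≤ T := ht.1.trans ht.2
  obtain ⟨-, hnonneg, hint, -⟩ := id hφ
  have hφi := hφ.intervalIntegrable hT n
  have hleft := intervalIntegrable_of_mem_Icc hφi ⟨le_rfl, hT⟩ ht
  have hright := intervalIntegrable_of_mem_Icc hφi ht ⟨hT, le_rfl⟩
  have hbound : ∀ s ∈ Ioc t T, ‖φ n s • k s‖ ≤ φ n s * C := by
    intro s hs
    have hs' : s ∈ Icc 0 T := ⟨ht.1.trans hs.1.le, hs.2⟩
    rw [norm_smul, Real.norm_of_nonneg (hnonneg n s hs')]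
    rcases eq_or_ne (φ n s) 0 with hzero | hne
    · simp [hzero]
    · exact mul_le_mul_of_nonneg_left (hk s hs' hne) (hnonneg n s hs')
  have hmass : ∫ s in t..T, φ n s ≤ 1 := by
    rw [← hint n, ← intervalIntegral.integral_add_adjacent_intervals hleft hright]
    exact le_add_of_nonneg_left (intervalIntegral.integral_nonneg ht.1
      fun s hs => hnonneg n s ⟨hs.1, hs.2.trans ht.2⟩)
  calc ‖∫ s in t..T, φ n s • k s‖ ≤ ∫ s in t..T, φ n s * C :=
        intervalIntegral.norm_integral_le_of_norm_le ht.2 (.of_forall hbound)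
          (hright.mul_const C)
    _ = (∫ s in t..T, φ n s) * C := intervalIntegral.integral_mul_const C _
    _ ≤ C := mul_le_of_le_one_left hC hmass

theorem tendsto_integral_smul [CompleteSpace V] (hφ : ApproximatesDirac T t' φ)
    (ht' : t' ∈ Icc 0 T) (hk : ContinuousOn k (Icc 0 T)) :
    Tendsto (fun n => ∫ s in 0..T, φ n s • k s) atTop (𝓝 (k t')) := by
  have hT : 0 ≤ T := ht'.1.trans ht'.2
  obtain ⟨-, -, hint, hvanish⟩ := id hφ
  refine Metric.tendsto_atTop'.2 fun ε hε => ?_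
  obtain ⟨δ, hδ, hclose⟩ := Metric.continuousWithinAt_iff.1 (hk t' ht') (ε / 2) (half_pos hε)
  obtain ⟨n₀, hn₀⟩ := eventually_atTop.1 (hvanish δ hδ)
  refine ⟨n₀, fun n hn => ?_⟩
  have hsub : (∫ s in 0..T, φ n s • k s) - k t' = ∫ s in 0..T, φ n s • (k s - k t') := by
    simp only [smul_sub]
    rw [intervalIntegral.integral_sub (hφ.intervalIntegrable_smul hT hk n)
      (hφ.intervalIntegrable_smul hT continuousOn_const n), intervalIntegral.integral_smul_const,
      hint n, one_smul]
  rw [dist_eq_norm, hsub]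
  refine (hφ.norm_integral_smul_le (half_pos hε).le (fun s hs hne => ?_)
    ⟨le_rfl, hT⟩).trans_lt (half_lt_self hε)
  rw [← dist_eq_norm]
  exact (hclose hs (not_le.1 fun hfar => hne (hn₀ n hn.le s hs hfar))).le

theorem eventually_integral_smul_eq_zero (hφ : ApproximatesDirac T t' φ) {a b : ℝ} (ha : 0 ≤ a)
    (hab : a ≤ b) (hb : b ≤ T) (ht' : t' ∉ Icc a b) (k : ℝ → V) :
    ∀ᶠ n in atTop, ∫ s in a..b, φ n s • k s = 0 := by
  have hdist : ∃ ε > 0, ∀ s ∈ Icc a b, ε ≤ |s - t'| := by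
    rcases lt_or_ge t' a with hlt | hge
    · exact ⟨a - t', sub_pos.2 hlt, fun s hs =>
        (sub_le_sub_right hs.1 t').trans (le_abs_self _)⟩
    · have hlt : b < t' := not_le.1 fun hle => ht' ⟨hge, hle⟩
      exact ⟨t' - b, sub_pos.2 hlt, fun s hs =>
        (sub_le_sub_left hs.2 t').trans ((le_abs_self _).trans_eq (abs_sub_comm _ _))⟩
  obtain ⟨ε, hε, hfar⟩ := hdist
  filter_upwards [hφ.2.2.2 ε hε] with n hn
  refine (intervalIntegral.integral_congr (g := fun _ => 0) fun s hs => ?_).trans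
    intervalIntegral.integral_zero
  rw [uIcc_of_le hab] at hs
  simp [hn s ⟨ha.trans hs.1, hs.2.trans hb⟩ (hfar s hs)]

variable [CompleteSpace V]

theorem tendsto_integral_smul_right (hφ : ApproximatesDirac T t' φ) (ht' : t' ∈ Icc 0 T)
    (hk : ContinuousOn k (Icc 0 T)) (ht : t ∈ Icc 0 T) (htt' : t ≠ t') :
    Tendsto (fun n => ∫ s in t..T, φ n s • k s) atTop (𝓝 (if t < t' then k t' else 0)) := by
  have hT : 0 ≤ T := ht.1.trans ht.2
  split_ifs with hlt
  · refine (hφ.tendsto_integral_smul ht' hk).congr' ?_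
    filter_upwards [hφ.eventually_integral_smul_eq_zero le_rfl ht.1 ht.2
      (fun hmem => hlt.not_ge hmem.2) k] with n hn
    have hi := hφ.intervalIntegrable_smul hT hk n
    rw [← intervalIntegral.integral_add_adjacent_intervals
      (intervalIntegrable_of_mem_Icc hi ⟨le_rfl, hT⟩ ht)
      (intervalIntegrable_of_mem_Icc hi ht ⟨hT, le_rfl⟩), hn, zero_add]
  · refine tendsto_const_nhds.congr' ?_
    filter_upwards [hφ.eventually_integral_smul_eq_zero ht.1 ht.2 le_rfl
      (fun hmem => hlt (hmem.1.lt_of_ne htt')) k] with n hn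
    exact hn.symm

theorem tendsto_integral_smul_left (hφ : ApproximatesDirac T t' φ) (ht' : t' ∈ Icc 0 T)
    (hk : ContinuousOn k (Icc 0 T)) (ht : t ∈ Icc 0 T) (htt' : t ≠ t') :
    Tendsto (fun n => ∫ s in 0..t, φ n s • k s) atTop (𝓝 (if t' ≤ t then k t' else 0)) := by
  have hT : 0 ≤ T := ht.1.trans ht.2
  have hlim : k t' - (if t < t' then k t' else 0) = if t' ≤ t then k t' else 0 := by
    rcases lt_or_ge t t' with hlt | hge
    · simp [hlt, hlt.not_ge]
    · simp [hge, hge.not_gt]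
  rw [← hlim]
  refine ((hφ.tendsto_integral_smul ht' hk).sub
    (hφ.tendsto_integral_smul_right ht' hk ht htt')).congr fun n => ?_
  have hi := hφ.intervalIntegrable_smul hT hk n
  rw [sub_eq_iff_eq_add, intervalIntegral.integral_add_adjacent_intervals
    (intervalIntegrable_of_mem_Icc hi ⟨le_rfl, hT⟩ ht)
    (intervalIntegrable_of_mem_Icc hi ht ⟨hT, le_rfl⟩)]

end ApproximatesDirac

theorem tendsto_integral_operator_apply_zero {V : Type*} [NormedAddCommGroup V]
    [NormedSpace ℝ V] {T t t' C : ℝ} {M : ℝ → V →L[ℝ] V} {r : ℕ → ℝ → V}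
    (hM : ContinuousOn M (Icc 0 T)) (hr : ∀ n, IntervalIntegrable (r n) volume 0 T)
    (hC : ∀ n, ∀ s ∈ Icc 0 T, ‖r n s‖ ≤ C)
    (hlim : ∀ s ∈ Icc 0 T, s ≠ t' → Tendsto (fun n => r n s) atTop (𝓝 0)) (ht : t ∈ Icc 0 T) :
    Tendsto (fun n => ∫ s in 0..t, M s (r n s)) atTop (𝓝 0) := by
  have hT : 0 ≤ T := ht.1.trans ht.2
  obtain ⟨B, hB⟩ := isCompact_Icc.exists_bound_of_continuousOn hM
  have hsub : ∀ s ∈ uIoc 0 t, s ∈ Icc 0 T := fun s hs => by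
    rw [uIoc_of_le ht.1] at hs
    exact ⟨hs.1.le, hs.2.trans ht.2⟩
  have hdominated := intervalIntegral.tendsto_integral_filter_of_dominated_convergence
    (μ := volume) (a := 0) (b := t) (l := atTop) (F := fun n s => M s (r n s))
    (f := fun _ => 0) (fun _ => B * C)
    (.of_forall fun n => (intervalIntegrable_iff.1 (intervalIntegrable_of_mem_Icc
      (intervalIntegrable_operator_apply hT hM (hr n)) ⟨le_rfl, hT⟩ ht)).aestronglyMeasurable)
    (.of_forall fun n => .of_forall fun s hs =>
      (M s).le_of_opNorm_le_of_le (hB s (hsub s hs)) (hC n s (hsub s hs)))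
    intervalIntegrable_const
    (by
      filter_upwards [compl_mem_ae_iff.2 (measure_singleton t')] with s hst' hs
      simpa [Function.comp_def] using
        ((M s).continuous.tendsto 0).comp (hlim s (hsub s hs) hst'))
  simpa using hdominated

/-- The density `φ` times the forcing `(k₁, k₂)` minus the same forcing concentrated at `t'`. -/
def Forcing.densitySubJump {V : Type*} [AddGroup V] [SMul ℝ V] (φ : ℝ → ℝ) (k₁ k₂ : ℝ → V)
    (t' : ℝ) : Forcing V where
  f t := φ t • k₁ t
  g t := φ t • k₂ t
  x₀ := 0
  e := 0
  p := -k₁ t'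
  q := -k₂ t'

namespace HamiltonianSystem

namespace Fundamental

variable {V : Type*} [NormedAddCommGroup V] [InnerProductSpace ℝ V] [CompleteSpace V]
  {T γ t t' : ℝ} {S : HamiltonianSystem V T γ} (Z : S.Fundamental) {φ : ℕ → ℝ → ℝ} {k₁ k₂ : ℝ → V}

theorem continuousOn_coframe (hk₁ : ContinuousOn k₁ (Icc 0 T)) (hk₂ : ContinuousOn k₂ (Icc 0 T)) :
    ContinuousOn (fun s => Z.coframe s (k₁ s) (k₂ s)) (Icc 0 T) :=
  ((continuousOn_adjoint Z.continuousOn_X).clm_apply hk₂).add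
    ((continuousOn_adjoint Z.continuousOn_L).clm_apply hk₁)

theorem wronskian_densitySubJump (φ : ℝ → ℝ) (k₁ k₂ : ℝ → V) (t' t : ℝ) :
    Z.wronskian t' (.densitySubJump φ k₁ k₂ t') t =
      (∫ s in t..T, φ s • Z.coframe s (k₁ s) (k₂ s)) -
        if t < t' then Z.coframe t' (k₁ t') (k₂ t') else 0 := by
  simp only [wronskian, Forcing.densitySubJump, coframe, zero_add, map_neg, map_smul, smul_add]
  split_ifs <;> abel

theorem tendsto_wronskian_densitySubJump (hφ : ApproximatesDirac T t' φ) (ht' : t' ∈ Icc 0 T)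
    (hk₁ : ContinuousOn k₁ (Icc 0 T)) (hk₂ : ContinuousOn k₂ (Icc 0 T)) (ht : t ∈ Icc 0 T)
    (htt' : t ≠ t') :
    Tendsto (fun n => Z.wronskian t' (.densitySubJump (φ n) k₁ k₂ t') t) atTop (𝓝 0) := by
  simp only [wronskian_densitySubJump]
  have hlim := hφ.tendsto_integral_smul_right ht' (Z.continuousOn_coframe hk₁ hk₂) ht htt'
  simpa only [sub_self] using
    hlim.sub_const (if t < t' then Z.coframe t' (k₁ t') (k₂ t') else 0)

theorem exists_norm_wronskian_densitySubJump_le (hφ : ApproximatesDirac T t' φ)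
    (ht' : t' ∈ Icc 0 T) (hk₁ : ContinuousOn k₁ (Icc 0 T)) (hk₂ : ContinuousOn k₂ (Icc 0 T)) :
    ∃ C, ∀ n, ∀ t ∈ Icc 0 T, ‖Z.wronskian t' (.densitySubJump (φ n) k₁ k₂ t') t‖ ≤ C := by
  obtain ⟨C, hC⟩ := isCompact_Icc.exists_bound_of_continuousOn (Z.continuousOn_coframe hk₁ hk₂)
  have hC0 : 0 ≤ C := (norm_nonneg _).trans (hC t' ht')
  refine ⟨C + C, fun n t ht => ?_⟩
  rw [wronskian_densitySubJump]
  refine norm_sub_le_of_le (hφ.norm_integral_smul_le hC0 (fun s hs _ => hC s hs) ht) ?_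
  split_ifs
  · exact hC t' ht'
  · simpa using hC0

theorem intervalIntegrable_wronskian_densitySubJump (hφ : ApproximatesDirac T t' φ)
    (hk₁ : ContinuousOn k₁ (Icc 0 T)) (hk₂ : ContinuousOn k₂ (Icc 0 T)) (n : ℕ) :
    IntervalIntegrable (Z.wronskian t' (.densitySubJump (φ n) k₁ k₂ t')) volume 0 T := by
  have hT := S.T_pos.le
  obtain ⟨r₀, hr⟩ := Z.hasJumpPrimitive_wronskian (t' := t')
    (b := .densitySubJump (φ n) k₁ k₂ t') (hφ.intervalIntegrable_smul hT hk₁ n)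
    (hφ.intervalIntegrable_smul hT hk₂ n)
  exact hr.intervalIntegrable hT

theorem tendsto_coordinate_densitySubJump (hφ : ApproximatesDirac T t' φ) (ht' : t' ∈ Icc 0 T)
    (hk₁ : ContinuousOn k₁ (Icc 0 T)) (hk₂ : ContinuousOn k₂ (Icc 0 T)) (ht : t ∈ Icc 0 T)
    (htt' : t ≠ t') :
    Tendsto (fun n => Z.coordinate t' (.densitySubJump (φ n) k₁ k₂ t') t) atTop (𝓝 0) := by
  have hT := S.T_pos.le
  set r := fun n => Z.wronskian t' (.densitySubJump (φ n) k₁ k₂ t')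
  set M := fun s => Z.Y s ∘L S.N s ∘L ((Z.Y s)†)
  have hr := Z.intervalIntegrable_wronskian_densitySubJump hφ hk₁ hk₂
  have hM : ContinuousOn M (Icc 0 T) := Z.continuousOn_Y.clm_comp
    (S.contN.clm_comp (continuousOn_adjoint Z.continuousOn_Y))
  have hYk : ContinuousOn (fun s => Z.Y s (k₁ s)) (Icc 0 T) := Z.continuousOn_Y.clm_apply hk₁
  have hformula (n : ℕ) : Z.coordinate t' (.densitySubJump (φ n) k₁ k₂ t') t =
      (∫ s in 0..t, φ n s • Z.Y s (k₁ s)) - (∫ s in 0..t, M s (r n s)) -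
        if t' ≤ t then Z.Y t' (k₁ t') else 0 := by
    rw [← intervalIntegral.integral_sub
      (intervalIntegrable_of_mem_Icc (hφ.intervalIntegrable_smul hT hYk n) ⟨le_rfl, hT⟩ ht)
      (intervalIntegrable_of_mem_Icc (intervalIntegrable_operator_apply hT hM (hr n))
        ⟨le_rfl, hT⟩ ht)]
    have hx₀ : Z.Y 0 (Forcing.densitySubJump (φ n) k₁ k₂ t').x₀ = 0 := map_zero _
    have hp : Z.Y t' (Forcing.densitySubJump (φ n) k₁ k₂ t').p = -Z.Y t' (k₁ t') := map_neg _ _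
    have hf (s : ℝ) : Z.Y s ((Forcing.densitySubJump (φ n) k₁ k₂ t').f s) = φ n s • Z.Y s (k₁ s) :=
      map_smul _ _ _
    simp only [coordinate, hx₀, hp, map_sub, hf, zero_add]
    split_ifs <;> simp [M, sub_eq_add_neg]
  obtain ⟨C, hC⟩ := Z.exists_norm_wronskian_densitySubJump_le hφ ht' hk₁ hk₂
  have hlim := ((hφ.tendsto_integral_smul_left ht' hYk ht htt').sub
    (tendsto_integral_operator_apply_zero hM hr hC (fun s hs hst' =>
      Z.tendsto_wronskian_densitySubJump hφ ht' hk₁ hk₂ hs hst') ht)).sub_const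
    (if t' ≤ t then Z.Y t' (k₁ t') else 0)
  simpa only [hformula, sub_zero, sub_self] using hlim

end Fundamental

theorem IsBVPSolution.tendsto_zero {V : Type*} [NormedAddCommGroup V] [InnerProductSpace ℝ V]
    [FiniteDimensional ℝ V] {T γ t t' : ℝ} {S : HamiltonianSystem V T γ} {φ : ℕ → ℝ → ℝ}
    {k₁ k₂ : ℝ → V} {x lam : ℕ → ℝ → V}
    (h : ∀ n, S.IsBVPSolution t' (.densitySubJump (φ n) k₁ k₂ t') (x n) (lam n))
    (hφ : ApproximatesDirac T t' φ) (ht' : t' ∈ Icc 0 T) (hk₁ : ContinuousOn k₁ (Icc 0 T))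
    (hk₂ : ContinuousOn k₂ (Icc 0 T)) (ht : t ∈ Icc 0 T) (htt' : t ≠ t') :
    Tendsto (fun n => x n t) atTop (𝓝 0) ∧ Tendsto (fun n => lam n t) atTop (𝓝 0) := by
  obtain ⟨Z⟩ := S.nonempty_fundamental
  have hx : Tendsto (fun n => x n t) atTop (𝓝 0) := by
    simp only [fun n => Z.state_eq ht' (h n) ht]
    simpa [Function.comp_def] using ((Z.X t).continuous.tendsto 0).comp
      (Z.tendsto_coordinate_densitySubJump hφ ht' hk₁ hk₂ ht htt')
  refine ⟨hx, ?_⟩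
  simp only [fun n => Z.lam_eq_riccati_add ht' (h n) ht]
  simpa [Function.comp_def] using (((Z.riccati t).continuous.tendsto 0).comp hx).add
    ((((Z.Y t)†).continuous.tendsto 0).comp
      (Z.tendsto_wronskian_densitySubJump hφ ht' hk₁ hk₂ ht htt'))

end HamiltonianSystem

/-! ### Constants of the estimate -/

namespace Constants

variable (k : Constants)

theorem kappa_pos : 0 < k.kappa := by
  have := k.lamA_pos; have := k.lamB_pos; have := k.lamH_pos; have := k.gamR_pos
  unfold kappa; positivity

theorem lamA_le_kappa : k.lamA ≤ k.kappa := by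
  have := k.lamB_pos; have := k.lamH_pos; have := k.gamR_pos
  exact le_add_of_nonneg_right (by positivity)

theorem one_lt_exp : 1 < Real.exp (2 * k.kappa * k.sigma) := by
  have := k.kappa_pos; have := k.sigma_pos
  exact Real.one_lt_exp_iff.2 (by positivity)

theorem two_div_alpha0_le_inv_alpha0' : 2 / k.alpha0 ≤ k.alpha0'⁻¹ := by
  have := k.lamA_pos; have := k.sigma_pos
  have hexp : 0 ≤ Real.exp (2 * k.lamA * k.sigma) - 1 :=
    sub_nonneg.2 (Real.one_le_exp (by positivity))
  rw [alpha0', inv_inv]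
  exact le_add_of_nonneg_right (by positivity)

theorem alpha0'_pos : 0 < k.alpha0' :=
  inv_pos.1 ((div_pos two_pos k.alpha0_pos).trans_le k.two_div_alpha0_le_inv_alpha0')

theorem alpha0'_le_alpha0 : k.alpha0' ≤ k.alpha0 := by
  have := k.alpha0_pos
  refine (inv_le_inv₀ k.alpha0_pos k.alpha0'_pos).1
    (le_trans ?_ k.two_div_alpha0_le_inv_alpha0')
  rw [inv_eq_one_div]
  gcongr
  norm_num

theorem alpha1'_eq :
    k.alpha1' = k.lamB ^ 2 * ((Real.exp (2 * k.kappa * k.sigma) - 1) / (2 * k.kappa)) := by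
  rw [alpha1', mul_right_comm, mul_div_assoc]

theorem alpha1'_pos : 0 < k.alpha1' := by
  have := k.kappa_pos; have := k.lamB_pos; have := sub_pos.2 k.one_lt_exp
  rw [alpha1'_eq]; positivity

theorem alpha1'_le :
    k.alpha1' ≤ k.lamB ^ 2 * (Real.exp (2 * k.kappa * k.sigma) / (2 * k.kappa)) := by
  have := k.kappa_pos
  rw [alpha1'_eq]
  gcongr
  exact sub_le_self _ zero_le_one

theorem exp_neg_eq : Real.exp (-2 * k.kappa * k.sigma) =
    (Real.exp (2 * k.kappa * k.sigma))⁻¹ := by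
  rw [← Real.exp_neg]; ring_nf

theorem alphaDual0_pos : 0 < k.alphaDual0 := by
  have := k.kappa_pos
  rw [alphaDual0, exp_neg_eq]
  exact mul_pos (by positivity) (sub_pos.2 (inv_lt_one_of_one_lt₀ k.one_lt_exp))

theorem alphaDual0_le_sigma : k.alphaDual0 ≤ k.sigma := by
  have := k.kappa_pos
  rw [alphaDual0, one_div_mul_eq_div, div_le_iff₀ (by positivity)]
  linarith [Real.add_one_le_exp (-2 * k.kappa * k.sigma)]

theorem alphaDual0_le_inv : k.alphaDual0 ≤ 1 / (2 * k.kappa) := by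
  have := k.kappa_pos
  exact mul_le_of_le_one_right (by positivity) (sub_le_self _ (Real.exp_pos _).le)

theorem alphaDual1_pos : 0 < k.alphaDual1 := by
  have := k.kappa_pos
  exact mul_pos (by positivity) (sub_pos.2 k.one_lt_exp)

theorem sigma_le_exp_div : k.sigma ≤ Real.exp (2 * k.kappa * k.sigma) / (2 * k.kappa) := by
  have := k.kappa_pos
  rw [le_div_iff₀ (by positivity)]
  linarith [Real.add_one_le_exp (2 * k.kappa * k.sigma)]

theorem one_add_mul_sq_le_exp :
    (1 + k.kappa * k.sigma) ^ 2 ≤ Real.exp (2 * k.kappa * k.sigma) := by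
  have := k.kappa_pos; have := k.sigma_pos
  rw [mul_assoc, two_mul, Real.exp_add, ← sq]
  gcongr
  linarith [Real.add_one_le_exp (k.kappa * k.sigma)]

theorem inv_sigma_le : 1 / k.sigma ≤ 1 / (2 * k.kappa) * (1 / k.alphaDual0 ^ 2) := by
  have hκ := k.kappa_pos; have hα := k.alphaDual0_pos
  rw [one_div_mul_one_div]
  refine one_div_le_one_div_of_le (by positivity) ?_
  calc 2 * k.kappa * k.alphaDual0 ^ 2 = k.alphaDual0 * (k.alphaDual0 * (2 * k.kappa)) := by ring
    _ ≤ k.alphaDual0 * 1 := by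
        gcongr
        exact (le_div_iff₀ (by positivity)).1 k.alphaDual0_le_inv
    _ ≤ k.sigma := by rw [mul_one]; exact k.alphaDual0_le_sigma

theorem c0_pos : 0 < k.c0 := by
  have := k.kappa_pos; have := k.lamB_pos; have := k.gamR_pos; have := k.gamQ_pos
  have := k.alphaDual0_pos; have := k.alphaDual1_pos
  exact mul_pos (lt_min (by positivity) (by positivity)) (Real.exp_pos _)

theorem c0_mul_tail_le : k.c0 * (Real.exp (2 * k.kappa * k.sigma) *
    (k.lamB ^ 2 / k.gamR / (2 * k.kappa) + 1 / k.gamQ)) ≤ 1 := by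
  have := k.kappa_pos; have := k.gamR_pos; have := k.gamQ_pos
  have := Real.exp_pos (2 * k.kappa * k.sigma)
  set S := k.lamB ^ 2 / k.gamR / (2 * k.kappa) + 1 / k.gamQ with hS
  have hS_pos : 0 < S := by positivity
  have hc0 : k.c0 ≤ S⁻¹ * (Real.exp (2 * k.kappa * k.sigma))⁻¹ := by
    rw [c0, exp_neg_eq, hS, div_div, mul_left_comm k.gamR, ← mul_assoc 2]
    exact mul_le_mul_of_nonneg_right (min_le_right _ _) (by positivity)
  calc _ ≤ S⁻¹ * (Real.exp (2 * k.kappa * k.sigma))⁻¹ *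
        (Real.exp (2 * k.kappa * k.sigma) * S) := by gcongr
    _ = 1 := by field_simp

theorem window_cost_le : k.lamB ^ 2 / k.gamR * k.sigma +
      (1 + k.kappa * k.sigma) ^ 2 / (k.sigma * k.gamQ) ≤
    Real.exp (2 * k.kappa * k.sigma) / (2 * k.kappa) *
      (k.lamB ^ 2 / k.gamR * (1 + k.alphaDual1 / k.alphaDual0) ^ 2 +
        1 / (k.gamQ * k.alphaDual0 ^ 2)) := by
  have hκ := k.kappa_pos; have hR := k.gamR_pos; have hQ := k.gamQ_pos; have hσ := k.sigma_pos
  have hα₀ := k.alphaDual0_pos; have hα₁ := k.alphaDual1_pos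
  rw [mul_add]
  refine add_le_add ?_ ?_
  · have hone : (1 : ℝ) ≤ (1 + k.alphaDual1 / k.alphaDual0) ^ 2 :=
      one_le_pow₀ (le_add_of_nonneg_right (by positivity))
    calc _ ≤ k.lamB ^ 2 / k.gamR * (Real.exp (2 * k.kappa * k.sigma) / (2 * k.kappa)) *
          (1 + k.alphaDual1 / k.alphaDual0) ^ 2 :=
          (mul_le_mul_of_nonneg_left k.sigma_le_exp_div (by positivity)).trans
            (le_mul_of_one_le_right (by positivity) hone)
      _ = _ := by ring
  · calc _ = (1 + k.kappa * k.sigma) ^ 2 * (1 / k.sigma) * (1 / k.gamQ) := by field_simp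
      _ ≤ Real.exp (2 * k.kappa * k.sigma) * (1 / (2 * k.kappa) * (1 / k.alphaDual0 ^ 2)) *
          (1 / k.gamQ) := by
          gcongr
          exacts [k.one_add_mul_sq_le_exp, k.inv_sigma_le]
      _ = _ := by field_simp

theorem c0_mul_window_le : k.c0 * (k.lamB ^ 2 / k.gamR * k.sigma +
    (1 + k.kappa * k.sigma) ^ 2 / (k.sigma * k.gamQ)) ≤ 1 := by
  have hκ := k.kappa_pos; have := k.gamR_pos; have := k.gamQ_pos; have := k.c0_pos
  have := k.alphaDual0_pos; have := k.alphaDual1_pos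
  have := Real.exp_pos (2 * k.kappa * k.sigma)
  set S := k.lamB ^ 2 / k.gamR * (1 + k.alphaDual1 / k.alphaDual0) ^ 2 +
      1 / (k.gamQ * k.alphaDual0 ^ 2) with hS
  have hS_pos : 0 < S := by positivity
  have hc0 : k.c0 ≤ 2 * k.kappa * S⁻¹ * (Real.exp (2 * k.kappa * k.sigma))⁻¹ := by
    rw [c0, exp_neg_eq, ← hS]
    exact mul_le_mul_of_nonneg_right (min_le_left _ _) (by positivity)
  calc _ ≤ k.c0 * (Real.exp (2 * k.kappa * k.sigma) / (2 * k.kappa) * S) := by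
        gcongr; exact k.window_cost_le
    _ ≤ 2 * k.kappa * S⁻¹ * (Real.exp (2 * k.kappa * k.sigma))⁻¹ *
        (Real.exp (2 * k.kappa * k.sigma) / (2 * k.kappa) * S) := by gcongr
    _ = 1 := by field_simp

theorem c1_pos : 0 < k.c1 := by
  have := k.kappa_pos; have := k.lamQ_pos; have := k.gamR_pos
  exact mul_pos (lt_max_of_lt_right (by positivity)) (Real.exp_pos _)

theorem lamQ_le_add : k.lamQ ≤ k.lamQ + k.lamH ^ 2 / k.gamR := by
  have := k.gamR_pos
  exact le_add_of_nonneg_right (by positivity)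

theorem tail_le_c1 :
    k.lamQ * (1 + 1 / (2 * k.kappa)) * Real.exp (2 * k.kappa * k.sigma) ≤ k.c1 := by
  have := k.kappa_pos
  refine mul_le_mul_of_nonneg_right (le_trans ?_ (le_max_right _ _)) (Real.exp_pos _).le
  exact mul_le_mul_of_nonneg_right k.lamQ_le_add (by positivity)

theorem window_le_c1 : (k.lamQ * (1 + k.alpha1' / k.alpha0') ^ 2 +
      k.lamR * k.lamB ^ 2 / k.alpha0' ^ 2) *
      (Real.exp (2 * k.kappa * k.sigma) / (2 * k.kappa)) ≤ k.c1 := by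
  have := k.kappa_pos
  rw [div_eq_mul_one_div (Real.exp _), mul_comm (Real.exp _), ← mul_assoc]
  refine mul_le_mul_of_nonneg_right (le_trans ?_ (le_max_left _ _)) (Real.exp_pos _).le
  gcongr
  exact k.lamQ_le_add

theorem rhoZ_pos : 0 < k.rhoZ := div_pos k.gamQ_pos (mul_pos two_pos k.c1_pos)

theorem cZ_pos : 0 < k.cZ := Real.sqrt_pos.2 (div_pos k.c1_pos k.c0_pos)

theorem cv_pos : 0 < k.cv := by
  have := k.c1_pos; have := k.cZ_pos; have := k.lamW_pos; have := k.lamB_pos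
  have := k.gamR_pos; have := k.lamC_pos; have := k.lamH_pos; have := k.lamG_pos
  unfold cv; positivity

theorem LambdaX_pos : 0 < k.LambdaX := by
  have := k.cv_pos; have := k.cZ_pos; have := k.lamW_pos; have := k.lamB_pos
  have := k.gamR_pos; have := k.lamC_pos; have := k.rhoZ_pos
  unfold LambdaX; positivity

theorem Lambda_pos : 0 < k.Lambda := by
  have := k.cv_pos; have := k.LambdaX_pos; have := k.c1_pos; have := k.lamB_pos
  have := k.gamR_pos; have := k.lamH_pos
  unfold Lambda; positivity

end Constants

/-! ### Elimination of the control -/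

section Coercive

variable {V : Type*} [NormedAddCommGroup V] [InnerProductSpace ℝ V]
  {γ : ℝ} {M : V →L[ℝ] V}

theorem le_smul_one_of_norm_le {c : ℝ} (hsymm : (M : V →ₗ[ℝ] V).IsSymmetric) (hc : ‖M‖ ≤ c) :
    M ≤ c • 1 := by
  refine le_smul_one_iff.2 ⟨hsymm, fun x => (real_inner_le_norm _ _).trans ?_⟩
  rw [sq, mul_left_comm]
  exact mul_le_mul_of_nonneg_left (M.le_of_opNorm_le hc x) (norm_nonneg x)

variable [CompleteSpace V]

theorem isUnit_of_smul_one_le (hγ : 0 < γ) (hM : γ • 1 ≤ M) : IsUnit M := by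
  refine ContinuousLinearMap.isUnit_of_forall_le_norm_inner_map M (c := ⟨γ, hγ.le⟩) hγ fun x => ?_
  rw [real_inner_comm, mul_comm]
  exact ((smul_one_le_iff.1 hM).2 x).trans (Real.le_norm_self _)

theorem inverse_apply_apply (hγ : 0 < γ) (hM : γ • 1 ≤ M) (x : V) : M.inverse (M x) = x := by
  rw [← ContinuousLinearMap.ringInverse_eq_inverse]
  exact DFunLike.congr_fun (Ring.inverse_mul_cancel _ (isUnit_of_smul_one_le hγ hM)) x

theorem apply_inverse_apply (hγ : 0 < γ) (hM : γ • 1 ≤ M) (x : V) : M (M.inverse x) = x := by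
  rw [← ContinuousLinearMap.ringInverse_eq_inverse]
  exact DFunLike.congr_fun (Ring.mul_inverse_cancel _ (isUnit_of_smul_one_le hγ hM)) x

theorem inverse_nonneg (hγ : 0 < γ) (hM : γ • 1 ≤ M) : 0 ≤ M.inverse := by
  obtain ⟨hsymm, hle⟩ := smul_one_le_iff.1 hM
  refine nonneg_iff.2 ⟨fun x y => ?_, fun x => ?_⟩
  · have := hsymm (M.inverse x) (M.inverse y)
    simpa only [ContinuousLinearMap.coe_coe, apply_inverse_apply hγ hM] using this.symm
  · have := hle (M.inverse x)
    rw [apply_inverse_apply hγ hM, real_inner_comm] at this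
    exact le_trans (by positivity) this

theorem adjoint_inverse (hγ : 0 < γ) (hM : γ • 1 ≤ M) : (M.inverse)† = M.inverse :=
  ((ContinuousLinearMap.eq_adjoint_iff _ _).2 (nonneg_iff.1 (inverse_nonneg hγ hM)).1).symm

theorem norm_inverse_le (hγ : 0 < γ) (hM : γ • 1 ≤ M) : ‖M.inverse‖ ≤ 1 / γ := by
  refine ContinuousLinearMap.opNorm_le_bound _ (by positivity) fun x => ?_
  have hle := ((smul_one_le_iff.1 hM).2 (M.inverse x)).trans (real_inner_le_norm _ _)
  rw [apply_inverse_apply hγ hM] at hle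
  rw [one_div_mul_eq_div, le_div_iff₀ hγ]
  rcases (norm_nonneg (M.inverse x)).eq_or_lt with h0 | h0
  · rw [← h0, zero_mul]
    exact norm_nonneg x
  · exact le_of_mul_le_mul_left (by linarith) h0

theorem continuousOn_inverse {M : ℝ → V →L[ℝ] V} {s : Set ℝ} (hγ : 0 < γ)
    (hM : ∀ t ∈ s, γ • 1 ≤ M t) (hc : ContinuousOn M s) :
    ContinuousOn (fun t => (M t).inverse) s := by
  intro t ht
  obtain ⟨u, hu⟩ := isUnit_of_smul_one_le hγ (hM t ht)
  have hinv := NormedRing.inverse_continuousAt u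
  rw [hu] at hinv
  simp only [← ContinuousLinearMap.ringInverse_eq_inverse]
  exact hinv.comp_continuousWithinAt (hc t ht)

end Coercive

namespace Data

variable {nx nu nd : ℕ} (D : Data nx nu nd)

/-- The state matrix `A - B R⁻¹ H` of the optimality system after elimination of the control. -/
noncomputable def F (t : ℝ) : Mat nx nx := D.A t - D.B t ∘L (D.R t).inverse ∘L D.H t

/-- The weight `B R⁻¹ Bᵀ` of the adjoint in the reduced state equation. -/
noncomputable def N (t : ℝ) : Mat nx nx := D.B t ∘L (D.R t).inverse ∘L (D.B t)†

/-- The reduced state cost `Q - Hᵀ R⁻¹ H`. -/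
noncomputable def K (t : ℝ) : Mat nx nx := D.Q t - (D.H t)† ∘L (D.R t).inverse ∘L D.H t

end Data

namespace Assumptions

variable {nx nu nd : ℕ} {k : Constants} {T : ℝ} {D : Data nx nu nd}

theorem T_pos (h : Assumptions k T D) : 0 < T := k.sigma_pos.trans h.sigma_lt

variable {t : ℝ}

theorem inverse_R_nonneg (h : Assumptions k T D) (ht : t ∈ Icc 0 T) : 0 ≤ (D.R t).inverse :=
  inverse_nonneg k.gamR_pos (h.coerciveR t ht)

theorem norm_inverse_R_le (h : Assumptions k T D) (ht : t ∈ Icc 0 T) :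
    ‖(D.R t).inverse‖ ≤ 1 / k.gamR :=
  norm_inverse_le k.gamR_pos (h.coerciveR t ht)

theorem norm_comp_inverse_comp_le (h : Assumptions k T D) (ht : t ∈ Icc 0 T) {m n : ℕ} {a b : ℝ}
    {L : Mat m nu} {L' : Mat nu n} (hL : ‖L‖ ≤ a) (hL' : ‖L'‖ ≤ b) :
    ‖L ∘L (D.R t).inverse ∘L L'‖ ≤ a * b / k.gamR := by
  have ha := (norm_nonneg _).trans hL
  calc _ ≤ ‖L‖ * (‖(D.R t).inverse‖ * ‖L'‖) := (ContinuousLinearMap.opNorm_comp_le _ _).trans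
        (mul_le_mul_of_nonneg_left (ContinuousLinearMap.opNorm_comp_le _ _) (norm_nonneg _))
    _ ≤ a * (1 / k.gamR * b) := by
        have := k.gamR_pos
        gcongr
        exact h.norm_inverse_R_le ht
    _ = _ := by ring

theorem norm_F_le (h : Assumptions k T D) (ht : t ∈ Icc 0 T) : ‖D.F t‖ ≤ k.kappa :=
  (norm_sub_le _ _).trans (add_le_add (h.boundA t ht)
    (h.norm_comp_inverse_comp_le ht (h.boundB t ht) (h.boundH t ht)))

theorem N_nonneg (h : Assumptions k T D) (ht : t ∈ Icc 0 T) : 0 ≤ D.N t :=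
  (ContinuousLinearMap.nonneg_iff_isPositive _).2
    (((ContinuousLinearMap.nonneg_iff_isPositive _).1 (h.inverse_R_nonneg ht)).conj_adjoint (D.B t))

theorem norm_N_le (h : Assumptions k T D) (ht : t ∈ Icc 0 T) :
    ‖D.N t‖ ≤ k.lamB ^ 2 / k.gamR := by
  rw [sq]
  refine h.norm_comp_inverse_comp_le ht (h.boundB t ht) ?_
  rw [LinearIsometryEquiv.norm_map]
  exact h.boundB t ht

theorem N_le (h : Assumptions k T D) (ht : t ∈ Icc 0 T) : D.N t ≤ (k.lamB ^ 2 / k.gamR) • 1 :=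
  le_smul_one_of_norm_le (nonneg_iff.1 (h.N_nonneg ht)).1 (h.norm_N_le ht)

theorem K_le (h : Assumptions k T D) (ht : t ∈ Icc 0 T) : D.K t ≤ k.lamQ • 1 := by
  refine le_smul_one_iff.2 ⟨(smul_one_le_iff.1 (h.coerciveQ t ht)).1, fun x => ?_⟩
  have hinv := (nonneg_iff.1 (h.inverse_R_nonneg ht)).2 (D.H t x)
  have hQ : ⟪x, D.Q t x⟫_ℝ ≤ k.lamQ * ‖x‖ ^ 2 := by
    rw [sq, mul_left_comm]
    exact (real_inner_le_norm _ _).trans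
      (mul_le_mul_of_nonneg_left ((D.Q t).le_of_opNorm_le (h.boundQ t ht) x) (norm_nonneg x))
  simp only [Data.K, sub_apply, ContinuousLinearMap.comp_apply, inner_sub_right,
    ContinuousLinearMap.adjoint_inner_right]
  linarith

theorem isSymmetric_Q (h : Assumptions k T D) (ht : t ∈ Icc 0 T) :
    (D.Q t : Vec nx →ₗ[ℝ] Vec nx).IsSymmetric := fun x y => by
  have hinv := (nonneg_iff.1 (h.inverse_R_nonneg ht)).1 (D.H t x) (D.H t y)
  have hK := (smul_one_le_iff.1 (h.coerciveQ t ht)).1 x y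
  simp only [ContinuousLinearMap.coe_coe, sub_apply, ContinuousLinearMap.comp_apply,
    inner_sub_left, inner_sub_right, ContinuousLinearMap.adjoint_inner_right,
    ContinuousLinearMap.adjoint_inner_left] at hinv hK ⊢
  linarith

theorem continuousOn_inverse_R (h : Assumptions k T D) :
    ContinuousOn (fun t => (D.R t).inverse) (Icc 0 T) :=
  continuousOn_inverse k.gamR_pos h.coerciveR h.contR

theorem continuousOn_F (h : Assumptions k T D) : ContinuousOn D.F (Icc 0 T) := by
  have := h.contA; have := h.contB; have := h.contH; have := h.continuousOn_inverse_R
  unfold Data.F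
  fun_prop

theorem continuousOn_N (h : Assumptions k T D) : ContinuousOn D.N (Icc 0 T) := by
  have := h.contB; have := continuousOn_adjoint h.contB; have := h.continuousOn_inverse_R
  unfold Data.N
  fun_prop

theorem continuousOn_K (h : Assumptions k T D) : ContinuousOn D.K (Icc 0 T) := by
  have := h.contQ; have := h.contH; have := continuousOn_adjoint h.contH
  have := h.continuousOn_inverse_R
  unfold Data.K
  fun_prop

/-- The Hamiltonian system obtained from the optimality system by eliminating the control. -/
noncomputable def system (h : Assumptions k T D) : HamiltonianSystem (Vec nx) T k.gamQ where
  F := D.F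
  N := D.N
  K := D.K
  P := D.QT
  T_pos := h.T_pos
  gam_pos := k.gamQ_pos
  contF := h.continuousOn_F
  contN := h.continuousOn_N
  contK := h.continuousOn_K
  nonneg_N _ ht := h.N_nonneg ht
  coercive_K := h.coerciveQ
  coercive_P := h.coerciveQT

end Assumptions

/-! ### Controllability windows -/

section Evolution

variable {n : ℕ} {T κ a s : ℝ} {A Z : ℝ → Mat n n} {Φ : ℝ → ℝ → Mat n n}

theorem exists_dual_fundamental (hT : 0 < T) (hA : ContinuousOn A (Icc 0 T))
    (ha : a ∈ Icc 0 T) : ∃ Z : ℝ → Mat n n, Z a = 1 ∧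
      ∀ s ∈ Icc 0 T, HasDerivWithinAt Z (-(Z s ∘L A s)) (Icc 0 T) s := by
  obtain ⟨Y, hYa, hY⟩ := exists_fundamental hT (continuousOn_adjoint hA).neg ha
  refine ⟨fun s => (Y s)†, ?_, fun s hs => (hY s hs).star.congr_deriv ?_⟩
  · change (Y a)† = 1
    rw [hYa, ← ContinuousLinearMap.star_eq_adjoint, star_one]
  · ext v
    simp [ContinuousLinearMap.star_eq_adjoint, ContinuousLinearMap.adjoint_comp]

theorem IsEvolution.dual_comp (hΦ : IsEvolution T A Φ)
    (hZ : ∀ s ∈ Icc 0 T, HasDerivWithinAt Z (-(Z s ∘L A s)) (Icc 0 T) s) {r : ℝ}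
    (hr : r ∈ Icc 0 T) (hs : s ∈ Icc 0 T) : Z r ∘L Φ r s = Z s := by
  have hconst := eq_of_hasDerivWithinAt_zero (f := fun r => Z r ∘L Φ r s) (fun q hq =>
    ((hZ q hq).clm_comp ((hΦ s hs).2 q hq)).congr_deriv (by ext v; simp)) hr hs
  rw [hconst, (hΦ s hs).1]
  rfl

theorem IsEvolution.hasDerivWithinAt_snd (hΦ : IsEvolution T A Φ) (hT : 0 < T)
    (hA : ContinuousOn A (Icc 0 T)) (ha : a ∈ Icc 0 T) (hs : s ∈ Icc 0 T) :
    HasDerivWithinAt (Φ a) (-(Φ a s ∘L A s)) (Icc 0 T) s := by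
  obtain ⟨Z, hZa, hZ⟩ := exists_dual_fundamental hT hA ha
  have hΦZ : ∀ r ∈ Icc 0 T, Φ a r = Z r := fun r hr => by
    rw [← hΦ.dual_comp hZ ha hr, hZa]
    rfl
  rw [hΦZ s hs]
  exact (hZ s hs).congr hΦZ (hΦZ s hs)

theorem IsEvolution.comp_swap (hΦ : IsEvolution T A Φ) (hT : 0 < T)
    (hA : ContinuousOn A (Icc 0 T)) (ha : a ∈ Icc 0 T) (hs : s ∈ Icc 0 T) :
    Φ a s ∘L Φ s a = 1 := by
  rw [hΦ.dual_comp (fun r hr => hΦ.hasDerivWithinAt_snd hT hA ha hr) hs ha, (hΦ a ha).1]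

theorem IsEvolution.norm_apply_le (hΦ : IsEvolution T A Φ) (hκ : ∀ t ∈ Icc 0 T, ‖A t‖ ≤ κ)
    (ha : a ∈ Icc 0 T) (hs : s ∈ Icc a T) (v : Vec n) :
    ‖Φ s a v‖ ≤ Real.exp (κ * (s - a)) * ‖v‖ := by
  have hsub : Icc a T ⊆ Icc 0 T := Icc_subset_Icc_left ha.1
  have hnorm := norm_le_exp_mul_of_norm_deriv_le (y := fun r => Φ r a v)
    (fun r hr => (hasDerivWithinAt_apply ((hΦ a ha).2 r (hsub hr)) v).mono hsub)
    (fun r hr => (A r).le_of_opNorm_le (hκ r (hsub hr)) _) hs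
  simpa [(hΦ a ha).1] using hnorm

theorem IsEvolution.norm_adjoint_apply_le (hΦ : IsEvolution T A Φ) (hT : 0 < T)
    (hA : ContinuousOn A (Icc 0 T)) (hκ : ∀ t ∈ Icc 0 T, ‖A t‖ ≤ κ)
    (ha : a ∈ Icc 0 T) (hs : s ∈ Icc a T) (v : Vec n) :
    ‖((Φ a s)†) v‖ ≤ Real.exp (κ * (s - a)) * ‖v‖ := by
  have hsub : Icc a T ⊆ Icc 0 T := Icc_subset_Icc_left ha.1
  have hnorm := norm_le_exp_mul_of_norm_deriv_le (y := fun r => ((Φ a r)†) v)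
    (y' := fun r => -((A r)†) (((Φ a r)†) v)) (κ := κ)
    (fun r hr => by
      refine (hasDerivWithinAt_apply
        (hΦ.hasDerivWithinAt_snd hT hA ha (hsub hr)).star v).mono hsub |>.congr_deriv ?_
      simp [ContinuousLinearMap.star_eq_adjoint, ContinuousLinearMap.adjoint_comp])
    (fun r hr => by
      rw [norm_neg]
      refine ((A r)†).le_of_opNorm_le ?_ _
      rw [LinearIsometryEquiv.norm_map]
      exact hκ r (hsub hr)) hs
  rwa [(hΦ a ha).1, ← ContinuousLinearMap.star_eq_adjoint (1 : Mat n n), star_one] at hnorm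

end Evolution

section Gramian

variable {n m : ℕ} {T a b s : ℝ} {A : ℝ → Mat n n} {B : ℝ → Mat n m}

/-- The control `s ↦ B(s)ᵀ Φ_A(a,s)ᵀ v`: its energy is the quadratic form of the Gramian at `v`,
and its negative steers the state from `W_{A,B}(a,b) v` at time `a` to the origin at time `b`. -/
noncomputable def gramianControl (T : ℝ) (A : ℝ → Mat n n) (B : ℝ → Mat n m) (a : ℝ) (v : Vec n)
    (s : ℝ) : Vec m :=
  ((B s)†) (((evolution T A a s)†) v)

theorem gramian_self : gramian T A B a a = 0 := intervalIntegral.integral_same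

theorem hasDerivWithinAt_gramian (hT : 0 < T) (hA : ContinuousOn A (Icc 0 T))
    (hB : ContinuousOn B (Icc 0 T)) (ha : a ∈ Icc 0 T) (hs : s ∈ Icc 0 T) :
    HasDerivWithinAt (gramian T A B a)
      (evolution T A a s ∘L B s ∘L (B s)† ∘L (evolution T A a s)†) (Icc 0 T) s := by
  have hΦ : ContinuousOn (evolution T A a) (Icc 0 T) := fun s hs =>
    ((evolution_spec hT hA).hasDerivWithinAt_snd hT hA ha hs).continuousWithinAt
  have hΦ' := continuousOn_adjoint hΦ
  have hB' := continuousOn_adjoint hB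
  have hg : ContinuousOn
      (fun s => evolution T A a s ∘L B s ∘L (B s)† ∘L (evolution T A a s)†) (Icc 0 T) := by
    fun_prop
  have : Fact (s ∈ Icc 0 T) := ⟨hs⟩
  exact intervalIntegral.integral_hasDerivWithinAt_right
    ((hg.mono (uIcc_subset_Icc ha hs)).intervalIntegrable)
    (hg.stronglyMeasurableAtFilter_nhdsWithin measurableSet_Icc s) (hg s hs)

theorem hasDerivWithinAt_inner_gramian (hT : 0 < T) (hA : ContinuousOn A (Icc 0 T))
    (hB : ContinuousOn B (Icc 0 T)) (ha : a ∈ Icc 0 T) (hs : s ∈ Icc 0 T) (v : Vec n) :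
    HasDerivWithinAt (fun s => ⟪v, gramian T A B a s v⟫_ℝ) (‖gramianControl T A B a v s‖ ^ 2)
      (Icc 0 T) s := by
  refine ((hasDerivWithinAt_const s (Icc 0 T) v).inner ℝ
    (hasDerivWithinAt_apply (hasDerivWithinAt_gramian hT hA hB ha hs) v)).congr_deriv ?_
  rw [inner_zero_left, add_zero, ← real_inner_self_eq_norm_sq]
  simp only [gramianControl, ContinuousLinearMap.comp_apply,
    ContinuousLinearMap.adjoint_inner_left]

theorem adjoint_gramian (hT : 0 < T) (hA : ContinuousOn A (Icc 0 T))
    (hB : ContinuousOn B (Icc 0 T)) (ha : a ∈ Icc 0 T) (hs : s ∈ Icc 0 T) :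
    (gramian T A B a s)† = gramian T A B a s := by
  have hconst := eq_of_hasDerivWithinAt_zero (fun r hr => by
    have hd := hasDerivWithinAt_gramian hT hA hB ha hr
    refine (hd.star.sub hd).congr_deriv ?_
    simp only [ContinuousLinearMap.star_eq_adjoint, ContinuousLinearMap.adjoint_comp,
      ContinuousLinearMap.adjoint_adjoint, ContinuousLinearMap.comp_assoc, sub_self]) hs ha
  simpa [gramian_self, sub_eq_zero, ContinuousLinearMap.star_eq_adjoint] using hconst

theorem gramian_le_gramian (hT : 0 < T) (hA : ContinuousOn A (Icc 0 T))
    (hB : ContinuousOn B (Icc 0 T)) (ha : a ∈ Icc 0 T) (hs : s ∈ Icc 0 T) (hsb : s ≤ b)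
    (hb : b ≤ T) : gramian T A B a s ≤ gramian T A B a b := by
  have hsub : Icc s b ⊆ Icc 0 T := Icc_subset_Icc hs.1 hb
  have hsymm : ∀ r ∈ Icc 0 T, (gramian T A B a r : Vec n →ₗ[ℝ] Vec n).IsSymmetric := fun r hr =>
    (ContinuousLinearMap.eq_adjoint_iff _ _).1 (adjoint_gramian hT hA hB ha hr).symm
  refine (ContinuousLinearMap.le_def _ _).2 ((ContinuousLinearMap.nonneg_iff_isPositive _).1
    (nonneg_iff.2 ⟨?_, fun v => ?_⟩))
  · exact (hsymm b (hsub ⟨hsb, le_rfl⟩)).sub (hsymm s hs)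
  · rw [sub_apply, inner_sub_right]
    exact sub_nonneg.2 (le_of_hasDerivWithinAt_nonneg hsb (fun r hr =>
      (hasDerivWithinAt_inner_gramian hT hA hB ha (hsub hr) v).mono hsub) fun r _ => sq_nonneg _)

theorem gramian_nonneg (hT : 0 < T) (hA : ContinuousOn A (Icc 0 T))
    (hB : ContinuousOn B (Icc 0 T)) (ha : a ∈ Icc 0 T) (hs : s ∈ Icc a T) :
    0 ≤ gramian T A B a s :=
  gramian_self.symm.trans_le (gramian_le_gramian hT hA hB ha ha hs.1 hs.2)

variable {κ β : ℝ}

theorem norm_gramianControl_sq_le (hT : 0 < T) (hA : ContinuousOn A (Icc 0 T))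
    (hκ : ∀ t ∈ Icc 0 T, ‖A t‖ ≤ κ) (hβ : ∀ t ∈ Icc 0 T, ‖B t‖ ≤ β) (ha : a ∈ Icc 0 T)
    (hs : s ∈ Icc a T) (v : Vec n) :
    ‖gramianControl T A B a v s‖ ^ 2 ≤ β ^ 2 * ‖v‖ ^ 2 * Real.exp (2 * κ * (s - a)) := by
  have hB := hβ s ⟨ha.1.trans hs.1, hs.2⟩
  have hnorm : ‖gramianControl T A B a v s‖ ≤ β * (Real.exp (κ * (s - a)) * ‖v‖) := by
    refine (ContinuousLinearMap.le_opNorm _ _).trans ?_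
    rw [LinearIsometryEquiv.norm_map]
    exact mul_le_mul hB ((evolution_spec hT hA).norm_adjoint_apply_le hT hA hκ ha hs v)
      (norm_nonneg _) ((norm_nonneg _).trans hB)
  refine (pow_le_pow_left₀ (norm_nonneg _) hnorm 2).trans_eq ?_
  rw [mul_assoc 2, two_mul (κ * _), Real.exp_add]
  ring

theorem gramian_le_smul_one (hT : 0 < T) (hA : ContinuousOn A (Icc 0 T))
    (hB : ContinuousOn B (Icc 0 T)) (hκ_pos : 0 < κ) (hκ : ∀ t ∈ Icc 0 T, ‖A t‖ ≤ κ)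
    (hβ : ∀ t ∈ Icc 0 T, ‖B t‖ ≤ β) (ha : a ∈ Icc 0 T) (hs : s ∈ Icc a T) :
    gramian T A B a s ≤ (β ^ 2 * ((Real.exp (2 * κ * (s - a)) - 1) / (2 * κ))) • 1 := by
  have hsub : Icc a s ⊆ Icc 0 T := Icc_subset_Icc ha.1 hs.2
  refine le_smul_one_iff.2 ⟨(nonneg_iff.1 (gramian_nonneg hT hA hB ha hs)).1, fun v => ?_⟩
  have hmono := le_of_hasDerivWithinAt_nonneg hs.1 (fun r hr =>
    (hasDerivAt_exp_primitive hκ_pos (β ^ 2 * ‖v‖ ^ 2) a r).hasDerivWithinAt.sub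
      ((hasDerivWithinAt_inner_gramian hT hA hB ha (hsub hr) v).mono hsub)) fun r hr =>
    sub_nonneg.2 (norm_gramianControl_sq_le hT hA hκ hβ ha ⟨hr.1, hr.2.trans hs.2⟩ v)
  simp only [Pi.sub_apply, gramian_self, zero_apply, inner_zero_right, sub_self, mul_zero,
    Real.exp_zero, sub_zero] at hmono
  rw [sub_div]
  linarith

/-- The state which starts from `v` at time `a` under the control `-gramianControl T A B a z`. -/
noncomputable def steeredState (T : ℝ) (A : ℝ → Mat n n) (B : ℝ → Mat n m) (a : ℝ)
    (v z : Vec n) (s : ℝ) : Vec n :=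
  evolution T A s a (v - gramian T A B a s z)

variable {v z : Vec n}

theorem steeredState_left (hT : 0 < T) (hA : ContinuousOn A (Icc 0 T)) (ha : a ∈ Icc 0 T) :
    steeredState T A B a v z a = v := by
  rw [steeredState, (evolution_spec hT hA a ha).1, gramian_self]
  simp

theorem steeredState_eq_zero (hz : gramian T A B a b z = v) :
    steeredState T A B a v z b = 0 := by
  rw [steeredState, hz, sub_self, map_zero]

theorem hasDerivWithinAt_steeredState (hT : 0 < T) (hA : ContinuousOn A (Icc 0 T))
    (hB : ContinuousOn B (Icc 0 T)) (ha : a ∈ Icc 0 T) (hs : s ∈ Icc 0 T) :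
    HasDerivWithinAt (steeredState T A B a v z)
      (A s (steeredState T A B a v z s) - B s (gramianControl T A B a z s)) (Icc 0 T) s := by
  have hΦ := evolution_spec hT hA
  have hswap : ∀ w, evolution T A s a (evolution T A a s w) = w :=
    DFunLike.congr_fun (hΦ.comp_swap hT hA hs ha)
  refine (((hΦ a ha).2 s hs).clm_apply
    ((hasDerivWithinAt_apply (hasDerivWithinAt_gramian hT hA hB ha hs) z).const_sub v)).congr_deriv
      ?_
  simp only [steeredState, gramianControl, ContinuousLinearMap.comp_apply, map_neg, hswap]
  abel

theorem norm_steeredState_sq_le (hT : 0 < T) (hA : ContinuousOn A (Icc 0 T))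
    (hκ : ∀ t ∈ Icc 0 T, ‖A t‖ ≤ κ) (ha : a ∈ Icc 0 T) (hs : s ∈ Icc a T) {g α : ℝ}
    (hg : ‖gramian T A B a s‖ ≤ g) (hz : ‖z‖ ≤ ‖v‖ / α) :
    ‖steeredState T A B a v z s‖ ^ 2 ≤
      (1 + g / α) ^ 2 * ‖v‖ ^ 2 * Real.exp (2 * κ * (s - a)) := by
  have hgz : ‖gramian T A B a s z‖ ≤ g * (‖v‖ / α) :=
    ((gramian T A B a s).le_of_opNorm_le hg z).trans
      (mul_le_mul_of_nonneg_left hz ((norm_nonneg _).trans hg))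
  have hnorm : ‖steeredState T A B a v z s‖ ≤
      Real.exp (κ * (s - a)) * ((1 + g / α) * ‖v‖) := by
    refine ((evolution_spec hT hA).norm_apply_le hκ ha hs _).trans
      (mul_le_mul_of_nonneg_left ((norm_sub_le_of_le le_rfl hgz).trans_eq ?_) (Real.exp_pos _).le)
    ring
  refine (pow_le_pow_left₀ (norm_nonneg _) hnorm 2).trans_eq ?_
  rw [mul_assoc 2, two_mul (κ * _), Real.exp_add]
  ring

end Gramian

namespace Constants

variable (k : Constants)

theorem inv_alpha0'_mul_le {p : ℝ} (hp : k.alpha0 * p ≤ k.alpha1' * p) (hp₀ : 0 ≤ p) :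
    k.alpha0'⁻¹ * p ≤ k.lamB ^ 2 / k.alpha0' ^ 2 *
      (Real.exp (2 * k.kappa * k.sigma) / (2 * k.kappa)) * p := by
  have hα' := k.alpha0'_pos
  have hle : k.alpha0' * p ≤
      k.lamB ^ 2 * (Real.exp (2 * k.kappa * k.sigma) / (2 * k.kappa)) * p :=
    (mul_le_mul_of_nonneg_right k.alpha0'_le_alpha0 hp₀).trans
      (hp.trans (mul_le_mul_of_nonneg_right k.alpha1'_le hp₀))
  calc k.alpha0'⁻¹ * p = (k.alpha0'⁻¹) ^ 2 * (k.alpha0' * p) := by field_simp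
    _ ≤ (k.alpha0'⁻¹) ^ 2 *
        (k.lamB ^ 2 * (Real.exp (2 * k.kappa * k.sigma) / (2 * k.kappa)) * p) := by gcongr
    _ = _ := by rw [inv_pow]; ring

theorem steering_cost_le {p q τ : ℝ} (hp₀ : 0 ≤ p) (hp : k.alpha0 * p ≤ k.alpha1' * p)
    (hq : q ≤ p / k.alpha0) (hτ : τ ≤ k.sigma) :
    k.lamQ * ((1 + k.alpha1' / k.alpha0') ^ 2 * p) *
        ((Real.exp (2 * k.kappa * τ) - 1) / (2 * k.kappa)) +
      (k.lamR * (2 * (k.lamH / k.gamR) ^ 2) * ((1 + k.alpha1 / k.alpha0) ^ 2 * p) *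
        ((Real.exp (2 * k.lamA * τ) - 1) / (2 * k.lamA)) + k.lamR * 2 * q) ≤ k.c1 * p := by
  have hκ := k.kappa_pos; have hA := k.lamA_pos; have := k.lamQ_pos; have hR := k.lamR_pos
  have := k.alpha0_pos; have := k.alpha0'_pos
  have hstate : k.lamQ * ((1 + k.alpha1' / k.alpha0') ^ 2 * p) *
        ((Real.exp (2 * k.kappa * τ) - 1) / (2 * k.kappa)) ≤
      k.lamQ * ((1 + k.alpha1' / k.alpha0') ^ 2 * p) *
        (Real.exp (2 * k.kappa * k.sigma) / (2 * k.kappa)) := by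
    gcongr
    exact (sub_le_self _ zero_le_one).trans (Real.exp_le_exp.2 (by gcongr))
  have hcontrol : k.lamR * (2 * (k.lamH / k.gamR) ^ 2) * ((1 + k.alpha1 / k.alpha0) ^ 2 * p) *
        ((Real.exp (2 * k.lamA * τ) - 1) / (2 * k.lamA)) + k.lamR * 2 * q ≤
      k.lamR * (k.alpha0'⁻¹ * p) := by
    calc _ ≤ k.lamR * (2 * (k.lamH / k.gamR) ^ 2) * ((1 + k.alpha1 / k.alpha0) ^ 2 * p) *
          ((Real.exp (2 * k.lamA * k.sigma) - 1) / (2 * k.lamA)) +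
            k.lamR * 2 * (p / k.alpha0) := by gcongr
      _ = _ := by rw [alpha0', inv_inv]; field_simp; ring
  have hgramian := mul_le_mul_of_nonneg_left (k.inv_alpha0'_mul_le hp hp₀) hR.le
  have hwindow := mul_le_mul_of_nonneg_right k.window_le_c1 hp₀
  refine (add_le_add hstate (hcontrol.trans hgramian)).trans (le_of_eq_of_le ?_ hwindow)
  ring

end Constants

namespace Assumptions

variable {nx nu nd : ℕ} {k : Constants} {T : ℝ} {D : Data nx nu nd} {t : ℝ}

theorem inner_N_add_nonneg (h : Assumptions k T D) (ht : t ∈ Icc 0 T) (v : Vec nx) (w : Vec nu) :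
    0 ≤ ⟪v, D.N t v⟫_ℝ + 2 * ⟪v, D.B t w⟫_ℝ + ⟪w, D.R t w⟫_ℝ := by
  obtain ⟨hsymm, hcoercive⟩ := smul_one_le_iff.1 (h.coerciveR t ht)
  set y := (D.R t).inverse (((D.B t)†) v)
  have hRy : D.R t y = ((D.B t)†) v := apply_inverse_apply k.gamR_pos (h.coerciveR t ht) _
  have hyR : ⟪y, D.R t w⟫_ℝ = ⟪v, D.B t w⟫_ℝ := by
    rw [← ContinuousLinearMap.adjoint_inner_left (D.B t), ← hRy]
    exact (hsymm y w).symm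
  have hwR : ⟪w, D.R t y⟫_ℝ = ⟪v, D.B t w⟫_ℝ := by
    rw [hRy, ContinuousLinearMap.adjoint_inner_right, real_inner_comm]
  have hyy : ⟪y, D.R t y⟫_ℝ = ⟪v, D.N t v⟫_ℝ := by
    rw [hRy, ContinuousLinearMap.adjoint_inner_right, real_inner_comm]
    rfl
  have hsq := (mul_nonneg k.gamR_pos.le (sq_nonneg _)).trans (hcoercive (y + w))
  rw [map_add, inner_add_left, inner_add_right, inner_add_right, hyy, hyR, hwR] at hsq
  linarith

variable {ξ : Vec nx} {u w : Vec nu}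

theorem norm_feedback_sub_sq_le (h : Assumptions k T D) (ht : t ∈ Icc 0 T) :
    ‖(D.R t).inverse (D.H t ξ) - u‖ ^ 2 ≤
      2 * ((k.lamH / k.gamR) ^ 2 * ‖ξ‖ ^ 2) + 2 * ‖u‖ ^ 2 := by
  have hfeedback : ‖(D.R t).inverse (D.H t ξ)‖ ≤ k.lamH / k.gamR * ‖ξ‖ := by
    refine ((D.R t).inverse.le_of_opNorm_le_of_le (h.norm_inverse_R_le ht)
      ((D.H t).le_of_opNorm_le (h.boundH t ht) ξ)).trans_eq ?_
    ring
  have hnorm := pow_le_pow_left₀ (norm_nonneg _)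
    ((norm_sub_le _ u).trans (add_le_add_left hfeedback _)) 2
  refine (hnorm.trans add_sq_le).trans_eq ?_
  ring

theorem inner_K_add_inner_R_le (h : Assumptions k T D) (ht : t ∈ Icc 0 T)
    (hw : w = (D.R t).inverse (D.H t ξ) - u) :
    ⟪ξ, D.K t ξ⟫_ℝ + ⟪w, D.R t w⟫_ℝ ≤
      k.lamQ * ‖ξ‖ ^ 2 + (k.lamR * (2 * (k.lamH / k.gamR) ^ 2) * ‖ξ‖ ^ 2 +
        k.lamR * 2 * ‖u‖ ^ 2) := by
  have hK := (le_smul_one_iff.1 (h.K_le ht)).2 ξ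
  have hR := (le_smul_one_iff.1 (le_smul_one_of_norm_le
    (smul_one_le_iff.1 (h.coerciveR t ht)).1 (h.boundR t ht))).2 w
  have hsq := mul_le_mul_of_nonneg_left (h.norm_feedback_sub_sq_le ht (ξ := ξ) (u := u))
    k.lamR_pos.le
  rw [← hw] at hsq
  linarith

variable {a s : ℝ}

theorem gramian_le_alpha1' (h : Assumptions k T D) (ha : a ∈ Icc 0 T) (hs : s ∈ Icc a T)
    (hsa : s - a ≤ k.sigma) : gramian T D.A D.B a s ≤ k.alpha1' • 1 := by
  have hκ := k.kappa_pos
  obtain ⟨hsymm, hle⟩ := le_smul_one_iff.1 (gramian_le_smul_one h.T_pos h.contA h.contB hκ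
    (fun t ht => (h.boundA t ht).trans k.lamA_le_kappa) h.boundB ha hs)
  refine le_smul_one_iff.2 ⟨hsymm, fun v => (hle v).trans ?_⟩
  rw [k.alpha1'_eq]
  gcongr

theorem exists_steering (h : Assumptions k T D) (ha : a ∈ Icc 0 (T - k.sigma)) (v : Vec nx) :
    ∃ b ∈ Icc a (a + k.sigma), ∃ z, gramian T D.A D.B a b z = v ∧
      ⟪z, v⟫_ℝ ≤ ‖v‖ ^ 2 / k.alpha0 ∧ k.alpha0 * ‖v‖ ^ 2 ≤ k.alpha1' * ‖v‖ ^ 2 ∧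
      ∀ s ∈ Icc a b,
        ‖steeredState T D.A D.B a v z s‖ ^ 2 ≤
          (1 + k.alpha1 / k.alpha0) ^ 2 * ‖v‖ ^ 2 * Real.exp (2 * k.lamA * (s - a)) ∧
        ‖steeredState T D.A D.B a v z s‖ ^ 2 ≤
          (1 + k.alpha1' / k.alpha0') ^ 2 * ‖v‖ ^ 2 * Real.exp (2 * k.kappa * (s - a)) := by
  obtain ⟨b, hb, hlower, hupper, -, -⟩ := h.controllable a ha
  have hα := k.alpha0_pos; have hα' := k.alpha0'_pos
  have hbT : b ≤ T := by linarith [hb.2, ha.2]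
  have haT : a ∈ Icc 0 T := ⟨ha.1, hb.1.trans hbT⟩
  have hupper' : gramian T D.A D.B a b ≤ k.alpha1' • 1 :=
    h.gramian_le_alpha1' haT ⟨hb.1, hbT⟩ (sub_le_iff_le_add'.2 hb.2)
  set z := (gramian T D.A D.B a b).inverse v
  have hzv : ‖z‖ ≤ ‖v‖ / k.alpha0 :=
    (ContinuousLinearMap.le_of_opNorm_le _ (norm_inverse_le hα hlower) v).trans_eq (by ring)
  have hzv' : ‖z‖ ≤ ‖v‖ / k.alpha0' :=
    hzv.trans (div_le_div_of_nonneg_left (norm_nonneg v) hα' k.alpha0'_le_alpha0)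
  refine ⟨b, hb, z, apply_inverse_apply hα hlower v, ?_, ?_, fun s hs => ?_⟩
  · refine ((real_inner_le_norm z v).trans
      (mul_le_mul_of_nonneg_right hzv (norm_nonneg v))).trans_eq ?_
    ring
  · exact ((smul_one_le_iff.1 hlower).2 v).trans ((le_smul_one_iff.1 hupper').2 v)
  · have hsT : s ∈ Icc a T := ⟨hs.1, hs.2.trans hbT⟩
    have hnonneg := gramian_nonneg h.T_pos h.contA h.contB haT hsT
    have hmono : gramian T D.A D.B a s ≤ gramian T D.A D.B a b :=
      gramian_le_gramian h.T_pos h.contA h.contB haT ⟨haT.1.trans hs.1, hsT.2⟩ hs.2 hbT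
    exact ⟨norm_steeredState_sq_le h.T_pos h.contA h.boundA haT hsT
        (norm_le_of_nonneg_of_le_smul_one k.alpha1_pos.le hnonneg (hmono.trans hupper)) hzv,
      norm_steeredState_sq_le h.T_pos h.contA
        (fun t ht => (h.boundA t ht).trans k.lamA_le_kappa) haT hsT
        (norm_le_of_nonneg_of_le_smul_one k.alpha1'_pos.le hnonneg (hmono.trans hupper')) hzv'⟩

variable {x lam : ℝ → Vec nx}

theorem hasDerivWithinAt_steeredState_reduced (h : Assumptions k T D) (ha : a ∈ Icc 0 T)
    (hs : s ∈ Icc 0 T) {ξ : ℝ → Vec nx} {v z : Vec nx} (hξ : ξ = steeredState T D.A D.B a v z) :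
    HasDerivWithinAt ξ (D.F s (ξ s) + D.B s
      ((D.R s).inverse (D.H s (ξ s)) - gramianControl T D.A D.B a z s)) (Icc 0 T) s := by
  subst hξ
  refine (hasDerivWithinAt_steeredState h.T_pos h.contA h.contB ha hs).congr_deriv ?_
  simp only [Data.F, sub_apply, ContinuousLinearMap.comp_apply, map_sub]
  abel

theorem inner_le_window (h : Assumptions k T D) (hx : h.system.IsSolution x lam)
    (ha : a ∈ Icc 0 (T - k.sigma)) : ⟪x a, lam a⟫_ℝ ≤ k.c1 * ‖x a‖ ^ 2 := by
  obtain ⟨b, hb, z, hz, hzv, hα, hξ⟩ := h.exists_steering ha (x a)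
  have hbT : b ≤ T := by linarith [hb.2, ha.2]
  have haT : a ∈ Icc 0 T := ⟨ha.1, hb.1.trans hbT⟩
  have hsub : Icc a b ⊆ Icc 0 T := Icc_subset_Icc ha.1 hbT
  set ξ := steeredState T D.A D.B a (x a) z
  have hvalue := hx.inner_le_of_primal hb.1 hsub
    (β := fun s => k.lamQ * ((1 + k.alpha1' / k.alpha0') ^ 2 * ‖x a‖ ^ 2) *
        (Real.exp (2 * k.kappa * (s - a)) / (2 * k.kappa)) +
      (k.lamR * (2 * (k.lamH / k.gamR) ^ 2) * ((1 + k.alpha1 / k.alpha0) ^ 2 * ‖x a‖ ^ 2) *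
        (Real.exp (2 * k.lamA * (s - a)) / (2 * k.lamA)) +
      k.lamR * 2 * ⟪z, gramian T D.A D.B a s z⟫_ℝ))
    (steeredState_left h.T_pos h.contA haT)
    (fun s hs => (h.hasDerivWithinAt_steeredState_reduced haT (hsub hs) rfl).mono hsub)
    (fun s hs v => h.inner_N_add_nonneg (hsub hs) v _)
    (fun s hs => (hasDerivAt_exp_primitive k.kappa_pos _ a s).hasDerivWithinAt.add
      ((hasDerivAt_exp_primitive k.lamA_pos _ a s).hasDerivWithinAt.add
        (((hasDerivWithinAt_inner_gramian h.T_pos h.contA h.contB haT (hsub hs) z).mono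
          hsub).const_mul _)))
    (fun s hs => by
      obtain ⟨hξA, hξκ⟩ := hξ s hs
      have := k.lamQ_pos; have := k.lamR_pos
      refine (h.inner_K_add_inner_R_le (hsub hs) rfl).trans ?_
      rw [mul_assoc k.lamQ, mul_assoc (k.lamR * _) _ (Real.exp _)]
      gcongr)
  have hcost := k.steering_cost_le (sq_nonneg ‖x a‖) hα hzv (sub_le_iff_le_add'.2 hb.2)
  have hgam := hx.gam_mul_norm_sq_le_inner (hsub ⟨hb.1, le_rfl⟩)
  have hb_nonneg : 0 ≤ ⟪x b, lam b⟫_ℝ :=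
    (mul_nonneg k.gamQ_pos.le (sq_nonneg _)).trans hgam
  have hξb : steeredState T D.A D.B a (x a) z b = 0 := steeredState_eq_zero hz
  simp only [hξb, hz, inner_zero_right, sub_self, mul_zero, Real.exp_zero, gramian_self,
    zero_apply, add_zero, sub_div, mul_sub] at hvalue hcost
  linarith

theorem hasValueBounds (h : Assumptions k T D) : h.system.HasValueBounds k.c0 k.c1 := by
  have hγ := k.gamR_pos
  have hν : 0 ≤ k.lamB ^ 2 / k.gamR := by positivity
  have hF : ∀ t ∈ Icc 0 T, ‖h.system.F t‖ ≤ k.kappa := fun t ht => h.norm_F_le ht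
  have hN : ∀ t ∈ Icc 0 T, h.system.N t ≤ (k.lamB ^ 2 / k.gamR) • 1 := fun t ht => h.N_le ht
  refine ⟨k.c0_pos, k.c1_pos, fun hx t ht => ?_, fun hx t ht => ?_⟩ <;>
    rcases le_total t (T - k.sigma) with htσ | htσ
  · exact hx.le_inner_window k.sigma_pos hF hν hN k.c0_pos.le k.c0_mul_window_le ht.1 (by linarith)
  · exact hx.le_inner_tail k.kappa_pos hF hν hN k.c0_pos.le k.c0_mul_tail_le ht (by linarith)
  · exact h.inner_le_window hx ⟨ht.1, htσ⟩
  · exact (hx.inner_le_tail k.kappa_pos hF k.lamQ_pos.le (fun t ht => h.K_le ht) h.boundQT ht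
      (by linarith)).trans (mul_le_mul_of_nonneg_right k.tail_le_c1 (sq_nonneg _))

end Assumptions

/-! ### The optimality system -/

section MemLp

variable {E F : Type*} [NormedAddCommGroup E] [NormedAddCommGroup F] {a b : ℝ} {p : ENNReal}

theorem memLp_of_continuousOn_Icc {g : ℝ → E} (hg : ContinuousOn g (Icc a b)) :
    MemLp g p (volume.restrict (Icc a b)) := by
  obtain ⟨C, hC⟩ := isCompact_Icc.exists_bound_of_continuousOn hg
  exact MemLp.of_bound (hg.aestronglyMeasurable measurableSet_Icc) C
    (ae_restrict_of_forall_mem measurableSet_Icc hC)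

theorem memLp_operator_apply [NormedSpace ℝ E] [NormedSpace ℝ F] {M : ℝ → E →L[ℝ] F} {g : ℝ → E}
    (hM : ContinuousOn M (Icc a b)) (hg : MemLp g p (volume.restrict (Icc a b))) :
    MemLp (fun t => M t (g t)) p (volume.restrict (Icc a b)) :=
  (ContinuousLinearMap.id ℝ (E →L[ℝ] F)).memLp_of_bilin p
    (memLp_of_continuousOn_Icc (p := ⊤) hM) hg

theorem intervalIntegrable_of_memLp (hab : a ≤ b) (hp : 1 ≤ p) {g : ℝ → E}
    (hg : MemLp g p (volume.restrict (Icc a b))) : IntervalIntegrable g volume a b :=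
  (intervalIntegrable_iff_integrableOn_Icc_of_le hab).2 (hg.integrable hp)

theorem intervalIntegrable_inner_of_memLp_two {V : Type*} [NormedAddCommGroup V]
    [InnerProductSpace ℝ V] (hab : a ≤ b) {f g : ℝ → V}
    (hf : MemLp f 2 (volume.restrict (Icc a b))) (hg : MemLp g 2 (volume.restrict (Icc a b))) :
    IntervalIntegrable (fun t => ⟪f t, g t⟫_ℝ) volume a b :=
  intervalIntegrable_of_memLp hab le_rfl ((innerSL ℝ).memLp_of_bilin 1 hf hg)

end MemLp

namespace HasJumpPrimitive

variable {E : Type*} [NormedAddCommGroup E] [NormedSpace ℝ E] {a b c : ℝ} {y : ℝ → E} {y₀ : E}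
  {h k : ℝ → E} {p : E}

theorem congr_deriv_ne (hab : a ≤ b) (hy : HasJumpPrimitive a b c y y₀ h p) {d : ℝ}
    (hk : ∀ t ∈ Icc a b, t ≠ d → k t = h t) : HasJumpPrimitive a b c y y₀ k p := by
  have hne : ∀ᵐ s : ℝ, s ≠ d := by simp [ae_iff]
  refine ⟨hy.integrable.congr_ae ?_, fun t ht => ?_⟩
  · rw [EventuallyEq, ae_restrict_iff' measurableSet_uIoc, uIoc_of_le hab]
    filter_upwards [hne] with s hs hs'
    exact (hk s (Ioc_subset_Icc_self hs') hs).symm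
  · rw [hy.eq t ht, intervalIntegral.integral_congr_ae (g := k)]
    filter_upwards [hne] with s hs hs'
    rw [uIoc_of_le ht.1] at hs'
    exact (hk s ⟨hs'.1.le, hs'.2.trans ht.2⟩ hs).symm

theorem exists_iff_eq_right (hc : c ≤ b) (hi : IntervalIntegrable h volume a b) :
    (∃ y₀, HasJumpPrimitive a b c y y₀ h p) ↔
      ∀ t ∈ Icc a b, y t = y b - (∫ s in t..b, h s) - if t < c then p else 0 :=
  ⟨fun ⟨_, hy⟩ _ ht => hy.eq_right hc ht, fun hy => ⟨_, .of_eq_right hi hy⟩⟩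

end HasJumpPrimitive

namespace Data

variable {nx nu nd : ℕ} (D : Data nx nu nd)

/-- The weight `C - B R⁻¹ Wᵀ` of the parameter in the reduced state equation. -/
noncomputable def E (t : ℝ) : Mat nx nd := D.C t - D.B t ∘L (D.R t).inverse ∘L (D.W t)†

/-- The weight `Gᵀ - Hᵀ R⁻¹ Wᵀ` of the parameter in the reduced adjoint equation. -/
noncomputable def J (t : ℝ) : Mat nx nd := (D.G t)† - (D.H t)† ∘L (D.R t).inverse ∘L (D.W t)†

/-- The control `-R⁻¹ (H x + Bᵀ λ + Wᵀ d)` which minimizes the Hamiltonian. -/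
noncomputable def feedback (t : ℝ) (x lam : Vec nx) (d : Vec nd) : Vec nu :=
  -(D.R t).inverse (D.H t x + ((D.B t)†) lam + ((D.W t)†) d)

/-- The right-hand side of the state equation. -/
def stateRate (t : ℝ) (x : Vec nx) (u : Vec nu) (d : Vec nd) : Vec nx :=
  D.A t x + D.B t u + D.C t d

/-- The gradient `∇ₓ ℋ` of the Hamiltonian in the state. -/
noncomputable def gradState (t : ℝ) (x : Vec nx) (u : Vec nu) (lam : Vec nx) (d : Vec nd) :
    Vec nx :=
  ((D.A t)†) lam + D.Q t x + ((D.H t)†) u + ((D.G t)†) d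

/-- The gradient `∇ᵤ ℋ` of the Hamiltonian in the control. -/
noncomputable def gradControl (t : ℝ) (x : Vec nx) (u : Vec nu) (lam : Vec nx) (d : Vec nd) :
    Vec nu :=
  D.H t x + D.R t u + ((D.B t)†) lam + ((D.W t)†) d

/-- The inhomogeneous terms of the reduced boundary value problem for the parameters
`(d, d₀, d_T)`, with prescribed jumps. -/
noncomputable def forcing (d : ℝ → Vec nd) (d0 : Vec nx) (dT : Vec nd) (p q : Vec nx) :
    Forcing (Vec nx) where
  f t := D.E t (d t)
  g t := D.J t (d t)
  x₀ := d0
  e := (D.GT†) dT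
  p := p
  q := q

theorem stateRate_feedback (t : ℝ) (x lam : Vec nx) (d : Vec nd) :
    D.stateRate t x (D.feedback t x lam d) d = D.F t x - D.N t lam + D.E t d := by
  simp only [stateRate, feedback, F, N, E, map_add, map_neg, sub_apply,
    ContinuousLinearMap.comp_apply]
  abel

end Data

namespace Assumptions

variable {nx nu nd : ℕ} {k : Constants} {T : ℝ} {D : Data nx nu nd}

section Integrability

theorem continuousOn_E (h : Assumptions k T D) : ContinuousOn D.E (Icc 0 T) := by
  have := h.contC; have := h.contB; have := h.continuousOn_inverse_R
  have := continuousOn_adjoint h.contW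
  unfold Data.E
  fun_prop

theorem continuousOn_J (h : Assumptions k T D) : ContinuousOn D.J (Icc 0 T) := by
  have := continuousOn_adjoint h.contG; have := continuousOn_adjoint h.contH
  have := h.continuousOn_inverse_R; have := continuousOn_adjoint h.contW
  unfold Data.J
  fun_prop

variable {x lam : ℝ → Vec nx} {u : ℝ → Vec nu} {d : ℝ → Vec nd}

theorem memLp_feedback (h : Assumptions k T D) {p : ENNReal}
    (hx : MemLp x p (volume.restrict (Icc 0 T))) (hl : MemLp lam p (volume.restrict (Icc 0 T)))
    (hd : MemLp d p (volume.restrict (Icc 0 T))) :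
    MemLp (fun t => D.feedback t (x t) (lam t) (d t)) p (volume.restrict (Icc 0 T)) :=
  (memLp_operator_apply h.continuousOn_inverse_R
    (((memLp_operator_apply h.contH hx).add
      (memLp_operator_apply (continuousOn_adjoint h.contB) hl)).add
      (memLp_operator_apply (continuousOn_adjoint h.contW) hd))).neg

theorem intervalIntegrable_feedback (h : Assumptions k T D) (hx : IntervalIntegrable x volume 0 T)
    (hl : IntervalIntegrable lam volume 0 T) (hd : IntervalIntegrable d volume 0 T) :
    IntervalIntegrable (fun t => D.feedback t (x t) (lam t) (d t)) volume 0 T := by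
  rw [intervalIntegrable_iff_integrableOn_Icc_of_le h.T_pos.le, IntegrableOn,
    ← memLp_one_iff_integrable] at hx hl hd ⊢
  exact h.memLp_feedback hx hl hd

theorem intervalIntegrable_stateRate (h : Assumptions k T D)
    (hx : IntervalIntegrable x volume 0 T) (hu : IntervalIntegrable u volume 0 T)
    (hd : IntervalIntegrable d volume 0 T) :
    IntervalIntegrable (fun s => D.stateRate s (x s) (u s) (d s)) volume 0 T :=
  have hT := h.T_pos.le
  ((intervalIntegrable_operator_apply hT h.contA hx).add
    (intervalIntegrable_operator_apply hT h.contB hu)).add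
    (intervalIntegrable_operator_apply hT h.contC hd)

theorem intervalIntegrable_gradState (h : Assumptions k T D)
    (hx : IntervalIntegrable x volume 0 T) (hu : IntervalIntegrable u volume 0 T)
    (hl : IntervalIntegrable lam volume 0 T) (hd : IntervalIntegrable d volume 0 T) :
    IntervalIntegrable (fun s => D.gradState s (x s) (u s) (lam s) (d s)) volume 0 T :=
  have hT := h.T_pos.le
  (((intervalIntegrable_operator_apply hT (continuousOn_adjoint h.contA) hl).add
    (intervalIntegrable_operator_apply hT h.contQ hx)).add
    (intervalIntegrable_operator_apply hT (continuousOn_adjoint h.contH) hu)).add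
    (intervalIntegrable_operator_apply hT (continuousOn_adjoint h.contG) hd)

theorem intervalIntegrable_runningCost (h : Assumptions k T D)
    (hx : MemLp x 2 (volume.restrict (Icc 0 T))) (hu : MemLp u 2 (volume.restrict (Icc 0 T)))
    (hd : MemLp d 2 (volume.restrict (Icc 0 T))) :
    IntervalIntegrable (fun t => runningCost D t (x t) (u t) (d t)) volume 0 T :=
  have hT := h.T_pos.le
  (((intervalIntegrable_inner_of_memLp_two hT hx
    (((memLp_operator_apply h.contQ hx).add
      (memLp_operator_apply (continuousOn_adjoint h.contH) hu)).add
      (memLp_operator_apply (continuousOn_adjoint h.contG) hd))).add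
    (intervalIntegrable_inner_of_memLp_two hT hu
      (((memLp_operator_apply h.contH hx).add (memLp_operator_apply h.contR hu)).add
        (memLp_operator_apply (continuousOn_adjoint h.contW) hd)))).add
    (intervalIntegrable_inner_of_memLp_two hT hd
      ((memLp_operator_apply h.contG hx).add (memLp_operator_apply h.contW hu)))).const_mul _

end Integrability

section Hamiltonian

variable {t : ℝ}

theorem gradState_feedback (h : Assumptions k T D) (ht : t ∈ Icc 0 T) (x lam : Vec nx)
    (d : Vec nd) : D.gradState t x (D.feedback t x lam d) lam d =
      ((D.F t)†) lam + D.K t x + D.J t d := by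
  simp only [Data.gradState, Data.feedback, Data.F, Data.K, Data.J, map_add, map_sub, map_neg,
    sub_apply, ContinuousLinearMap.comp_apply, ContinuousLinearMap.adjoint_comp,
    adjoint_inverse k.gamR_pos (h.coerciveR t ht)]
  abel

theorem gradControl_feedback (h : Assumptions k T D) (ht : t ∈ Icc 0 T) (x lam : Vec nx)
    (d : Vec nd) : D.gradControl t x (D.feedback t x lam d) lam d = 0 := by
  rw [Data.gradControl, Data.feedback, map_neg,
    apply_inverse_apply k.gamR_pos (h.coerciveR t ht)]
  abel

theorem isSymmetric_R (h : Assumptions k T D) (ht : t ∈ Icc 0 T) :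
    (D.R t : Vec nu →ₗ[ℝ] Vec nu).IsSymmetric :=
  (smul_one_le_iff.1 (h.coerciveR t ht)).1

theorem hamiltonian_add (h : Assumptions k T D) (ht : t ∈ Icc 0 T) (x ξ lam : Vec nx)
    (u ω : Vec nu) (d : Vec nd) :
    hamiltonian D t (x + ξ) (u + ω) lam d = hamiltonian D t x u lam d +
      (⟪ξ, D.gradState t x u lam d⟫_ℝ + ⟪ω, D.gradControl t x u lam d⟫_ℝ) +
      runningCost D t ξ ω 0 := by
  have hQ : ⟪x, D.Q t ξ⟫_ℝ = ⟪ξ, D.Q t x⟫_ℝ := by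
    rw [real_inner_comm]
    exact h.isSymmetric_Q ht ξ x
  have hR : ⟪u, D.R t ω⟫_ℝ = ⟪ω, D.R t u⟫_ℝ := by
    rw [real_inner_comm]
    exact h.isSymmetric_R ht ω u
  have hadj {m n : ℕ} (M : Mat m n) (y : Vec n) (v : Vec m) : ⟪y, (M†) v⟫_ℝ = ⟪v, M y⟫_ℝ := by
    rw [ContinuousLinearMap.adjoint_inner_right, real_inner_comm]
  simp only [hamiltonian, runningCost, Data.gradState, Data.gradControl, map_add, map_zero,
    inner_add_left, inner_add_right, inner_zero_left, inner_zero_right, hQ, hR, hadj]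
  ring

theorem runningCost_zero_eq (h : Assumptions k T D) (ht : t ∈ Icc 0 T) (ξ : Vec nx) (ω : Vec nu) :
    runningCost D t ξ ω 0 = 1 / 2 * (⟪ξ, D.K t ξ⟫_ℝ +
      ⟪ω + (D.R t).inverse (D.H t ξ), D.R t (ω + (D.R t).inverse (D.H t ξ))⟫_ℝ) := by
  have hcross : ⟪(D.R t).inverse (D.H t ξ), D.R t ω⟫_ℝ = ⟪ω, D.H t ξ⟫_ℝ := by
    rw [real_inner_comm]
    simpa only [ContinuousLinearMap.coe_coe,
      apply_inverse_apply k.gamR_pos (h.coerciveR t ht)] using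
      h.isSymmetric_R ht ω ((D.R t).inverse (D.H t ξ))
  have hH : ⟪ξ, ((D.H t)†) ω⟫_ℝ = ⟪ω, D.H t ξ⟫_ℝ := by
    rw [ContinuousLinearMap.adjoint_inner_right, real_inner_comm]
  simp only [runningCost, Data.K, map_add, map_zero, inner_add_left, inner_add_right,
    inner_zero_left, add_zero, sub_apply, ContinuousLinearMap.comp_apply, inner_sub_right, hH,
    ContinuousLinearMap.adjoint_inner_right, hcross,
    apply_inverse_apply k.gamR_pos (h.coerciveR t ht)]
  rw [real_inner_comm (D.H t ξ) ((D.R t).inverse (D.H t ξ))]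
  ring

theorem runningCost_zero_nonneg (h : Assumptions k T D) (ht : t ∈ Icc 0 T) (ξ : Vec nx)
    (ω : Vec nu) : 0 ≤ runningCost D t ξ ω 0 := by
  have := k.gamQ_pos; have := k.gamR_pos
  rw [h.runningCost_zero_eq ht]
  exact mul_nonneg (by norm_num) <| add_nonneg
    ((by positivity : (0 : ℝ) ≤ _).trans ((smul_one_le_iff.1 (h.coerciveQ t ht)).2 ξ))
    ((by positivity : (0 : ℝ) ≤ _).trans ((smul_one_le_iff.1 (h.coerciveR t ht)).2 _))

theorem hamiltonian_feedback_add (h : Assumptions k T D) (ht : t ∈ Icc 0 T) (x ξ lam : Vec nx)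
    (ω : Vec nu) (d : Vec nd) :
    hamiltonian D t (x + ξ) (D.feedback t x lam d + ω) lam d =
      hamiltonian D t x (D.feedback t x lam d) lam d +
      ⟪ξ, D.gradState t x (D.feedback t x lam d) lam d⟫_ℝ + runningCost D t ξ ω 0 := by
  rw [h.hamiltonian_add ht, h.gradControl_feedback ht, inner_zero_right, add_zero]

theorem forall_hamiltonian_le_iff (h : Assumptions k T D) (ht : t ∈ Icc 0 T) {x lam : Vec nx}
    {d : Vec nd} {u : Vec nu} :
    (∀ w, hamiltonian D t x u lam d ≤ hamiltonian D t x w lam d) ↔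
      u = D.feedback t x lam d := by
  have hadd (w : Vec nu) : hamiltonian D t x w lam d =
      hamiltonian D t x (D.feedback t x lam d) lam d +
        runningCost D t 0 (w - D.feedback t x lam d) 0 := by
    simpa using h.hamiltonian_feedback_add ht x 0 lam (w - D.feedback t x lam d) d
  constructor
  · intro hu
    have hle := hu (D.feedback t x lam d)
    rw [hadd u, h.runningCost_zero_eq ht] at hle
    simp only [map_zero, inner_zero_right, zero_add, add_zero] at hle
    have hcoercive := (smul_one_le_iff.1 (h.coerciveR t ht)).2 (u - D.feedback t x lam d)
    have hsq : ‖u - D.feedback t x lam d‖ ^ 2 ≤ 0 :=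
      nonpos_of_mul_nonpos_right (by linarith) k.gamR_pos
    exact sub_eq_zero.1 (norm_eq_zero.1 (pow_eq_zero_iff two_ne_zero |>.1
      (hsq.antisymm (sq_nonneg _))))
  · rintro rfl w
    rw [hadd w]
    exact le_add_of_nonneg_right (h.runningCost_zero_nonneg ht _ _)

end Hamiltonian

section OptimalitySystem

variable {t' : ℝ} {x lam : ℝ → Vec nx} {u : ℝ → Vec nu} {d : ℝ → Vec nd} {d0 : Vec nx}
  {dT : Vec nd} {p q : Vec nx}

theorem hasJumpPrimitive_state_iff (h : Assumptions k T D)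
    (hu : ∀ t ∈ Icc 0 T, t ≠ t' → u t = D.feedback t (x t) (lam t) (d t)) :
    HasJumpPrimitive 0 T t' x d0 (fun t => D.F t (x t) - D.N t (lam t) + D.E t (d t)) p ↔
      HasJumpPrimitive 0 T t' x d0 (fun t => D.stateRate t (x t) (u t) (d t)) p := by
  have heq : ∀ t ∈ Icc 0 T, t ≠ t' → D.stateRate t (x t) (u t) (d t) =
      D.F t (x t) - D.N t (lam t) + D.E t (d t) := fun t ht hne => by
    rw [hu t ht hne, D.stateRate_feedback]
  exact ⟨fun hx => hx.congr_deriv_ne h.T_pos.le heq,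
    fun hx => hx.congr_deriv_ne h.T_pos.le fun t ht hne => (heq t ht hne).symm⟩

theorem hasJumpPrimitive_adjoint_iff (h : Assumptions k T D) {l₀ : Vec nx}
    (hu : ∀ t ∈ Icc 0 T, t ≠ t' → u t = D.feedback t (x t) (lam t) (d t)) :
    HasJumpPrimitive 0 T t' lam l₀
        (fun t => -((D.F t)†) (lam t) - D.K t (x t) - D.J t (d t)) (-q) ↔
      HasJumpPrimitive 0 T t' lam l₀
        (fun t => -D.gradState t (x t) (u t) (lam t) (d t)) (-q) := by
  have heq : ∀ t ∈ Icc 0 T, t ≠ t' → -D.gradState t (x t) (u t) (lam t) (d t) =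
      -((D.F t)†) (lam t) - D.K t (x t) - D.J t (d t) := fun t ht hne => by
    rw [hu t ht hne, h.gradState_feedback ht]
    abel
  exact ⟨fun hl => hl.congr_deriv_ne h.T_pos.le heq,
    fun hl => hl.congr_deriv_ne h.T_pos.le fun t ht hne => (heq t ht hne).symm⟩

theorem isBVPSolution_iff (h : Assumptions k T D) (ht' : t' ∈ Icc 0 T)
    (hx : IntervalIntegrable x volume 0 T) (hl : IntervalIntegrable lam volume 0 T)
    (hui : IntervalIntegrable u volume 0 T) (hd : IntervalIntegrable d volume 0 T)
    (hu : ∀ t ∈ Icc 0 T, t ≠ t' → u t = D.feedback t (x t) (lam t) (d t)) :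
    h.system.IsBVPSolution t' (D.forcing d d0 dT p q) x lam ↔
      (∀ t ∈ Icc 0 T, x t = d0 + (∫ s in 0..t, D.stateRate s (x s) (u s) (d s)) +
        if t' ≤ t then p else 0) ∧
      ∀ t ∈ Icc 0 T, lam t = D.QT (x T) + (D.GT†) dT +
        (∫ s in t..T, D.gradState s (x s) (u s) (lam s) (d s)) + if t < t' then q else 0 := by
  have hright := HasJumpPrimitive.exists_iff_eq_right (y := lam) (p := -q) ht'.2
    (h.intervalIntegrable_gradState hx hui hl hd).neg
  have hshape (t : ℝ) (v : Vec nx) :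
      v - (∫ s in t..T, -D.gradState s (x s) (u s) (lam s) (d s)) - (if t < t' then -q else 0) =
        v + (∫ s in t..T, D.gradState s (x s) (u s) (lam s) (d s)) + if t < t' then q else 0 := by
    rw [intervalIntegral.integral_neg]
    split_ifs <;> simp
  simp only [Pi.neg_def, hshape] at hright
  constructor
  · rintro ⟨hstate, ⟨l₀, hadj⟩, hT⟩
    have hlam := hright.1 ⟨l₀, (h.hasJumpPrimitive_adjoint_iff hu).1 hadj⟩
    rw [hT] at hlam
    exact ⟨((h.hasJumpPrimitive_state_iff hu).1 hstate).eq, hlam⟩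
  · rintro ⟨hstate, hlam⟩
    have hT : lam T = D.QT (x T) + (D.GT†) dT := by
      simpa [ht'.2.not_gt] using hlam T ⟨h.T_pos.le, le_rfl⟩
    rw [← hT] at hlam
    obtain ⟨l₀, hadj⟩ := hright.2 hlam
    exact ⟨(h.hasJumpPrimitive_state_iff hu).2
      ⟨h.intervalIntegrable_stateRate hx hui hd, hstate⟩,
      ⟨l₀, (h.hasJumpPrimitive_adjoint_iff hu).2 hadj⟩, hT⟩

end OptimalitySystem

end Assumptions

theorem HasJumpPrimitive.inner_right_eq_integral {V : Type*} [NormedAddCommGroup V]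
    [InnerProductSpace ℝ V] [CompleteSpace V] {a b c : ℝ} {lam ξ g r : ℝ → V} {l₀ : V} (hab : a ≤ b)
    (hc : c ∈ Icc a b) (hl : HasJumpPrimitive a b c lam l₀ (fun t => -g t) 0)
    (hξ : HasJumpPrimitive a b c ξ 0 r 0) :
    IntervalIntegrable (fun t => ⟪ξ t, g t⟫_ℝ - ⟪lam t, r t⟫_ℝ) volume a b ∧
      (∫ t in a..b, (⟪ξ t, g t⟫_ℝ - ⟪lam t, r t⟫_ℝ)) = -⟪ξ b, lam b⟫_ℝ := by
  have hprod := HasJumpPrimitive.bilin (innerSL ℝ) hab hc hl hξ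
  have hrate : (fun t => -(innerSL ℝ (-g t) (ξ t) + innerSL ℝ (lam t) (r t))) =
      fun t => ⟪ξ t, g t⟫_ℝ - ⟪lam t, r t⟫_ℝ := funext fun t => by
    rw [innerSL_apply_apply, innerSL_apply_apply, inner_neg_left, real_inner_comm]
    ring
  have heq := hprod.eq b (right_mem_Icc.2 hab)
  simp only [map_zero, ite_self, zero_add, add_zero] at heq
  rw [← hrate, intervalIntegral.integral_neg, ← heq, innerSL_apply_apply, real_inner_comm]
  exact ⟨hprod.integrable.neg, rfl⟩

namespace Assumptions

variable {nx nu nd : ℕ} {k : Constants} {T : ℝ} {D : Data nx nu nd}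

theorem terminalCost_add (h : Assumptions k T D) (x ξ : Vec nx) (e : Vec nd) :
    terminalCost D (x + ξ) e =
      terminalCost D x e + ⟪ξ, D.QT x + (D.GT†) e⟫_ℝ + terminalCost D ξ 0 := by
  have hQ : ⟪x, D.QT ξ⟫_ℝ = ⟪ξ, D.QT x⟫_ℝ := by
    rw [real_inner_comm]
    exact (smul_one_le_iff.1 h.coerciveQT).1 ξ x
  have hG : ⟪ξ, (D.GT†) e⟫_ℝ = ⟪e, D.GT ξ⟫_ℝ := by
    rw [ContinuousLinearMap.adjoint_inner_right, real_inner_comm]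
  simp only [terminalCost, map_add, map_zero, inner_add_left, inner_add_right, inner_zero_left,
    inner_zero_right, hQ, hG]
  ring

theorem terminalCost_zero_nonneg (h : Assumptions k T D) (ξ : Vec nx) :
    0 ≤ terminalCost D ξ 0 := by
  have := k.gamQ_pos
  have hQ : 0 ≤ ⟪ξ, D.QT ξ⟫_ℝ :=
    (by positivity : (0 : ℝ) ≤ _).trans ((smul_one_le_iff.1 h.coerciveQT).2 ξ)
  simpa [terminalCost] using hQ

theorem runningCost_feedback_add_le (h : Assumptions k T D) {t : ℝ} (ht : t ∈ Icc 0 T)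
    (x ξ lam : Vec nx) (ω : Vec nu) (d : Vec nd) :
    runningCost D t x (D.feedback t x lam d) d +
        (⟪ξ, D.gradState t x (D.feedback t x lam d) lam d⟫_ℝ -
          ⟪lam, D.stateRate t ξ ω 0⟫_ℝ) ≤
      runningCost D t (x + ξ) (D.feedback t x lam d + ω) d := by
  have hadd := h.hamiltonian_feedback_add ht x ξ lam ω d
  have hnonneg := h.runningCost_zero_nonneg ht ξ ω
  simp only [hamiltonian, map_add, inner_add_right] at hadd
  simp only [Data.stateRate, map_zero, add_zero, inner_add_right]
  linarith

section Optimality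

variable {t' : ℝ} {x lam : ℝ → Vec nx} {d : ℝ → Vec nd} {d0 : Vec nx} {dT : Vec nd}

theorem hasJumpPrimitive_of_admissible (h : Assumptions k T D)
    (hd : MemLp d 2 (volume.restrict (Icc 0 T))) {x : ℝ → Vec nx} {u : ℝ → Vec nu}
    (hxu : Admissible D T d d0 x u) (t' : ℝ) :
    HasJumpPrimitive 0 T t' x d0 (fun t => D.stateRate t (x t) (u t) (d t)) 0 :=
  have hT := h.T_pos.le
  ⟨h.intervalIntegrable_stateRate (hxu.2.1.intervalIntegrable_of_Icc hT)
    (intervalIntegrable_of_memLp hT one_le_two hxu.1)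
    (intervalIntegrable_of_memLp hT one_le_two hd), fun t ht => by
      rw [ite_self, add_zero]
      exact hxu.2.2 t ht⟩

theorem admissible_of_isBVPSolution (h : Assumptions k T D)
    (hd : MemLp d 2 (volume.restrict (Icc 0 T)))
    (hs : h.system.IsBVPSolution t' (D.forcing d d0 dT 0 0) x lam) :
    Admissible D T d d0 x (fun t => D.feedback t (x t) (lam t) (d t)) := by
  have hT := h.T_pos.le
  obtain ⟨l₀, hl⟩ := hs.adj
  have hxc := hs.state.continuousOn hT
  have hlc := (neg_zero (G := Vec nx) ▸ hl).continuousOn hT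
  have hstate := (h.hasJumpPrimitive_state_iff fun _ _ _ => rfl).1 hs.state
  exact ⟨h.memLp_feedback (memLp_of_continuousOn_Icc hxc) (memLp_of_continuousOn_Icc hlc) hd, hxc,
    fun t ht => by simpa [Data.stateRate, Data.forcing] using hstate.eq t ht⟩

theorem cost_le_of_isBVPSolution (h : Assumptions k T D) (ht' : t' ∈ Icc 0 T)
    (hd : MemLp d 2 (volume.restrict (Icc 0 T)))
    (hs : h.system.IsBVPSolution t' (D.forcing d d0 dT 0 0) x lam) {x' : ℝ → Vec nx}
    {u' : ℝ → Vec nu} (hxu' : Admissible D T d d0 x' u') :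
    cost D T d dT x (fun t => D.feedback t (x t) (lam t) (d t)) ≤ cost D T d dT x' u' := by
  have hT := h.T_pos.le
  have hxu := h.admissible_of_isBVPSolution hd hs
  obtain ⟨l₀, hl⟩ := hs.adj
  have hlam := (h.hasJumpPrimitive_adjoint_iff (q := 0) fun _ _ _ => rfl).1 hl
  rw [neg_zero] at hlam
  set u : ℝ → Vec nu := fun t => D.feedback t (x t) (lam t) (d t) with hu
  have hξ : HasJumpPrimitive 0 T t' (fun t => x' t - x t) 0
      (fun t => D.stateRate t (x' t - x t) (u' t - u t) 0) 0 := by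
    refine ((h.hasJumpPrimitive_of_admissible hd hxu' t').sub
      (h.hasJumpPrimitive_of_admissible hd hxu t')).congr hT (fun _ _ => rfl) (sub_self d0).symm
      (fun t _ => ?_) (sub_self 0).symm
    simp only [Data.stateRate, map_sub, map_zero]
    abel
  obtain ⟨hint, hparts⟩ := hlam.inner_right_eq_integral hT ht' hξ
  have hcost {x : ℝ → Vec nx} {u : ℝ → Vec nu} (hxu : Admissible D T d d0 x u) :=
    h.intervalIntegrable_runningCost (memLp_of_continuousOn_Icc hxu.2.1) hxu.1 hd
  have hmono := intervalIntegral.integral_mono_on hT ((hcost hxu).add hint) (hcost hxu')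
    fun t ht => by
      simpa only [hu, add_sub_cancel] using
        h.runningCost_feedback_add_le ht (x t) (x' t - x t) (lam t) (u' t - u t) (d t)
  rw [intervalIntegral.integral_add (hcost hxu) hint, hparts] at hmono
  have hterm := h.terminalCost_add (x T) (x' T - x T) dT
  rw [add_sub_cancel] at hterm
  have hright : lam T = D.QT (x T) + (D.GT†) dT := hs.right
  rw [hright] at hmono
  have hnonneg := h.terminalCost_zero_nonneg (x' T - x T)
  simp only [cost]
  linarith

theorem isOptimalTriple_of_isBVPSolution (h : Assumptions k T D) (ht' : t' ∈ Icc 0 T)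
    (hd : MemLp d 2 (volume.restrict (Icc 0 T)))
    (hs : h.system.IsBVPSolution t' (D.forcing d d0 dT 0 0) x lam) :
    IsOptimalTriple D T d d0 dT ⟨x, fun t => D.feedback t (x t) (lam t) (d t), lam⟩ := by
  have hT := h.T_pos.le
  have hxu := h.admissible_of_isBVPSolution hd hs
  obtain ⟨l₀, hl⟩ := hs.adj
  have hlc := (neg_zero (G := Vec nx) ▸ hl).continuousOn hT
  have hadj := ((h.isBVPSolution_iff ht' (hs.state.intervalIntegrable hT)
    (hl.intervalIntegrable hT) (intervalIntegrable_of_memLp hT one_le_two hxu.1)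
    (intervalIntegrable_of_memLp hT one_le_two hd) fun _ _ _ => rfl).1 hs).2
  exact ⟨hxu, fun _ _ => h.cost_le_of_isBVPSolution ht' hd hs, hlc,
    fun t ht => by simpa [Data.gradState] using hadj t ht,
    fun t ht => (h.forall_hamiltonian_le_iff ht).2 rfl⟩

end Optimality

end Assumptions

/-! ### Decay of sensitivity -/

namespace Data

variable {nx nu nd : ℕ} (D : Data nx nu nd)

theorem feedback_sub (t : ℝ) (x x' lam lam' : Vec nx) (d : Vec nd) :
    D.feedback t x lam d - D.feedback t x' lam' d =
      -(D.R t).inverse (D.H t (x - x') + ((D.B t)†) (lam - lam')) := by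
  simp only [feedback, map_add, map_sub]
  abel

theorem continuous_feedback (t : ℝ) (d : Vec nd) :
    Continuous fun z : Vec nx × Vec nx => D.feedback t z.1 z.2 d := by
  unfold feedback
  fun_prop

theorem forcing_add_smul_sub (d : ℝ → Vec nd) (d0 : Vec nx) (dT : Vec nd) (φ : ℝ → ℝ) (t' : ℝ)
    (l : Vec nd) :
    D.forcing (fun t => d t + φ t • l) d0 dT 0 0 - D.forcing d d0 dT (D.E t' l) (D.J t' l) =
      .densitySubJump φ (fun s => D.E s l) (fun s => D.J s l) t' := by
  simp [Forcing.sub_def, forcing, Forcing.densitySubJump]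

theorem forcing_sub_forcing_zero (d : ℝ → Vec nd) (d0 : Vec nx) (dT : Vec nd) (p q : Vec nx) :
    D.forcing d d0 dT p q - D.forcing d d0 dT 0 0 = .jump p q := by
  simp [Forcing.sub_def, forcing, Forcing.jump]

end Data

namespace Assumptions

variable {nx nu nd : ℕ} {k : Constants} {T : ℝ} {D : Data nx nu nd} {t t' : ℝ}

section Bounds

theorem norm_E_le (h : Assumptions k T D) (ht : t ∈ Icc 0 T) :
    ‖D.E t‖ ≤ k.lamW * k.lamB / k.gamR + k.lamC := by
  have hBW := h.norm_comp_inverse_comp_le ht (h.boundB t ht)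
    ((LinearIsometryEquiv.norm_map _ _).trans_le (h.boundW t ht) : ‖(D.W t)†‖ ≤ _)
  refine (norm_sub_le_of_le (h.boundC t ht) hBW).trans_eq ?_
  ring

theorem norm_J_le (h : Assumptions k T D) (ht : t ∈ Icc 0 T) :
    ‖D.J t‖ ≤ k.lamW * k.lamH / k.gamR + k.lamG := by
  have hHW := h.norm_comp_inverse_comp_le ht
    ((LinearIsometryEquiv.norm_map _ _).trans_le (h.boundH t ht) : ‖(D.H t)†‖ ≤ _)
    ((LinearIsometryEquiv.norm_map _ _).trans_le (h.boundW t ht) : ‖(D.W t)†‖ ≤ _)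
  have hG : ‖(D.G t)†‖ ≤ k.lamG := (LinearIsometryEquiv.norm_map _ _).trans_le (h.boundG t ht)
  refine (norm_sub_le_of_le hG hHW).trans_eq ?_
  ring

theorem norm_feedback_sub_le (h : Assumptions k T D) (ht : t ∈ Icc 0 T) (x x' lam lam' : Vec nx)
    (d : Vec nd) : ‖D.feedback t x lam d - D.feedback t x' lam' d‖ ≤
      k.lamH / k.gamR * ‖x - x'‖ + k.lamB / k.gamR * ‖lam - lam'‖ := by
  have := k.gamR_pos
  have hB : ‖(D.B t)†‖ ≤ k.lamB := (LinearIsometryEquiv.norm_map _ _).trans_le (h.boundB t ht)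
  rw [D.feedback_sub, norm_neg]
  calc _ ≤ 1 / k.gamR * ‖D.H t (x - x') + ((D.B t)†) (lam - lam')‖ :=
        ContinuousLinearMap.le_of_opNorm_le _ (h.norm_inverse_R_le ht) _
    _ ≤ 1 / k.gamR * (k.lamH * ‖x - x'‖ + k.lamB * ‖lam - lam'‖) := by
        gcongr
        exact norm_add_le_of_le (ContinuousLinearMap.le_of_opNorm_le _ (h.boundH t ht) _)
          (ContinuousLinearMap.le_of_opNorm_le _ hB _)
    _ = _ := by ring

end Bounds

section Triples

variable {d : ℝ → Vec nd} {d0 : Vec nx} {dT l : Vec nd}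

theorem jump_eq (h : Assumptions k T D) (ht : t ∈ Icc 0 T) {η : Vec nu}
    (hη : D.R t η + ((D.W t)†) l = 0) :
    D.B t η + D.C t l = D.E t l ∧ ((D.H t)†) η + ((D.G t)†) l = D.J t l := by
  have hη' : η = -(D.R t).inverse (((D.W t)†) l) := by
    rw [← inverse_apply_apply k.gamR_pos (h.coerciveR t ht) η, eq_neg_of_add_eq_zero_left hη,
      map_neg]
  constructor <;>
  · simp only [hη', Data.E, Data.J, map_neg, sub_apply, ContinuousLinearMap.comp_apply]
    abel

theorem isBVPSolution_of_isOptimalTriple (h : Assumptions k T D) (ht' : t' ∈ Icc 0 T)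
    (hd : IntervalIntegrable d volume 0 T) {z : Trajectory nx nu}
    (hz : IsOptimalTriple D T d d0 dT z) :
    h.system.IsBVPSolution t' (D.forcing d d0 dT 0 0) z.x z.lam ∧
      ∀ t ∈ Icc 0 T, z.u t = D.feedback t (z.x t) (z.lam t) (d t) := by
  have hT := h.T_pos.le
  obtain ⟨⟨hu, hx, hstate⟩, -, hl, hadj, hmin⟩ := hz
  have hfb := fun t ht => (h.forall_hamiltonian_le_iff ht).1 (hmin t ht)
  refine ⟨(h.isBVPSolution_iff ht' (hx.intervalIntegrable_of_Icc hT)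
    (hl.intervalIntegrable_of_Icc hT) (intervalIntegrable_of_memLp hT one_le_two hu) hd
    fun t ht _ => hfb t ht).2 ?_, hfb⟩
  simp only [ite_self, add_zero]
  exact ⟨hstate, hadj⟩

theorem isBVPSolution_of_isPerturbedTriple (h : Assumptions k T D) (ht' : t' ∈ Icc 0 T)
    (hd : IntervalIntegrable d volume 0 T) {z : Trajectory nx nu}
    (hz : IsPerturbedTriple D T d d0 dT t' l z) :
    h.system.IsBVPSolution t' (D.forcing d d0 dT (D.E t' l) (D.J t' l)) z.x z.lam ∧
      ∀ t ∈ Icc 0 T, t ≠ t' → z.u t = D.feedback t (z.x t) (z.lam t) (d t) := by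
  obtain ⟨hx, hu, hl, η, hη, hstate, hadj, hmin⟩ := hz
  obtain ⟨hE, hJ⟩ := h.jump_eq ht' hη
  rw [hE] at hstate
  rw [hJ] at hadj
  have hfb := fun t ht hne => (h.forall_hamiltonian_le_iff ht).1 (hmin t ht hne)
  exact ⟨(h.isBVPSolution_iff ht' hx hl hu hd hfb).2 ⟨hstate, hadj⟩, hfb⟩

theorem isPerturbedTriple_of_isBVPSolution (h : Assumptions k T D) (ht' : t' ∈ Icc 0 T)
    (hd : IntervalIntegrable d volume 0 T) {x lam : ℝ → Vec nx}
    (hs : h.system.IsBVPSolution t' (D.forcing d d0 dT (D.E t' l) (D.J t' l)) x lam) :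
    IsPerturbedTriple D T d d0 dT t' l ⟨x, fun t => D.feedback t (x t) (lam t) (d t), lam⟩ := by
  have hT := h.T_pos.le
  obtain ⟨l₀, hl⟩ := hs.adj
  have hx := hs.state.intervalIntegrable hT
  have hlam := hl.intervalIntegrable hT
  have hu := h.intervalIntegrable_feedback hx hlam hd
  have hη : D.R t' (-(D.R t').inverse (((D.W t')†) l)) + ((D.W t')†) l = 0 := by
    rw [map_neg, apply_inverse_apply k.gamR_pos (h.coerciveR t' ht'), neg_add_cancel]
  obtain ⟨hE, hJ⟩ := h.jump_eq ht' hη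
  obtain ⟨hstate, hadj⟩ := (h.isBVPSolution_iff ht' hx hlam hu hd fun _ _ _ => rfl).1 hs
  rw [← hE] at hstate
  rw [← hJ] at hadj
  exact ⟨hx, hu, hlam, _, hη, hstate, hadj, fun t ht _ => (h.forall_hamiltonian_le_iff ht).2 rfl⟩

theorem exists_isBVPSolution_forcing (h : Assumptions k T D) (ht' : t' ∈ Icc 0 T)
    (hd : IntervalIntegrable d volume 0 T) (d0 : Vec nx) (dT : Vec nd) (p q : Vec nx) :
    ∃ x lam, h.system.IsBVPSolution t' (D.forcing d d0 dT p q) x lam :=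
  h.system.exists_isBVPSolution ht'
    (intervalIntegrable_operator_apply h.T_pos.le h.continuousOn_E hd)
    (intervalIntegrable_operator_apply h.T_pos.le h.continuousOn_J hd)

theorem exists_unique_optimal (h : Assumptions k T D)
    (hd : MemLp d 2 (volume.restrict (Icc 0 T))) (d0 : Vec nx) (dT : Vec nd) :
    ∃ z, IsOptimalTriple D T d d0 dT z ∧
      ∀ z', IsOptimalTriple D T d d0 dT z' → z'.AgreeOn z (Icc 0 T) := by
  have hT := h.T_pos.le
  have h0 : (0 : ℝ) ∈ Icc 0 T := left_mem_Icc.2 hT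
  have hdi := intervalIntegrable_of_memLp hT one_le_two hd
  obtain ⟨x, lam, hs⟩ := h.exists_isBVPSolution_forcing h0 hdi d0 dT 0 0
  refine ⟨_, h.isOptimalTriple_of_isBVPSolution h0 hd hs, fun z hz => ?_⟩
  obtain ⟨hz', hu⟩ := h.isBVPSolution_of_isOptimalTriple h0 hdi hz
  obtain ⟨hx, hlam⟩ := hz'.unique hs h0
  exact ⟨hx, fun t ht => by rw [hu t ht, hx ht, hlam ht], hlam⟩

theorem exists_unique_perturbed (h : Assumptions k T D) (hd : IntervalIntegrable d volume 0 T)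
    (d0 : Vec nx) (dT : Vec nd) (ht' : t' ∈ Icc 0 T) (l : Vec nd) :
    ∃ zp, IsPerturbedTriple D T d d0 dT t' l zp ∧
      ∀ z', IsPerturbedTriple D T d d0 dT t' l z' → z'.AgreeOn zp (Icc 0 T \ {t'}) := by
  obtain ⟨x, lam, hs⟩ := h.exists_isBVPSolution_forcing ht' hd d0 dT (D.E t' l) (D.J t' l)
  refine ⟨_, h.isPerturbedTriple_of_isBVPSolution ht' hd hs, fun z hz => ?_⟩
  obtain ⟨hz', hu⟩ := h.isBVPSolution_of_isPerturbedTriple ht' hd hz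
  obtain ⟨hx, hlam⟩ := hz'.unique hs ht'
  exact ⟨hx.mono sdiff_subset, fun t ht => by rw [hu t ht.1 ht.2, hx ht.1, hlam ht.1],
    hlam.mono sdiff_subset⟩

end Triples

section Perturbation

variable {d : ℝ → Vec nd} {d0 : Vec nx} {dT l : Vec nd} {zp : Trajectory nx nu}

theorem tendsto_state_adjoint (h : Assumptions k T D) (hd : IntervalIntegrable d volume 0 T)
    (ht' : t' ∈ Icc 0 T) (hzp : IsPerturbedTriple D T d d0 dT t' l zp) {φ : ℕ → ℝ → ℝ}
    (hφ : ApproximatesDirac T t' φ) {zn : ℕ → Trajectory nx nu}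
    (hzn : ∀ n, IsOptimalTriple D T (fun t => d t + φ n t • l) d0 dT (zn n))
    (ht : t ∈ Icc 0 T) (hne : t ≠ t') :
    Tendsto (fun n => (zn n).x t) atTop (𝓝 (zp.x t)) ∧
      Tendsto (fun n => (zn n).lam t) atTop (𝓝 (zp.lam t)) := by
  have hdn (n : ℕ) : IntervalIntegrable (fun t => d t + φ n t • l) volume 0 T :=
    hd.add (hφ.intervalIntegrable_smul h.T_pos.le continuousOn_const n)
  have hsub (n : ℕ) := D.forcing_add_smul_sub d d0 dT (φ n) t' l ▸
    (h.isBVPSolution_of_isOptimalTriple ht' (hdn n) (hzn n)).1.sub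
      (h.isBVPSolution_of_isPerturbedTriple ht' hd hzp).1
  have hlim := HamiltonianSystem.IsBVPSolution.tendsto_zero hsub hφ ht'
    (h.continuousOn_E.clm_apply continuousOn_const)
    (h.continuousOn_J.clm_apply continuousOn_const) ht hne
  rwa [tendsto_sub_nhds_zero_iff, tendsto_sub_nhds_zero_iff] at hlim

theorem tendsto_perturbed (h : Assumptions k T D) (hd : IntervalIntegrable d volume 0 T)
    (ht' : t' ∈ Icc 0 T) (hzp : IsPerturbedTriple D T d d0 dT t' l zp) {φ : ℕ → ℝ → ℝ}
    (hφ : ApproximatesDirac T t' φ) {zn : ℕ → Trajectory nx nu}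
    (hzn : ∀ n, IsOptimalTriple D T (fun t => d t + φ n t • l) d0 dT (zn n))
    (ht : t ∈ Icc 0 T) (hne : t ≠ t') :
    Tendsto (fun n => (zn n).x t) atTop (𝓝 (zp.x t)) ∧
      Tendsto (fun n => (zn n).u t) atTop (𝓝 (zp.u t)) ∧
      Tendsto (fun n => (zn n).lam t) atTop (𝓝 (zp.lam t)) := by
  obtain ⟨hx, hlam⟩ := h.tendsto_state_adjoint hd ht' hzp hφ hzn ht hne
  refine ⟨hx, ?_, hlam⟩
  have hφ0 : ∀ᶠ n in atTop, φ n t = 0 :=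
    (hφ.2.2.2 |t - t'| (abs_pos.2 (sub_ne_zero.2 hne))).mono fun n hn => hn t ht le_rfl
  rw [(h.isBVPSolution_of_isPerturbedTriple ht' hd hzp).2 t ht hne]
  refine (((D.continuous_feedback t (d t)).tendsto _).comp (hx.prodMk_nhds hlam)).congr'
    (hφ0.mono fun n hn => ?_)
  have hdn := hd.add (hφ.intervalIntegrable_smul h.T_pos.le (continuousOn_const (c := l)) n)
  simp [(h.isBVPSolution_of_isOptimalTriple ht' hdn (hzn n)).2 t ht, hn]

theorem norm_perturbed_state_adjoint_sub_le (h : Assumptions k T D)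
    (hd : IntervalIntegrable d volume 0 T) (ht' : t' ∈ Icc 0 T) {z : Trajectory nx nu}
    (hz : IsOptimalTriple D T d d0 dT z) (hzp : IsPerturbedTriple D T d d0 dT t' l zp)
    (ht : t ∈ Icc 0 T) :
    ‖zp.x t - z.x t‖ ≤ ‖l‖ * k.LambdaX * Real.exp (-k.rhoZ * |t - t'|) ∧
      ‖zp.lam t - z.lam t‖ ≤
        k.c1 * ‖zp.x t - z.x t‖ + ‖l‖ * k.cv * Real.exp (-k.rhoZ * |t - t'|) := by
  obtain ⟨Z⟩ := h.system.nonempty_fundamental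
  have hdecay := Z.hasDecay h.hasValueBounds
  have hsub := D.forcing_sub_forcing_zero d d0 dT (D.E t' l) (D.J t' l) ▸
    (h.isBVPSolution_of_isPerturbedTriple ht' hd hzp).1.sub
      (h.isBVPSolution_of_isOptimalTriple ht' hd hz).1
  have hp := ContinuousLinearMap.le_of_opNorm_le _ (h.norm_E_le ht') l
  have hq := ContinuousLinearMap.le_of_opNorm_le _ (h.norm_J_le ht') l
  have hc₁ := k.c1_pos
  have hγ := k.gamR_pos
  have hρ := k.rhoZ_pos
  have hv : k.cZ * (k.c1 * ‖D.E t' l‖ + ‖D.J t' l‖) ≤ ‖l‖ * k.cv := by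
    have : 0 ≤ k.cZ := Real.sqrt_nonneg _
    calc _ ≤ k.cZ * (k.c1 * ((k.lamW * k.lamB / k.gamR + k.lamC) * ‖l‖) +
          (k.lamW * k.lamH / k.gamR + k.lamG) * ‖l‖) := by gcongr
      _ = ‖l‖ * k.cv := by rw [Constants.cv]; ring
  refine ⟨(hdecay.norm_state_le (fun t ht => h.norm_N_le ht) ht' hsub ht).trans ?_,
    (hdecay.norm_adjoint_le ht' hsub ht).trans ?_⟩
  · change k.cZ * (k.cZ * (k.c1 * ‖D.E t' l‖ + ‖D.J t' l‖) * (k.lamB ^ 2 / k.gamR) /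
      (2 * k.rhoZ) + ‖D.E t' l‖) * Real.exp (-k.rhoZ * |t - t'|) ≤ _
    have : 0 ≤ k.cZ := Real.sqrt_nonneg _
    calc _ ≤ k.cZ * (‖l‖ * k.cv * (k.lamB ^ 2 / k.gamR) / (2 * k.rhoZ) +
          (k.lamW * k.lamB / k.gamR + k.lamC) * ‖l‖) * Real.exp (-k.rhoZ * |t - t'|) := by gcongr
      _ = ‖l‖ * k.LambdaX * Real.exp (-k.rhoZ * |t - t'|) := by
          rw [Constants.LambdaX]; field_simp; ring
  · exact add_le_add_right (mul_le_mul_of_nonneg_right hv (Real.exp_nonneg _)) _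

theorem norm_perturbed_sub_le (h : Assumptions k T D) (hd : IntervalIntegrable d volume 0 T)
    (ht' : t' ∈ Icc 0 T) {z : Trajectory nx nu} (hz : IsOptimalTriple D T d d0 dT z)
    (hzp : IsPerturbedTriple D T d d0 dT t' l zp) (ht : t ∈ Icc 0 T) (hne : t ≠ t') :
    ‖zp.x t - z.x t‖ + ‖zp.u t - z.u t‖ + ‖zp.lam t - z.lam t‖ ≤
      ‖l‖ * k.Lambda * Real.exp (-k.rhoZ * |t - t'|) := by
  obtain ⟨hx, hlam⟩ := h.norm_perturbed_state_adjoint_sub_le hd ht' hz hzp ht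
  have hu := h.norm_feedback_sub_le ht (zp.x t) (z.x t) (zp.lam t) (z.lam t) (d t)
  rw [← (h.isBVPSolution_of_isPerturbedTriple ht' hd hzp).2 t ht hne,
    ← (h.isBVPSolution_of_isOptimalTriple ht' hd hz).2 t ht] at hu
  have hγ := k.gamR_pos; have hH := k.lamH_pos; have hB := k.lamB_pos; have hc₁ := k.c1_pos
  set ε := Real.exp (-k.rhoZ * |t - t'|)
  calc _ ≤ ‖zp.x t - z.x t‖ + (k.lamH / k.gamR * ‖zp.x t - z.x t‖ +
          k.lamB / k.gamR * ‖zp.lam t - z.lam t‖) + ‖zp.lam t - z.lam t‖ := by gcongr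
    _ = (1 + k.lamH / k.gamR) * ‖zp.x t - z.x t‖ +
          (1 + k.lamB / k.gamR) * ‖zp.lam t - z.lam t‖ := by ring
    _ ≤ (1 + k.lamH / k.gamR) * ‖zp.x t - z.x t‖ +
          (1 + k.lamB / k.gamR) * (k.c1 * ‖zp.x t - z.x t‖ + ‖l‖ * k.cv * ε) := by gcongr
    _ = (1 + k.lamH / k.gamR + k.c1 * (1 + k.lamB / k.gamR)) * ‖zp.x t - z.x t‖ +
          (1 + k.lamB / k.gamR) * (‖l‖ * k.cv * ε) := by ring
    _ ≤ (1 + k.lamH / k.gamR + k.c1 * (1 + k.lamB / k.gamR)) * (‖l‖ * k.LambdaX * ε) +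
          (1 + k.lamB / k.gamR) * (‖l‖ * k.cv * ε) := by gcongr
    _ = ‖l‖ * k.Lambda * ε := by rw [Constants.Lambda]; ring

end Perturbation

end Assumptions

end LQ

theorem mainTheorem4 (k : LQ.Constants) :
    0 < k.rhoZ ∧ 0 < k.Lambda ∧
    ∀ (nx nu nd : ℕ) (T : ℝ) (D : LQ.Data nx nu nd), LQ.Assumptions k T D →
    ∀ (d : ℝ → LQ.Vec nd) (d0 : LQ.Vec nx) (dT : LQ.Vec nd),
      MemLp d 2 (volume.restrict (Icc 0 T)) →
    ∀ t' ∈ Icc 0 T, ∀ l : LQ.Vec nd,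
      -- the unperturbed and the perturbed solution exist and are unique
      (∃ z, LQ.IsOptimalTriple D T d d0 dT z ∧
        ∀ z', LQ.IsOptimalTriple D T d d0 dT z' → z'.AgreeOn z (Icc 0 T)) ∧
      (∃ zp, LQ.IsPerturbedTriple D T d d0 dT t' l zp ∧
        ∀ z', LQ.IsPerturbedTriple D T d d0 dT t' l z' → z'.AgreeOn zp (Icc 0 T \ {t'})) ∧
      -- the perturbed solution is the limit of the optimal solutions for approximate point masses
      (∀ zp, LQ.IsPerturbedTriple D T d d0 dT t' l zp →
        ∀ φ : ℕ → ℝ → ℝ, LQ.ApproximatesDirac T t' φ →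
        ∀ zn : ℕ → LQ.Trajectory nx nu,
          (∀ n, LQ.IsOptimalTriple D T (fun t => d t + φ n t • l) d0 dT (zn n)) →
        ∀ t ∈ Icc 0 T, t ≠ t' →
          Tendsto (fun n => (zn n).x t) atTop (𝓝 (zp.x t)) ∧
          Tendsto (fun n => (zn n).u t) atTop (𝓝 (zp.u t)) ∧
          Tendsto (fun n => (zn n).lam t) atTop (𝓝 (zp.lam t))) ∧
      -- exponential decay of sensitivity
      ∀ z zp, LQ.IsOptimalTriple D T d d0 dT z → LQ.IsPerturbedTriple D T d d0 dT t' l zp →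
        ∀ t ∈ Icc 0 T, t ≠ t' →
          ‖zp.x t - z.x t‖ + ‖zp.u t - z.u t‖ + ‖zp.lam t - z.lam t‖ ≤
            ‖l‖ * k.Lambda * Real.exp (-k.rhoZ * |t - t'|) := by
  refine ⟨k.rhoZ_pos, k.Lambda_pos, fun nx nu nd T D h d d0 dT hd t' ht' l => ?_⟩
  have hdi := LQ.intervalIntegrable_of_memLp h.T_pos.le one_le_two hd
  exact ⟨h.exists_unique_optimal hd d0 dT, h.exists_unique_perturbed hdi d0 dT ht' l,
    fun zp hzp φ hφ zn hzn t ht hne => h.tendsto_perturbed hdi ht' hzp hφ hzn ht hne,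
    fun z zp hz hzp t ht hne => h.norm_perturbed_sub_le hdi ht' hz hzp ht hne⟩
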